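/- Let $n\ge 1$, $0<c_1\le\dots\le c_n$, $\mathbf C=\operatorname{diag}(c_1,\dots,c_n)$, $\mathbf c=(c_1,\dots,c_n)$ and $\beta>0$. Put $\omega(x)=\sum_{i=1}^n\cosh(\beta x_i)$, $\mathcal H=L^2(\mathbb R^n,\omega(x)\,dx)$ (complex-valued functions), $Lf=\Delta f+x^T\mathbf C\nabla f+(\operatorname{tr}\mathbf C)f$, $\mu_{\mathbf 0}(x)=\det(\mathbf C/(2\pi))^{1/2}e^{-\frac12x^T\mathbf Cx}$, $\mu_{\mathbf k}=\nabla^{\mathbf k}\mu_{\mathbf 0}$ for $\mathbf k\in\mathbb N_0^n$, $\Omega_{\beta/2}=\{z\in\mathbb C^n:\sum_i|\operatorname{Im}z_i|<\beta/2\}$, and, for $k\in\mathbb N_0$, \[\mathcal H_k=\Big\{f\in\mathcal H:\int_{\mathbb R^n}f(x)x^{\mathbf k}\,dx=0\text{ for all }\mathbf k\in\mathbb N_0^n\text{ with }|\mathbf k|_1\le k-1\Big\}.\] The Fourier transform is $\hat f(\xi)=\int f(x)e^{-ix\cdot\xi}\,dx$, extended to tempered distributions. Let $\vartheta$ be a (real-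 or complex-valued) tempered distribution on $\mathbb R^n$ satisfying conditions (C): (i) $\hat\vartheta$ is (the restriction to $\mathbb R^n$ of) a bounded analytic function on $\Omega_{\beta/2}$; (ii) $\hat\vartheta(0)=0$; (iii) the function $\xi\mapsto\int_0^1\frac1s\hat\vartheta(\xi^Ts^{\mathbf C})\,ds$, where $\xi^Ts^{\mathbf C}=(s^{c_1}\xi_1,\dots,s^{c_n}\xi_n)$, is analytic in $\Omega_{\beta/2}$ with bounded real part. Let $\Theta f=\vartheta*f$ and $\Psi f=\psi*f$ for $f\in\mathcal H$, where $\psi$ is the tempered distribution with $\hat\psi(\xi)=\exp\big(\int_0^1\frac1s\hat\vartheta(\xi^Ts^{\mathbf C})\,ds\big)$. Then $L|_{C_0^\infty(\mathbb R^n)}$ is closable in $\mathcal H$; let $\mathcal L$ be its closure. $\Theta$ is a bounded operator on $\mathcal H$, $\Psi$ is a bounded bijection of $\mathcal H$ with bounded inverse, $\Psi$ maps $D(\mathcal L)$ onto $D(\mathcal L+\Theta)=D(\mathcal L)$ and $(\mathcal L+\Theta)\Psi=\Psi\mathcal L$. Moreover: (i) $\sigma(\mathcal L+\Theta)=\sigma(\mathcal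 L)=\{-\mathbf c\cdot\mathbf k:\mathbf k\in\mathbb N_0^n\}$. (ii) The functions $\mu_{\mathbf k}$ lie in $\mathcal H$, each $f_{\mathbf k}:=\Psi\mu_{\mathbf k}$ is an eigenfunction of $\mathcal L+\Theta$ with eigenvalue $-\mathbf c\cdot\mathbf k$, and for every $\lambda\in\sigma(\mathcal L+\Theta)$, $\ker(\lambda-(\mathcal L+\Theta))=\operatorname{span}\{f_{\mathbf k}:-\mathbf c\cdot\mathbf k=\lambda\}$. (iii) $\mathcal L+\Theta$ generates a $C_0$-semigroup $(e^{t(\mathcal L+\Theta)})_{t\ge0}$ on $\mathcal H$. For every $k\in\mathbb N_0$, $\mathcal H_k$ is a closed subspace invariant under $\mathcal L+\Theta$ and under the semigroup, the restricted semigroup is the $C_0$-semigroup on $\mathcal H_k$ generated by the restriction of $\mathcal L+\Theta$ to $\mathcal H_k$, and there is a constant $\tilde C_k>0$ with \[\big\|e^{t(\mathcal L+\Theta)}|_{\mathcal H_k}\big\|_{\mathscr B(\mathcal H_k)}\le\tilde C_k\,e^{-tkc_1}\qquad\text{for all }t\ge0.\] -/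

import Mathlib

open MeasureTheory Filter Topology
open scoped SchwartzMap ContDiff NNReal FourierTransform

noncomputable section

namespace FokkerPlanck

/-! Unbounded operators and semigroups on a complex normed space. -/

section Operators

variable {X : Type*} [NormedAddCommGroup X] [NormedSpace ℂ X]

/-- The resolvent set of an unbounded operator: those `ζ` for which `ζ - A : D(A) → X` has a
bounded, everywhere defined two-sided inverse. -/
def resolventSet (A : X →ₗ.[ℂ] X) : Set ℂ :=
  {ζ | ∃ R : X →L[ℂ] X, (∀ x : A.domain, R (ζ • (x : X) - A x) = x) ∧
    ∀ y : X, ∃ h : R y ∈ A.domain, ζ • R y - A ⟨R y, h⟩ = y}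

/-- The spectrum of an unbounded operator. -/
def spectrum (A : X →ₗ.[ℂ] X) : Set ℂ := (resolventSet A)ᶜ

/-- The null space `ker (z - A)`. -/
def eigenspace (A : X →ₗ.[ℂ] X) (z : ℂ) : Submodule ℂ X where
  carrier := {x | (x, z • x) ∈ A.graph}
  zero_mem' := by
    change ((0 : X), z • (0 : X)) ∈ A.graph
    rw [smul_zero]
    exact A.graph.zero_mem
  add_mem' := by
    intro x y hx hy
    simpa [smul_add] using A.graph.add_mem hx hy
  smul_mem' := by
    intro a x hx
    have := A.graph.smul_mem a hx
    simpa [smul_comm a z x] using this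

/-- `Y` is mapped into itself by `A`. -/
def MapsInto (A : X →ₗ.[ℂ] X) (Y : Submodule ℂ X) : Prop :=
  ∀ x : A.domain, (x : X) ∈ Y → A x ∈ Y

/-- The part of `A` in the subspace `Y`; its domain is `{y ∈ D(A) ∩ Y : A y ∈ Y}`, which is
`D(A) ∩ Y` if `A` maps `Y` into itself. -/
def part (A : X →ₗ.[ℂ] X) (Y : Submodule ℂ X) : Y →ₗ.[ℂ] Y where
  domain :=
    { carrier := {y | ∃ h : (y : X) ∈ A.domain, A ⟨y, h⟩ ∈ Y}
      zero_mem' := ⟨A.domain.zero_mem, by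
        have : (⟨((0 : Y) : X), A.domain.zero_mem⟩ : A.domain) = 0 := rfl
        rw [this, A.map_zero]
        exact Y.zero_mem⟩
      add_mem' := by
        rintro a b ⟨ha, ha'⟩ ⟨hb, hb'⟩
        refine ⟨A.domain.add_mem ha hb, ?_⟩
        have : (⟨((a + b : Y) : X), A.domain.add_mem ha hb⟩ : A.domain)
            = ⟨a, ha⟩ + ⟨b, hb⟩ := rfl
        rw [this, A.map_add]
        exact Y.add_mem ha' hb'
      smul_mem' := by
        rintro r a ⟨ha, ha'⟩
        refine ⟨A.domain.smul_mem r ha, ?_⟩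
        have : (⟨((r • a : Y) : X), A.domain.smul_mem r ha⟩ : A.domain) = r • ⟨a, ha⟩ := rfl
        rw [this, A.map_smul]
        exact Y.smul_mem r ha' }
  toFun :=
    { toFun := fun y => ⟨A ⟨y.1, y.2.choose⟩, y.2.choose_spec⟩
      map_add' := by
        intro a b
        apply Subtype.ext
        exact A.map_add ⟨a.1, a.2.choose⟩ ⟨b.1, b.2.choose⟩
      map_smul' := by
        intro r a
        apply Subtype.ext
        exact A.map_smul r ⟨a.1, a.2.choose⟩ }

/-- `T` is a strongly continuous one-parameter semigroup of bounded operators. -/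
structure IsC0Semigroup (T : ℝ≥0 → X →L[ℂ] X) : Prop where
  zero : T 0 = ContinuousLinearMap.id ℂ X
  add : ∀ s t, T (s + t) = (T s).comp (T t)
  continuous : ∀ x, Tendsto (fun t => T t x) (𝓝 0) (𝓝 x)

/-- `A` is the infinitesimal generator of `T`: one has `x ∈ D(A)` and `A x = y` if and only if
`(T t x - x) / t → y` as `t ↓ 0`. -/
def IsGenerator (A : X →ₗ.[ℂ] X) (T : ℝ≥0 → X →L[ℂ] X) : Prop :=
  ∀ x y : X, (x, y) ∈ A.graph ↔
    Tendsto (fun t : ℝ≥0 => (((t : ℝ)⁻¹ : ℝ) : ℂ) • (T t x - x)) (𝓝[>] 0) (𝓝 y)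

end Operators

/-! The exponentially weighted space and the Fokker-Planck operator. -/

/-- `ℝⁿ`. -/
abbrev E (n : ℕ) : Type := EuclideanSpace ℝ (Fin n)

/-- The weight `ω(x) = ∑ cosh (β xᵢ)`. -/
def weight {n : ℕ} (β : ℝ) (x : E n) : ℝ := ∑ i, Real.cosh (β * x i)

/-- The measure `ω(x) dx`. -/
def weightMeasure (n : ℕ) (β : ℝ) : Measure (E n) :=
  volume.withDensity fun x => ENNReal.ofReal (weight β x)

/-- The weighted space `L²(ω)` of complex-valued functions. -/
abbrev WL2 (n : ℕ) (β : ℝ) : Type := Lp ℂ 2 (weightMeasure n β)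

/-- The partial derivative `∂ᵢ`. -/
def pderiv {n : ℕ} (i : Fin n) (g : E n → ℂ) : E n → ℂ :=
  fun x => fderiv ℝ g x (EuclideanSpace.single i 1)

/-- The mixed partial derivative `∇ᵏ = ∂₁^{k₁} ⋯ ∂ₙ^{kₙ}`. -/
def mpderiv {n : ℕ} (k : Fin n → ℕ) (g : E n → ℂ) : E n → ℂ :=
  (List.finRange n).foldr (fun i h => (pderiv i)^[k i] h) g

/-- `L φ = Δ φ + xᵀ C ∇ φ + (tr C) φ` with `C = diag c`, that is `L φ = div (∇ φ + C x φ)`. -/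
def fpExpr {n : ℕ} (c : Fin n → ℝ) (φ : E n → ℂ) : E n → ℂ :=
  fun x => ∑ i, pderiv i (pderiv i φ) x + ∑ i, ((c i * x i : ℝ) : ℂ) * pderiv i φ x
    + ((∑ i, c i : ℝ) : ℂ) * φ x

lemma pderiv_add {n : ℕ} (i : Fin n) {f g : E n → ℂ} (hf : ContDiff ℝ ∞ f)
    (hg : ContDiff ℝ ∞ g) : pderiv i (f + g) = pderiv i f + pderiv i g := by
  funext x
  simp only [pderiv, Pi.add_apply]
  rw [fderiv_add (hf.differentiable (by simp) x) (hg.differentiable (by simp) x)]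
  rfl

lemma pderiv_smul {n : ℕ} (i : Fin n) (a : ℂ) {f : E n → ℂ} (hf : ContDiff ℝ ∞ f) :
    pderiv i (a • f) = a • pderiv i f := by
  funext x
  simp only [pderiv, Pi.smul_apply]
  rw [fderiv_const_smul (hf.differentiable (by simp) x)]
  rfl

lemma contDiff_pderiv {n : ℕ} (i : Fin n) {f : E n → ℂ} (hf : ContDiff ℝ ∞ f) :
    ContDiff ℝ ∞ (pderiv i f) :=
  (hf.fderiv_right (m := ∞) (by simp)).clm_apply contDiff_const

lemma fpExpr_add {n : ℕ} (c : Fin n → ℝ) {f g : E n → ℂ} (hf : ContDiff ℝ ∞ f)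
    (hg : ContDiff ℝ ∞ g) : fpExpr c (f + g) = fpExpr c f + fpExpr c g := by
  funext x
  simp only [fpExpr, pderiv_add _ hf hg, pderiv_add _ (contDiff_pderiv _ hf)
    (contDiff_pderiv _ hg), Pi.add_apply, mul_add, Finset.sum_add_distrib]
  ring

lemma fpExpr_smul {n : ℕ} (c : Fin n → ℝ) (a : ℂ) {f : E n → ℂ} (hf : ContDiff ℝ ∞ f) :
    fpExpr c (a • f) = a • fpExpr c f := by
  funext x
  simp only [fpExpr, pderiv_smul _ a hf, pderiv_smul _ a (contDiff_pderiv _ hf),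
    Pi.smul_apply, smul_eq_mul, mul_add, Finset.mul_sum]
  congr 1
  · congr 1
    exact Finset.sum_congr rfl fun i _ => by ring
  · ring

/-- The graph, in `L²(ω)`, of `L` on the complex-valued test functions `C₀^∞(ℝⁿ)`. -/
def testGraph {n : ℕ} (c : Fin n → ℝ) (β : ℝ) : Submodule ℂ (WL2 n β × WL2 n β) where
  carrier := {p | ∃ φ : E n → ℂ, ContDiff ℝ ∞ φ ∧ HasCompactSupport φ ∧
    p.1 =ᵐ[weightMeasure n β] φ ∧ p.2 =ᵐ[weightMeasure n β] fpExpr c φ}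
  zero_mem' := by
    refine ⟨0, contDiff_const, HasCompactSupport.zero, Lp.coeFn_zero _ _ _, ?_⟩
    have h : fpExpr c (0 : E n → ℂ) = 0 := by
      simpa using fpExpr_smul c 0 (f := (0 : E n → ℂ)) contDiff_const
    rw [h]
    exact Lp.coeFn_zero _ _ _
  add_mem' := by
    rintro p q ⟨φ, hφ, hφs, hp1, hp2⟩ ⟨χ, hχ, hχs, hq1, hq2⟩
    refine ⟨φ + χ, hφ.add hχ, hφs.add hχs, ?_, ?_⟩
    · exact (Lp.coeFn_add _ _).trans (hp1.add hq1)
    · rw [fpExpr_add c hφ hχ]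
      exact (Lp.coeFn_add _ _).trans (hp2.add hq2)
  smul_mem' := by
    rintro a p ⟨φ, hφ, hφs, hp1, hp2⟩
    refine ⟨a • φ, hφ.const_smul a, hφs.smul_left (f := fun _ => a), ?_, ?_⟩
    · exact (Lp.coeFn_smul _ _).trans (hp1.const_smul a)
    · rw [fpExpr_smul c a hφ]
      exact (Lp.coeFn_smul _ _).trans (hp2.const_smul a)

/-- The Fokker-Planck operator `𝓛` in `L²(ω)`: the closure of `L` on `C₀^∞(ℝⁿ)`. -/
def fpOp {n : ℕ} (c : Fin n → ℝ) (β : ℝ) : WL2 n β →ₗ.[ℂ] WL2 n β :=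
  (testGraph c β).topologicalClosure.toLinearPMap

/-- The perturbed operator `𝓛 + Θ`, with domain `D(𝓛)`, for a bounded operator `Θ`. -/
def perturbedOp {n : ℕ} (c : Fin n → ℝ) (β : ℝ) (Θ : WL2 n β →L[ℂ] WL2 n β) :
    WL2 n β →ₗ.[ℂ] WL2 n β :=
  (Θ : WL2 n β →ₗ[ℂ] WL2 n β) +ᵥ fpOp c β

/-- The Gaussian `μ₀(x) = det(C/(2π))^{1/2} exp(-½ xᵀ C x)`. -/
def mu0 {n : ℕ} (c : Fin n → ℝ) : E n → ℂ :=
  fun x => ((Real.sqrt (∏ i, c i / (2 * Real.pi)) *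
    Real.exp (-(1 / 2) * ∑ i, c i * x i ^ 2) : ℝ) : ℂ)

/-- The functions `μ_k = ∇ᵏ μ₀`. -/
def mu {n : ℕ} (c : Fin n → ℝ) (k : Fin n → ℕ) : E n → ℂ := mpderiv k (mu0 c)

/-- The real number `-c·k`, as a complex number. -/
def eigval {n : ℕ} (c : Fin n → ℝ) (k : Fin n → ℕ) : ℂ := ((-∑ i, c i * k i : ℝ) : ℂ)

lemma volume_ac_weightMeasure (n : ℕ) [NeZero n] (β : ℝ) :
    (volume : Measure (E n)) ≪ weightMeasure n β := by
  apply withDensity_absolutelyContinuous'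
  · apply Measurable.aemeasurable
    unfold weight
    fun_prop
  · refine Eventually.of_forall fun x => ?_
    have : 0 < weight β x :=
      Finset.sum_pos (fun i _ => Real.cosh_pos _) Finset.univ_nonempty
    simpa using this

/-- The monomial `xˡ`. -/
def monom {n : ℕ} (l : Fin n → ℕ) (x : E n) : ℂ := ((∏ i, x i ^ l i : ℝ) : ℂ)

/-- The subspace `𝓗_k` of all `f ∈ L²(ω)` whose moments of order at most `k - 1` exist (which
is automatic for `β > 0`) and vanish. -/
def momentSpace (n : ℕ) [NeZero n] (β : ℝ) (k : ℕ) : Submodule ℂ (WL2 n β) where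
  carrier := {f | ∀ l : Fin n → ℕ, ∑ i, l i < k →
    Integrable (fun x => f x * monom l x) ∧ ∫ x, f x * monom l x = 0}
  zero_mem' := by
    intro l _
    have h : (fun x => (0 : WL2 n β) x * monom l x) =ᵐ[volume] fun _ => 0 := by
      filter_upwards [(volume_ac_weightMeasure n β).ae_le (Lp.coeFn_zero ℂ 2 _)] with x hx
      simp only [hx, Pi.zero_apply, zero_mul]
    exact ⟨(integrable_zero _ _ _).congr h.symm, by rw [integral_congr_ae h]; simp⟩
  add_mem' := by
    intro f g hf hg l hl
    have h : (fun x => (f + g) x * monom l x) =ᵐ[volume]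
        fun x => f x * monom l x + g x * monom l x := by
      filter_upwards [(volume_ac_weightMeasure n β).ae_le (Lp.coeFn_add f g)] with x hx
      simp only [hx, Pi.add_apply, add_mul]
    obtain ⟨hf1, hf2⟩ := hf l hl
    obtain ⟨hg1, hg2⟩ := hg l hl
    refine ⟨(hf1.add hg1).congr h.symm, ?_⟩
    rw [integral_congr_ae h, integral_add hf1 hg1, hf2, hg2, add_zero]
  smul_mem' := by
    intro a f hf l hl
    have h : (fun x => (a • f) x * monom l x) =ᵐ[volume]
        fun x => a * (f x * monom l x) := by
      filter_upwards [(volume_ac_weightMeasure n β).ae_le (Lp.coeFn_smul a f)] with x hx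
      simp only [hx, Pi.smul_apply, smul_eq_mul, mul_assoc]
    obtain ⟨hf1, hf2⟩ := hf l hl
    refine ⟨(hf1.const_mul a).congr h.symm, ?_⟩
    rw [integral_congr_ae h, integral_const_mul, hf2, mul_zero]

/-! Fourier transform and convolution. -/

/-- The dilation `x ↦ (2π)⁻¹ x` of `ℝⁿ`. -/
def dilation (n : ℕ) : E n ≃L[ℝ] E n :=
  ContinuousLinearEquiv.smulLeft (Units.mk0 (2 * Real.pi)⁻¹ (by positivity))

/-- The Fourier transform `(𝓕 φ)(ξ) = ∫ φ(x) exp(-i x·ξ) dx` on Schwartz functions. -/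
def schwartzFourier (n : ℕ) : 𝓢(E n, ℂ) →L[ℂ] 𝓢(E n, ℂ) :=
  (SchwartzMap.compCLMOfContinuousLinearEquiv ℂ (dilation n)).comp
    (SchwartzMap.fourierTransformCLM ℂ)

lemma schwartzFourier_apply {n : ℕ} (φ : 𝓢(E n, ℂ)) (ξ : E n) :
    schwartzFourier n φ ξ = ∫ x, φ x * Complex.exp (-Complex.I * ((∑ i, x i * ξ i : ℝ) : ℂ)) := by
  have h : schwartzFourier n φ ξ = 𝓕 (φ : E n → ℂ) ((2 * Real.pi)⁻¹ • ξ) := rfl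
  rw [h, Real.fourier_eq']
  refine integral_congr_ae (Eventually.of_forall fun x => ?_)
  simp only [smul_eq_mul]
  rw [mul_comm]
  congr 2
  have h2 : inner ℝ x ((2 * Real.pi)⁻¹ • ξ) = (2 * Real.pi)⁻¹ * ∑ i, x i * ξ i := by
    rw [inner_smul_right, PiLp.inner_apply]
    congr 1
    exact Finset.sum_congr rfl fun i _ => by simp [mul_comm]
  rw [h2]
  have hpi : (Real.pi : ℂ) ≠ 0 := by exact_mod_cast Real.pi_ne_zero
  push_cast
  field_simp

/-- The Fourier transform of the tempered distribution `T`, defined by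
`⟨𝓕 T, φ⟩ = ⟨T, 𝓕 φ⟩`, is the (bounded, measurable) function `m`. -/
def HasFourier {n : ℕ} (T : 𝓢'(E n, ℂ)) (m : E n → ℂ) : Prop :=
  ∀ φ : 𝓢(E n, ℂ), T (schwartzFourier n φ) = ∫ ξ, m ξ * φ ξ

/-- `h = T * f`, the convolution of a tempered distribution `T` with a function `f` all of whose
moments are finite: `⟨T * f, φ⟩ = ⟨T, g⟩` for all Schwartz functions `φ`, where `g` is the
Schwartz function `g(x) = ∫ f(y) φ(x + y) dy`. -/
def IsConvolution {n : ℕ} (T : 𝓢'(E n, ℂ)) (f h : E n → ℂ) : Prop :=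
  ∀ φ : 𝓢(E n, ℂ), ∃ g : 𝓢(E n, ℂ), (∀ x, g x = ∫ y, f y * φ (x + y)) ∧
    ∫ x, h x * φ x = T g

/-- The tube `Ω_{β/2} = {z ∈ ℂⁿ : |Im z|₁ < β/2}`. -/
def tube (n : ℕ) (β : ℝ) : Set (Fin n → ℂ) := {z | ∑ i, |(z i).im| < β / 2}

/-- The inclusion `ℝⁿ ⊆ ℂⁿ`. -/
def toComplex {n : ℕ} (ξ : E n) : Fin n → ℂ := fun i => (ξ i : ℂ)

/-- The function `ξ ↦ ∫₀¹ s⁻¹ F(ξᵀ s^C) ds`, where `(ξᵀ s^C)ᵢ = s^{cᵢ} ξᵢ`. -/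
def logSymbol {n : ℕ} (c : Fin n → ℝ) (F : (Fin n → ℂ) → ℂ) (z : Fin n → ℂ) : ℂ :=
  ∫ s in (0 : ℝ)..1, ((s⁻¹ : ℝ) : ℂ) * F fun i => ((s ^ c i : ℝ) : ℂ) * z i

/-- Conditions (C) on a convolution kernel `θ` whose Fourier transform extends to the function
`F` on the tube. -/
structure KernelCondition {n : ℕ} (c : Fin n → ℝ) (β : ℝ) (θ : 𝓢'(E n, ℂ))
    (F : (Fin n → ℂ) → ℂ) : Prop where
  fourier : HasFourier θ fun ξ => F (toComplex ξ)
  analytic : AnalyticOnNhd ℂ F (tube n β)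
  bounded : ∃ M : ℝ, ∀ z ∈ tube n β, ‖F z‖ ≤ M
  massless : F 0 = 0
  log_analytic : AnalyticOnNhd ℂ (logSymbol c F) (tube n β)
  log_re_bounded : ∃ M : ℝ, ∀ z ∈ tube n β, |(logSymbol c F z).re| ≤ M

/-- The symbol `ψ̂(ξ) = exp (∫₀¹ s⁻¹ F(ξᵀ s^C) ds)`. -/
def psiSymbol {n : ℕ} (c : Fin n → ℝ) (F : (Fin n → ℂ) → ℂ) (z : Fin n → ℂ) : ℂ :=
  Complex.exp (logSymbol c F z)

end FokkerPlanck

end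

/-! Everything is read off the Fourier-Laplace transform `FL f z = ∫ f(x) exp(-i x·z) dx`. An
element of L²(ω) is square integrable against exp(β|x|_∞), so its transform lives on the tube |Im
z|₁ < β/2. Since ω is a sum of cosh(β xᵢ), Plancherel's theorem on the shifted spaces ℝⁿ + i b eᵢ
makes the norm of L²(ω) equivalent to the supremum, over i and |b| < β/2, of the L² norms of the
transform there (`lintegral_FL_linePt`, `norm_le_of_lintegral_le`). A Paley-Wiener theorem
(`TubeDecay.exists_FL_eq`) and the density of polynomials times Gaussians (`dense_span_muL`) then
turn every bounded analytic function on the tube into the symbol of a bounded operator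
(`exists_multiplier`). With ℓ = `logSymbol c F`, the symbols F, exp ℓ and exp(-ℓ) yield Θ, Ψ and
Ψ⁻¹.

On the Fourier side L is the first-order operator -|ξ|² - ∑ cᵢ ξᵢ ∂ᵢ. Its characteristics ξ ↦
e^{-tC} ξ give the semigroup in closed form: a Gaussian factor times f̂(e^{-tC} ξ) (`ou`). The μ_k
are eigenfunctions. The space 𝓗_k consists of the functions whose transform vanishes to order k at
0; for these f̂(e^{-tC} ξ) is of size e^{-t k c₁} |ξ|^k, and the Gaussian factor absorbs the growth
in ξ. This is the decay on 𝓗_k (`exists_norm_ou_le_of_mem`).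

The μ_l with |l| < k span a complement of 𝓗_k (`exists_sub_sum_muL_mem`). For Re z > -k c₁ the
resolvent equation is solved by a Laplace transform on 𝓗_k and by division on the complement. As k
is arbitrary, this determines the whole spectrum and all eigenspaces (`exists_mem_genGraph_ou`,
`mem_span_of_mem_genGraph_ou`). The closure of L on test functions is the generator of `ou`, because
cutoffs put the μ_k into its domain and their span is a core (`topologicalClosure_testGraph`).

For the perturbation, the substitution r = e^{-s} in the integral defining ℓ shows that ℓ(e^{-sC} ξ)
has s-derivative -F(e^{-sC} ξ) (`hasDerivAt_logSymbol`). Hence conjugation by the multiplier exp ℓ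
adds precisely the multiplier F to the generator: (𝓛 + Θ)Ψ = Ψ𝓛. Spectrum, eigenspaces and semigroup
are carried over by this similarity, and Ψ preserves each 𝓗_k since its symbol is continuous at 0.
-/

noncomputable section

namespace FokkerPlanck

/-! ### The weighted space -/

section Weighted

variable {n : ℕ} {β : ℝ}

/-- The supremum norm of `x`. -/
def supn (x : E n) : ℝ := ‖(WithLp.ofLp x : Fin n → ℝ)‖

lemma supn_nonneg (x : E n) : 0 ≤ supn x := norm_nonneg _

lemma abs_le_supn (x : E n) (i : Fin n) : |x i| ≤ supn x :=
  norm_le_pi_norm (WithLp.ofLp x : Fin n → ℝ) i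

lemma continuous_supn : Continuous (supn (n := n)) :=
  (PiLp.continuous_ofLp 2 _).norm

lemma exists_supn_eq [NeZero n] (x : E n) : ∃ i, supn x = |x i| := by
  obtain ⟨i, _, hi⟩ := Finset.exists_max_image (Finset.univ : Finset (Fin n)) (fun i => |x i|)
    Finset.univ_nonempty
  refine ⟨i, le_antisymm ?_ (abs_le_supn x i)⟩
  exact (pi_norm_le_iff_of_nonneg (abs_nonneg _)).2 fun j => hi j (Finset.mem_univ j)

lemma norm_le_supn (x : E n) : ‖x‖ ≤ n * supn x := by
  have h : ‖x‖ ≤ ∑ i, |x i| := by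
    rw [EuclideanSpace.norm_eq]
    apply Real.sqrt_le_iff.2
    refine ⟨Finset.sum_nonneg fun i _ => abs_nonneg _, ?_⟩
    simp only [Real.norm_eq_abs]
    exact Finset.sum_sq_le_sq_sum_of_nonneg fun i _ => abs_nonneg _
  refine h.trans ((Finset.sum_le_sum fun j _ => abs_le_supn x j).trans ?_)
  simp

lemma supn_le_norm (x : E n) : supn x ≤ ‖x‖ :=
  (pi_norm_le_iff_of_nonneg (norm_nonneg _)).2 fun i => PiLp.norm_apply_le x i

lemma integrable_exp_neg_norm {δ : ℝ} (hδ : 0 < δ) :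
    Integrable (fun x : E n => Real.exp (-δ * ‖x‖)) := by
  have h := integrable_one_add_norm (E := E n) (μ := volume) (r := ((n + 1 : ℕ) : ℝ))
    (by simp)
  refine (h.const_mul ((n + 1).factorial * Real.exp δ / δ ^ (n + 1))).mono'
    (by fun_prop) (Eventually.of_forall fun x => ?_)
  have h1 : (0 : ℝ) < 1 + ‖x‖ := by positivity
  have h2 := Real.pow_div_factorial_le_exp (δ * (1 + ‖x‖)) (by positivity) (n + 1)
  rw [Real.norm_of_nonneg (Real.exp_pos _).le, Real.rpow_neg h1.le, Real.rpow_natCast]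
  rw [div_le_iff₀ (by positivity), mul_pow] at h2
  rw [neg_mul, Real.exp_neg, ← div_eq_mul_inv, div_div, inv_eq_one_div,
    div_le_div_iff₀ (Real.exp_pos _) (by positivity)]
  have : Real.exp (δ * (1 + ‖x‖)) = Real.exp δ * Real.exp (δ * ‖x‖) := by
    rw [← Real.exp_add]; ring_nf
  rw [this] at h2
  linarith

lemma integrable_exp_neg_supn {δ : ℝ} (hδ : 0 < δ) :
    Integrable (fun x : E n => Real.exp (-δ * supn x)) := by
  rcases Nat.eq_zero_or_pos n with rfl | hn
  · refine (integrable_exp_neg_norm (n := 0) hδ).congr (Eventually.of_forall fun x => ?_)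
    have h1 : ‖x‖ = 0 := by rw [Subsingleton.elim x 0, norm_zero]
    have h2 : supn x = 0 := le_antisymm (h1 ▸ supn_le_norm x) (supn_nonneg x)
    simp only [h1, h2]
  have hn' : (0 : ℝ) < n := by exact_mod_cast hn
  refine (integrable_exp_neg_norm (n := n) (δ := δ / n) (by positivity)).mono'
    (by have := continuous_supn (n := n); fun_prop) (Eventually.of_forall fun x => ?_)
  rw [Real.norm_of_nonneg (Real.exp_pos _).le]
  apply Real.exp_le_exp.2
  have := norm_le_supn x
  have h2 : δ / n * ‖x‖ ≤ δ / n * (n * supn x) := by gcongr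
  have h3 : δ / n * (n * supn x) = δ * supn x := by field_simp
  linarith

lemma weight_pos [NeZero n] (x : E n) : 0 < weight β x :=
  Finset.sum_pos (fun _ _ => Real.cosh_pos _) Finset.univ_nonempty

lemma continuous_weight : Continuous (weight (n := n) β) := by
  unfold weight
  fun_prop

/-- Together with `weight_le_exp`, this makes ω comparable with exp(β|x|_∞). The sup norm is used
because it is dual to the ℓ¹ norm of Im z which defines the tube. -/
lemma exp_supn_le_weight [NeZero n] (x : E n) :
    Real.exp (β * supn x) ≤ 2 * weight β x := by
  obtain ⟨i, hi⟩ := exists_supn_eq x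
  have h1 : Real.cosh (β * x i) ≤ weight β x :=
    Finset.single_le_sum (f := fun i => Real.cosh (β * x i)) (fun i _ => (Real.cosh_pos _).le)
      (Finset.mem_univ i)
  have h2 : Real.exp (β * |x i|) ≤ 2 * Real.cosh (β * x i) := by
    rw [Real.cosh_eq]
    rcases abs_cases (x i) with ⟨h, _⟩ | ⟨h, _⟩ <;> rw [h]
    · linarith [Real.exp_pos (-(β * x i))]
    · rw [mul_neg]
      linarith [Real.exp_pos (β * x i)]
  rw [hi]
  linarith

lemma weight_le_exp (hβ : 0 ≤ β) (x : E n) : weight β x ≤ n * Real.exp (β * supn x) := by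
  have (i : Fin n) : Real.cosh (β * x i) ≤ Real.exp (β * supn x) := by
    rw [← Real.cosh_abs, Real.cosh_eq, abs_mul, abs_of_nonneg hβ]
    have h1 : Real.exp (β * |x i|) ≤ Real.exp (β * supn x) :=
      Real.exp_le_exp.2 (mul_le_mul_of_nonneg_left (abs_le_supn x i) hβ)
    have h2 : Real.exp (-(β * |x i|)) ≤ Real.exp (β * supn x) := by
      apply Real.exp_le_exp.2
      have := mul_nonneg hβ (supn_nonneg x)
      have := mul_nonneg hβ (abs_nonneg (x i))
      linarith
    linarith
  refine (Finset.sum_le_sum fun i _ => this i).trans ?_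
  simp

lemma weightMeasure_ac_volume : weightMeasure n β ≪ (volume : Measure (E n)) :=
  withDensity_absolutelyContinuous _ _

lemma ae_volume_of_ae_weight [NeZero n] {p : E n → Prop} (h : ∀ᵐ x ∂(weightMeasure n β), p x) :
    ∀ᵐ x, p x := (volume_ac_weightMeasure n β).ae_le h

lemma aestronglyMeasurable_volume [NeZero n] (f : WL2 n β) :
    AEStronglyMeasurable (f : E n → ℂ) volume :=
  (Lp.aestronglyMeasurable f).mono_ac (volume_ac_weightMeasure n β)

lemma integrable_weightMeasure_iff {g : E n → ℝ} :
    Integrable g (weightMeasure n β) ↔ Integrable (fun x => weight β x * g x) := by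
  rw [weightMeasure, integrable_withDensity_iff_integrable_smul' (by
    exact continuous_weight.measurable.ennreal_ofReal) (by simp)]
  refine integrable_congr (Eventually.of_forall fun x => ?_)
  simp only [smul_eq_mul]
  rw [ENNReal.toReal_ofReal]
  exact Finset.sum_nonneg fun i _ => (Real.cosh_pos _).le

lemma integral_weightMeasure (g : E n → ℝ) :
    ∫ x, g x ∂(weightMeasure n β) = ∫ x, weight β x * g x := by
  rw [weightMeasure, integral_withDensity_eq_integral_toReal_smul (by
    exact continuous_weight.measurable.ennreal_ofReal) (by simp)]
  refine integral_congr_ae (Eventually.of_forall fun x => ?_)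
  simp only [smul_eq_mul]
  rw [ENNReal.toReal_ofReal]
  exact Finset.sum_nonneg fun i _ => (Real.cosh_pos _).le

lemma integrable_weight_sq (f : WL2 n β) : Integrable (fun x => weight β x * ‖f x‖ ^ 2) :=
  integrable_weightMeasure_iff.1 <|
    (memLp_two_iff_integrable_sq_norm (Lp.aestronglyMeasurable f)).1 (Lp.memLp f)

lemma norm_sq_eq (f : WL2 n β) : ‖f‖ ^ 2 = ∫ x, weight β x * ‖f x‖ ^ 2 := by
  rw [← integral_weightMeasure]
  have h := L2.inner_def (𝕜 := ℂ) f f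
  simp only [inner_self_eq_norm_sq_to_K] at h
  have h2 : ((‖f‖ ^ 2 : ℝ) : ℂ) = ((∫ x, ‖f x‖ ^ 2 ∂(weightMeasure n β) : ℝ) : ℂ) := by
    rw [← integral_complex_ofReal]
    push_cast
    exact h
  exact_mod_cast h2

/-- Exponentially weighted integrals of elements of `L²(ω)` below the critical rate. -/
lemma exists_integral_exp_le [NeZero n] {r : ℝ} (hr : r < β / 2) :
    ∃ K : ℝ, 0 < K ∧ ∀ f : WL2 n β,
      Integrable (fun x => ‖f x‖ * Real.exp (r * supn x)) ∧
      ∫ x, ‖f x‖ * Real.exp (r * supn x) ≤ K * ‖f‖ := by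
  have hδ : 0 < β - 2 * r := by linarith
  have hI := integrable_exp_neg_supn (n := n) hδ
  set J := ∫ x : E n, Real.exp (-(β - 2 * r) * supn x) with hJ
  have hJ0 : 0 ≤ J := integral_nonneg fun x => (Real.exp_pos _).le
  -- Young's inequality with a free parameter: t = 1 gives integrability, and t = 1/‖f‖ gives a
  -- bound linear in ‖f‖.
  have key : ∀ f : WL2 n β, ∀ t : ℝ, 0 < t → ∀ x, ‖f x‖ * Real.exp (r * supn x) ≤
      t * (weight β x * ‖f x‖ ^ 2) + t⁻¹ * Real.exp (-(β - 2 * r) * supn x) := by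
    intro f t ht x
    have h1 := exp_supn_le_weight (β := β) x
    set a := ‖f x‖
    set u := Real.exp (β / 2 * supn x)
    set v := Real.exp (-(β - 2 * r) / 2 * supn x)
    have hu : Real.exp (β * supn x) = u ^ 2 := by rw [← Real.exp_nat_mul]; push_cast; ring_nf
    have hv : Real.exp (-(β - 2 * r) * supn x) = v ^ 2 := by
      rw [← Real.exp_nat_mul]; push_cast; ring_nf
    have huv : Real.exp (r * supn x) = u * v := by rw [← Real.exp_add]; ring_nf
    rw [hv, huv]
    have h2 : t * (u ^ 2 / 2 * a ^ 2) ≤ t * (weight β x * a ^ 2) := by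
      gcongr
      linarith
    refine le_trans ?_ (add_le_add_left h2 _)
    have h3 : 0 ≤ t⁻¹ * ((t * (u * a) - v) ^ 2 + v ^ 2) := by positivity
    have h4 : t⁻¹ * ((t * (u * a) - v) ^ 2 + v ^ 2)
        = t * (u ^ 2 * a ^ 2) - 2 * (a * (u * v)) + 2 * (t⁻¹ * v ^ 2) := by
      field_simp
      ring
    linarith
  have hint : ∀ f : WL2 n β, Integrable (fun x => ‖f x‖ * Real.exp (r * supn x)) := fun f => by
    refine Integrable.mono' (((integrable_weight_sq f).const_mul 1).add (hI.const_mul 1⁻¹)) ?_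
      (Eventually.of_forall fun x => ?_)
    · have := continuous_supn (n := n)
      exact (aestronglyMeasurable_volume f).norm.mul (by fun_prop)
    · rw [Real.norm_of_nonneg (by positivity)]
      exact key f 1 one_pos x
  refine ⟨1 + J, by positivity, fun f => ⟨hint f, ?_⟩⟩
  rcases eq_or_lt_of_le (norm_nonneg f) with h0 | h0
  · have hf : f = 0 := norm_eq_zero.1 h0.symm
    have : ∀ᵐ x, ‖f x‖ * Real.exp (r * supn x) = 0 := by
      filter_upwards [ae_volume_of_ae_weight (hf ▸ Lp.coeFn_zero ℂ 2 _)] with x hx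
      rw [hx]
      simp
    rw [integral_congr_ae this]
    simp [hf]
  · have h1 := integral_mono (hint f)
      (((integrable_weight_sq f).const_mul (‖f‖⁻¹)).add (hI.const_mul (‖f‖⁻¹)⁻¹))
      (fun x => key f (‖f‖⁻¹) (by positivity) x)
    simp only [Pi.add_apply] at h1
    rw [integral_add ((integrable_weight_sq f).const_mul _) (hI.const_mul _),
      integral_const_mul, integral_const_mul, ← norm_sq_eq, inv_inv, ← hJ] at h1
    have : ‖f‖⁻¹ * ‖f‖ ^ 2 = ‖f‖ := by field_simp
    linarith

lemma memLp_of_integrable {h : E n → ℂ} (hm : AEStronglyMeasurable h)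
    (hi : Integrable (fun x => weight β x * ‖h x‖ ^ 2)) : MemLp h 2 (weightMeasure n β) :=
  (memLp_two_iff_integrable_sq_norm (hm.mono_ac weightMeasure_ac_volume)).2
    (integrable_weightMeasure_iff.2 hi)

lemma exp_le_two_weight [NeZero n] {b : ℝ} (hb : 2 * |b| ≤ β) (i : Fin n) (x : E n) :
    Real.exp (2 * b * x i) ≤ 2 * weight β x := by
  refine le_trans (Real.exp_le_exp.2 ?_) (exp_supn_le_weight x)
  calc 2 * b * x i ≤ |2 * b * x i| := le_abs_self _
    _ = 2 * |b| * |x i| := by rw [abs_mul, abs_mul]; norm_num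
    _ ≤ β * supn x := mul_le_mul hb (abs_le_supn x i) (abs_nonneg _)
        ((by positivity : 0 ≤ 2 * |b|).trans hb)

lemma integrable_exp_sq [NeZero n] {b : ℝ} (hb : 2 * |b| ≤ β) (i : Fin n) (f : WL2 n β) :
    Integrable (fun x => Real.exp (2 * b * x i) * ‖f x‖ ^ 2) := by
  refine ((integrable_weight_sq f).const_mul 2).mono'
    (AEStronglyMeasurable.mul (by fun_prop) ((aestronglyMeasurable_volume f).norm.pow 2))
    (Eventually.of_forall fun x => ?_)
  rw [Real.norm_of_nonneg (by positivity), ← mul_assoc]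
  gcongr
  exact exp_le_two_weight hb i x

lemma integral_exp_sq_le [NeZero n] {b : ℝ} (hb : 2 * |b| ≤ β) (i : Fin n) (f : WL2 n β) :
    ∫ x, Real.exp (2 * b * x i) * ‖f x‖ ^ 2 ≤ 2 * ‖f‖ ^ 2 := by
  rw [norm_sq_eq, ← integral_const_mul]
  refine integral_mono (integrable_exp_sq hb i f) ((integrable_weight_sq f).const_mul 2)
    fun x => ?_
  rw [← mul_assoc]
  gcongr
  exact exp_le_two_weight hb i x

/-- A function is in `L²(ω)` if its exponentially weighted `L²` norms are bounded uniformly below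
the critical rate. -/
lemma exists_mem_of_lintegral_le [NeZero n] (hβ : 0 < β) {h : E n → ℂ}
    (hm : AEStronglyMeasurable h) {K : ℝ} (hK0 : 0 ≤ K)
    (hK : ∀ (i : Fin n) (b : ℝ), 2 * |b| < β →
      ∫⁻ x, ENNReal.ofReal (Real.exp (2 * b * x i) * ‖h x‖ ^ 2) ≤ ENNReal.ofReal K) :
    ∃ f : WL2 n β, f =ᵐ[volume] h ∧ ‖f‖ ≤ Real.sqrt (n * K) := by
  -- The hypothesis stops short of the critical rate β/2. The rates s j * (β/2) increase to it, and
  -- Fatou's lemma carries the bound to the limit.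
  let s : ℕ → ℝ := fun j => 1 - 1 / ((j : ℝ) + 1)
  have hs0 : ∀ j, 0 ≤ s j := fun j => by
    have : (1 : ℝ) / (j + 1) ≤ 1 := by
      rw [div_le_one (by positivity)]
      linarith [Nat.cast_nonneg (α := ℝ) j]
    simp only [s]
    linarith
  have hs1 : ∀ j, s j < 1 := fun j => by
    have : (0 : ℝ) < 1 / (j + 1) := by positivity
    simp only [s]
    linarith
  have hs : Tendsto s atTop (𝓝 1) := by
    have := (tendsto_const_nhds (x := (1 : ℝ))).sub
      (tendsto_one_div_add_atTop_nhds_zero_nat (𝕜 := ℝ))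
    rwa [sub_zero] at this
  have hexp : ∀ i : Fin n, ∀ ε : ℝ, |ε| = 1 →
      ∫⁻ x, ENNReal.ofReal (Real.exp (ε * (β * x i)) * ‖h x‖ ^ 2) ≤ ENNReal.ofReal K := by
    intro i ε hε
    have hlim : ∀ x : E n, Tendsto (fun j => ENNReal.ofReal
        (Real.exp (2 * (ε * (s j * (β / 2))) * x i) * ‖h x‖ ^ 2)) atTop
        (𝓝 (ENNReal.ofReal (Real.exp (ε * (β * x i)) * ‖h x‖ ^ 2))) := by
      intro x
      apply ENNReal.tendsto_ofReal
      apply Tendsto.mul_const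
      apply (Real.continuous_exp.tendsto _).comp
      have := (((hs.mul_const (β / 2)).const_mul ε).const_mul 2).mul_const (x i)
      convert this using 2
      ring
    calc ∫⁻ x, ENNReal.ofReal (Real.exp (ε * (β * x i)) * ‖h x‖ ^ 2)
        = ∫⁻ x, liminf (fun j => ENNReal.ofReal
            (Real.exp (2 * (ε * (s j * (β / 2))) * x i) * ‖h x‖ ^ 2)) atTop := by
          refine lintegral_congr fun x => ?_
          rw [(hlim x).liminf_eq]
      _ ≤ liminf (fun j => ∫⁻ x, ENNReal.ofReal
            (Real.exp (2 * (ε * (s j * (β / 2))) * x i) * ‖h x‖ ^ 2)) atTop := by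
          refine lintegral_liminf_le' fun j => ?_
          exact (AEMeasurable.mul (by fun_prop)
            (hm.norm.aemeasurable.pow_const 2)).ennreal_ofReal
      _ ≤ liminf (fun _ : ℕ => ENNReal.ofReal K) atTop := by
          refine liminf_le_liminf (Eventually.of_forall fun j => hK i _ ?_)
          rw [abs_mul, hε, abs_mul, abs_of_nonneg (hs0 j), abs_of_pos (by positivity)]
          nlinarith [hs1 j]
      _ = ENNReal.ofReal K := by simp
  -- Each cosh is the mean of the two critical exponentials, so each of the n summands of the weight
  -- contributes at most K.
  have hw : ∫⁻ x, ENNReal.ofReal (weight β x * ‖h x‖ ^ 2) ≤ ENNReal.ofReal (n * K) := by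
    have : ∀ x : E n, ENNReal.ofReal (weight β x * ‖h x‖ ^ 2) = ∑ i,
        ENNReal.ofReal (1 / 2) * (ENNReal.ofReal (Real.exp (1 * (β * x i)) * ‖h x‖ ^ 2)
          + ENNReal.ofReal (Real.exp (-1 * (β * x i)) * ‖h x‖ ^ 2)) := by
      intro x
      simp_rw [← ENNReal.ofReal_add (by positivity : 0 ≤ Real.exp (1 * (β * x _)) * ‖h x‖ ^ 2)
        (by positivity : 0 ≤ Real.exp (-1 * (β * x _)) * ‖h x‖ ^ 2),
        ← ENNReal.ofReal_mul (by norm_num : (0 : ℝ) ≤ 1 / 2)]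
      rw [← ENNReal.ofReal_sum_of_nonneg (fun i _ => by positivity), weight, Finset.sum_mul]
      congr 1
      refine Finset.sum_congr rfl fun i _ => ?_
      rw [Real.cosh_eq, one_mul, neg_one_mul]
      ring
    simp_rw [this]
    have hmeas : ∀ (i : Fin n) (ε : ℝ),
        AEMeasurable (fun x : E n => ENNReal.ofReal (Real.exp (ε * (β * x i)) * ‖h x‖ ^ 2)) :=
      fun i ε => (AEMeasurable.mul (by fun_prop)
        (hm.norm.aemeasurable.pow_const 2)).ennreal_ofReal
    have hsum : ∀ i : Fin n, AEMeasurable (fun x : E n => ENNReal.ofReal (1 / 2) *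
        (ENNReal.ofReal (Real.exp (1 * (β * x i)) * ‖h x‖ ^ 2)
          + ENNReal.ofReal (Real.exp (-1 * (β * x i)) * ‖h x‖ ^ 2))) :=
      fun i => ((hmeas i 1).add (hmeas i (-1))).const_mul _
    rw [lintegral_finsetSum' _ fun i _ => hsum i]
    calc _ ≤ ∑ _i : Fin n, ENNReal.ofReal K := by
          refine Finset.sum_le_sum fun i _ => ?_
          rw [lintegral_const_mul' _ _ ENNReal.ofReal_ne_top, lintegral_add_left' (hmeas i 1)]
          calc _ ≤ ENNReal.ofReal (1 / 2) * (ENNReal.ofReal K + ENNReal.ofReal K) := by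
                gcongr
                · exact hexp i 1 (by simp)
                · exact hexp i (-1) (by simp)
            _ = ENNReal.ofReal K := by
                rw [← ENNReal.ofReal_add hK0 hK0, ← ENNReal.ofReal_mul (by norm_num)]
                congr 1
                ring
      _ = ENNReal.ofReal (n * K) := by
          rw [← ENNReal.ofReal_sum_of_nonneg fun _ _ => hK0]
          simp
  have hmw : AEStronglyMeasurable (fun x => weight β x * ‖h x‖ ^ 2) :=
    continuous_weight.aestronglyMeasurable.mul (hm.norm.pow 2)
  have hpos : ∀ x : E n, 0 ≤ weight β x * ‖h x‖ ^ 2 := fun x =>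
    mul_nonneg (weight_pos x).le (by positivity)
  have hint : Integrable (fun x => weight β x * ‖h x‖ ^ 2) := by
    refine ⟨hmw, ?_⟩
    rw [hasFiniteIntegral_iff_ofReal (Eventually.of_forall hpos)]
    exact hw.trans_lt ENNReal.ofReal_lt_top
  have hL := memLp_of_integrable hm hint
  have hae : (hL.toLp h : E n → ℂ) =ᵐ[volume] h := ae_volume_of_ae_weight hL.coeFn_toLp
  refine ⟨hL.toLp h, hae, Real.le_sqrt_of_sq_le ?_⟩
  rw [norm_sq_eq]
  have : ∫ x, weight β x * ‖hL.toLp h x‖ ^ 2 = ∫ x, weight β x * ‖h x‖ ^ 2 :=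
    integral_congr_ae (hae.mono fun x hx => by simp only [hx])
  rw [this, integral_eq_lintegral_of_nonneg_ae (Eventually.of_forall hpos) hmw]
  exact ENNReal.toReal_le_of_le_ofReal (by positivity) hw

end Weighted

/-! ### Plancherel's theorem and the Fourier-Laplace transform -/

section Plancherel

variable {n : ℕ} {β : ℝ}

/-- The transform on `Lp` is an abstract extension. It is compared with the integral by pairing both
with test functions and moving the transform to the other factor: as tempered distributions on one
side, by Fubini on the other. -/
lemma coeFn_fourier_toLp {u : E n → ℂ} (h1 : Integrable u) (h2 : MemLp u 2) :
    ((𝓕 (h2.toLp u) : Lp ℂ 2 (volume : Measure (E n))) : E n → ℂ) =ᵐ[volume] 𝓕 u := by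
  have hloc1 : LocallyIntegrable
      ((𝓕 (h2.toLp u) : Lp ℂ 2 (volume : Measure (E n))) : E n → ℂ) :=
    (Lp.memLp _).locallyIntegrable (by norm_num)
  have hcont : Continuous (𝓕 u) :=
    VectorFourier.fourierIntegral_continuous Real.continuous_fourierChar continuous_inner h1
  refine ae_eq_of_integral_contDiff_smul_eq hloc1 hcont.locallyIntegrable fun g hg hgs => ?_
  have hgs' : HasCompactSupport (fun x => (g x : ℂ)) := hgs.comp_left Complex.ofReal_zero
  let G : 𝓢(E n, ℂ) := hgs'.toSchwartzMap (Complex.ofRealCLM.contDiff.comp hg)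
  have hG : ∀ x, G x = (g x : ℂ) := fun x => rfl
  have e1 : ∀ w : E n → ℂ, ∫ x, g x • w x = ∫ x, G x • w x := fun w => by
    refine integral_congr_ae (Eventually.of_forall fun x => ?_)
    simp [hG]
  rw [e1, e1]
  have e2 := Lp.toTemperedDistribution_apply (μ := volume)
    (𝓕 (h2.toLp u) : Lp ℂ 2 (volume : Measure (E n))) G
  rw [← e2, ← Lp.fourier_toTemperedDistribution_eq, TemperedDistribution.fourier_apply,
    Lp.toTemperedDistribution_apply]
  have e3 : ∫ x, (𝓕 G) x • (h2.toLp u) x = ∫ x, (𝓕 G) x • u x :=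
    integral_congr_ae (h2.coeFn_toLp.mono fun x hx => by simp only [hx])
  rw [e3]
  have e4 := VectorFourier.integral_fourierIntegral_smul_eq_flip (L := innerₗ (E n))
    Real.continuous_fourierChar continuous_inner (G.integrable (μ := volume)) h1
  rw [flip_innerₗ] at e4
  rw [SchwartzMap.fourier_coe]
  exact e4

lemma eLpNorm_fourier {u : E n → ℂ} (h1 : Integrable u) (h2 : MemLp u 2) :
    eLpNorm (𝓕 u) 2 = eLpNorm u 2 := by
  have h := Lp.norm_fourier_eq (h2.toLp u)
  rw [Lp.norm_def, Lp.norm_def, ENNReal.toReal_eq_toReal_iff' (Lp.eLpNorm_ne_top _)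
    (Lp.eLpNorm_ne_top _), eLpNorm_congr_ae (coeFn_fourier_toLp h1 h2),
    eLpNorm_congr_ae h2.coeFn_toLp] at h
  exact h

lemma lintegral_sq_eq_eLpNorm (u : E n → ℂ) :
    ∫⁻ x, ENNReal.ofReal (‖u x‖ ^ 2) = eLpNorm u 2 ^ (2 : ℝ) := by
  rw [eLpNorm_eq_lintegral_rpow_enorm_toReal (by norm_num) (by norm_num)]
  simp only [ENNReal.toReal_ofNat]
  rw [← ENNReal.rpow_mul, one_div, inv_mul_cancel₀ two_ne_zero, ENNReal.rpow_one]
  refine lintegral_congr fun x => ?_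
  rw [ENNReal.ofReal_pow (norm_nonneg _), ofReal_norm, ENNReal.rpow_two]

lemma lintegral_sq_fourier {u : E n → ℂ} (h1 : Integrable u) (h2 : MemLp u 2) :
    ∫⁻ x, ENNReal.ofReal (‖𝓕 u x‖ ^ 2) = ∫⁻ x, ENNReal.ofReal (‖u x‖ ^ 2) := by
  rw [lintegral_sq_eq_eLpNorm, lintegral_sq_eq_eLpNorm, eLpNorm_fourier h1 h2]

lemma lintegral_sq_fourierInv {u : E n → ℂ} (h1 : Integrable u) (h2 : MemLp u 2) :
    ∫⁻ x, ENNReal.ofReal (‖𝓕⁻ u x‖ ^ 2) = ∫⁻ x, ENNReal.ofReal (‖u x‖ ^ 2) := by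
  rw [← lintegral_sq_fourier h1 h2,
    ← lintegral_neg_eq_self (fun x => ENNReal.ofReal (‖𝓕 u x‖ ^ 2))]
  refine lintegral_congr fun x => ?_
  rw [Real.fourierInv_eq_fourier_neg]

/-- The exponential `exp (-i x·z)`. -/
def expKer (z : Fin n → ℂ) (x : E n) : ℂ := Complex.exp (-Complex.I * ∑ i, (x i : ℂ) * z i)

/-- The Fourier-Laplace transform. -/
def FL (f : E n → ℂ) (z : Fin n → ℂ) : ℂ := ∫ x, f x * expKer z x

/-- The point `2π ξ + w eᵢ`. -/
def linePt (i : Fin n) (w : ℂ) (ξ : E n) : Fin n → ℂ :=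
  fun j => 2 * Real.pi * (ξ j : ℂ) + Pi.single (M := fun _ => ℂ) i w j

lemma continuous_expKer (z : Fin n → ℂ) : Continuous (expKer z) := by
  unfold expKer
  fun_prop

lemma norm_expKer (z : Fin n → ℂ) (x : E n) : ‖expKer z x‖ = Real.exp (∑ i, x i * (z i).im) := by
  rw [expKer, Complex.norm_exp]
  congr 1
  simp [Complex.re_sum, Complex.im_sum]

lemma abs_sum_mul_le (x : E n) (y : Fin n → ℝ) : |∑ i, x i * y i| ≤ (∑ i, |y i|) * supn x := by
  rw [Finset.sum_mul]
  refine (Finset.abs_sum_le_sum_abs _ _).trans (Finset.sum_le_sum fun i _ => ?_)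
  rw [abs_mul, mul_comm]
  gcongr
  exact abs_le_supn x i

lemma norm_expKer_le {z : Fin n → ℂ} {r : ℝ} (hz : ∑ i, |(z i).im| ≤ r) (x : E n) :
    ‖expKer z x‖ ≤ Real.exp (r * supn x) := by
  rw [norm_expKer]
  refine Real.exp_le_exp.2 ((le_abs_self _).trans ((abs_sum_mul_le x _).trans ?_))
  exact mul_le_mul_of_nonneg_right hz (supn_nonneg x)

/-- Pairing of elements of `L²(ω)` with functions of subcritical exponential growth. -/
lemma integrable_mul_of_le [NeZero n] {r : ℝ} (hr : r < β / 2) (f : WL2 n β) {e : E n → ℂ}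
    (he : AEStronglyMeasurable e) {C : ℝ} (hC : ∀ x, ‖e x‖ ≤ C * Real.exp (r * supn x)) :
    Integrable (fun x => f x * e x) := by
  obtain ⟨K, _, h⟩ := exists_integral_exp_le (n := n) hr
  refine ((h f).1.const_mul C).mono' ((aestronglyMeasurable_volume f).mul he)
    (Eventually.of_forall fun x => ?_)
  rw [norm_mul]
  nlinarith [hC x, norm_nonneg (f x)]

/-- The bounded functional on `L²(ω)` given by a function of subcritical exponential growth. -/
lemma exists_functional [NeZero n] {r : ℝ} (hr : r < β / 2) : ∃ K : ℝ, 0 < K ∧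
    ∀ (e : E n → ℂ) (C : ℝ), AEStronglyMeasurable e →
      (∀ x, ‖e x‖ ≤ C * Real.exp (r * supn x)) →
      ∃ L : WL2 n β →L[ℂ] ℂ, (∀ f : WL2 n β, L f = ∫ x, f x * e x) ∧ ‖L‖ ≤ C * K := by
  obtain ⟨K, hK, h⟩ := exists_integral_exp_le (n := n) hr
  refine ⟨K, hK, fun e C he hC => ?_⟩
  have hC0 : 0 ≤ C := by
    have := (norm_nonneg _).trans (hC 0)
    exact nonneg_of_mul_nonneg_left this (Real.exp_pos _)
  let L0 : WL2 n β →ₗ[ℂ] ℂ :=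
    { toFun := fun f => ∫ x, f x * e x
      map_add' := fun f g => by
        rw [← integral_add (integrable_mul_of_le hr f he hC) (integrable_mul_of_le hr g he hC)]
        refine integral_congr_ae ?_
        filter_upwards [ae_volume_of_ae_weight (Lp.coeFn_add f g)] with x hx
        simp only [hx, Pi.add_apply, add_mul]
      map_smul' := fun a f => by
        rw [RingHom.id_apply, smul_eq_mul, ← integral_const_mul]
        refine integral_congr_ae ?_
        filter_upwards [ae_volume_of_ae_weight (Lp.coeFn_smul a f)] with x hx
        simp only [hx, Pi.smul_apply, smul_eq_mul, mul_assoc] }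
  refine ⟨L0.mkContinuous (C * K) fun f => ?_, fun f => rfl,
    LinearMap.mkContinuous_norm_le _ (by positivity) _⟩
  calc ‖∫ x, f x * e x‖ ≤ ∫ x, C * (‖f x‖ * Real.exp (r * supn x)) := by
        refine norm_integral_le_of_norm_le ((h f).1.const_mul C) (Eventually.of_forall fun x => ?_)
        rw [norm_mul]
        nlinarith [hC x, norm_nonneg (f x)]
    _ = C * ∫ x, ‖f x‖ * Real.exp (r * supn x) := integral_const_mul _ _
    _ ≤ C * (K * ‖f‖) := by gcongr; exact (h f).2
    _ = C * K * ‖f‖ := by ring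

lemma integrable_mul_expKer [NeZero n] {z : Fin n → ℂ} (hz : z ∈ tube n β) (f : WL2 n β) :
    Integrable (fun x => f x * expKer z x) :=
  integrable_mul_of_le hz f (continuous_expKer z).aestronglyMeasurable (C := 1)
    (fun x => by rw [one_mul]; exact norm_expKer_le le_rfl x)

lemma exists_FL_functional [NeZero n] {r : ℝ} (hr : r < β / 2) : ∃ K : ℝ, 0 < K ∧
    ∀ z : Fin n → ℂ, ∑ i, |(z i).im| ≤ r →
      ∃ L : WL2 n β →L[ℂ] ℂ, (∀ f : WL2 n β, L f = FL f z) ∧ ‖L‖ ≤ K := by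
  obtain ⟨K, hK, h⟩ := exists_functional (n := n) hr
  refine ⟨K, hK, fun z hz => ?_⟩
  obtain ⟨L, hL, hb⟩ := h (expKer z) 1 (continuous_expKer z).aestronglyMeasurable
    (fun x => by rw [one_mul]; exact norm_expKer_le hz x)
  exact ⟨L, hL, by simpa using hb⟩

/-- The Fourier-Laplace transform at a point of the tube, as a bounded functional. -/
def FLc [NeZero n] (β : ℝ) (z : Fin n → ℂ) (hz : z ∈ tube n β) : WL2 n β →L[ℂ] ℂ :=
  ((exists_FL_functional (n := n) hz).choose_spec.2 z le_rfl).choose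

@[simp] lemma FLc_apply [NeZero n] {z : Fin n → ℂ} (hz : z ∈ tube n β) (f : WL2 n β) :
    FLc β z hz f = FL f z :=
  ((exists_FL_functional (n := n) hz).choose_spec.2 z le_rfl).choose_spec.1 f

lemma toComplex_mem_tube (hβ : 0 < β) (ξ : E n) : toComplex ξ ∈ tube n β := by
  simp [tube, toComplex, hβ]

lemma linePt_mem_tube {i : Fin n} {w : ℂ} (hw : 2 * |w.im| < β) (ξ : E n) :
    linePt i w ξ ∈ tube n β := by
  have h : ∀ j, |(linePt i w ξ j).im| = Pi.single (M := fun _ => ℝ) i |w.im| j := fun j => by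
    by_cases hj : j = i
    · subst hj
      simp [linePt]
    · simp [linePt, hj]
  simp only [tube, Set.mem_ofPred_eq, h]
  rw [Finset.sum_pi_single']
  simp
  linarith

/-- Moving the argument by w in the i-th direction amounts to multiplying f by an exponential in xᵢ.
The factor 2π in `linePt` reconciles exp(-i x·ξ) with the normalisation of `𝓕`. -/
lemma FL_linePt (f : E n → ℂ) (i : Fin n) (w : ℂ) (ξ : E n) :
    FL f (linePt i w ξ) = 𝓕 (fun x => Complex.exp (-Complex.I * w * x i) * f x) ξ := by
  rw [Real.fourier_eq', FL]
  refine integral_congr_ae (Eventually.of_forall fun x => ?_)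
  simp only [smul_eq_mul, expKer]
  rw [← mul_assoc, ← Complex.exp_add, mul_comm]
  congr 2
  have : ∑ j, (x j : ℂ) * linePt i w ξ j = 2 * Real.pi * ((inner ℝ x ξ : ℝ) : ℂ) + w * x i := by
    rw [PiLp.inner_apply]
    push_cast
    simp only [linePt, mul_add, Finset.sum_add_distrib, Finset.mul_sum]
    congr 1
    · exact Finset.sum_congr rfl fun j _ => by simp; ring
    · rw [Finset.sum_eq_single i (fun j _ hj => by simp [hj]) (by simp)]
      simp [mul_comm]
  rw [this]
  push_cast
  ring

lemma linePt_zero (i : Fin n) (ξ : E n) : linePt i 0 ξ = toComplex ((2 * Real.pi) • ξ) := by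
  funext j
  simp [linePt, toComplex]

lemma norm_exp_mul (i : Fin n) (b : ℝ) (x : E n) :
    ‖Complex.exp (-Complex.I * (Complex.I * b) * x i)‖ = Real.exp (b * x i) := by
  have : -Complex.I * (Complex.I * b) * x i = ((b * x i : ℝ) : ℂ) := by
    rw [← mul_assoc, neg_mul, Complex.I_mul_I]
    push_cast
    ring
  rw [this, Complex.norm_exp_ofReal]

lemma integrable_exp_mul [NeZero n] {i : Fin n} {b : ℝ} (hb : 2 * |b| < β) (f : WL2 n β) :
    Integrable (fun x => Complex.exp (-Complex.I * (Complex.I * b) * x i) * f x) := by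
  have := integrable_mul_of_le (r := |b|) (by linarith) f
    (e := fun x => Complex.exp (-Complex.I * (Complex.I * b) * x i)) (by fun_prop) (C := 1)
    (fun x => by
      rw [norm_exp_mul, one_mul]
      refine Real.exp_le_exp.2 ((le_abs_self _).trans ?_)
      rw [abs_mul]
      exact mul_le_mul_of_nonneg_left (abs_le_supn x i) (abs_nonneg b))
  simpa only [mul_comm] using this

lemma memLp_exp_mul [NeZero n] {i : Fin n} {b : ℝ} (hb : 2 * |b| < β) (f : WL2 n β) :
    MemLp (fun x => Complex.exp (-Complex.I * (Complex.I * b) * x i) * f x) 2 := by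
  have hm : AEStronglyMeasurable
      (fun x => Complex.exp (-Complex.I * (Complex.I * b) * x i) * f x) :=
    AEStronglyMeasurable.mul (by fun_prop) (aestronglyMeasurable_volume f)
  refine (memLp_two_iff_integrable_sq_norm hm).2 ?_
  refine (integrable_exp_sq hb.le i f).congr (Eventually.of_forall fun x => ?_)
  simp only [norm_mul, norm_exp_mul, mul_pow, ← Real.exp_nat_mul]
  push_cast
  ring_nf

/-- Plancherel's theorem on the lines `ℝⁿ + i b eᵢ` of the tube. -/
lemma lintegral_FL_linePt [NeZero n] {i : Fin n} {b : ℝ} (hb : 2 * |b| < β) (f : WL2 n β) :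
    ∫⁻ ξ, ENNReal.ofReal (‖FL f (linePt i (Complex.I * b) ξ)‖ ^ 2) =
      ∫⁻ x, ENNReal.ofReal (Real.exp (2 * b * x i) * ‖f x‖ ^ 2) := by
  simp_rw [FL_linePt]
  rw [lintegral_sq_fourier (integrable_exp_mul hb f) (memLp_exp_mul hb f)]
  refine lintegral_congr fun x => ?_
  rw [norm_mul, norm_exp_mul, mul_pow, ← Real.exp_nat_mul]
  push_cast
  ring_nf

/-- Plancherel at height b = 0 makes the transform injective. This is how operator identities are
verified below: by comparing symbols on ℝⁿ. -/
lemma ext_FL [NeZero n] (hβ : 0 < β) {f g : WL2 n β}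
    (h : ∀ ξ : E n, FL f (toComplex ξ) = FL g (toComplex ξ)) : f = g := by
  rw [← sub_eq_zero]
  set u := f - g with hu
  have h0 : ∀ ξ : E n, FL u (toComplex ξ) = 0 := fun ξ => by
    rw [← FLc_apply (toComplex_mem_tube hβ ξ), hu, map_sub, FLc_apply, FLc_apply, h ξ, sub_self]
  have h1 := lintegral_FL_linePt (i := 0) (b := 0) (by simpa using hβ) u
  simp only [Complex.ofReal_zero, mul_zero, linePt_zero, h0] at h1
  have h2 : ∀ᵐ x, u x = 0 := by
    have := (lintegral_eq_zero_iff' ?_).1 (h1.symm.trans (by simp))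
    · filter_upwards [this] with x hx
      simpa using hx
    · exact (AEMeasurable.mul (by fun_prop)
        ((aestronglyMeasurable_volume u).norm.aemeasurable.pow_const 2)).ennreal_ofReal
  exact (Lp.eq_zero_iff_ae_eq_zero).2 (weightMeasure_ac_volume.ae_le h2)

end Plancherel

/-! ### Shifting the contour of integration and a Paley-Wiener theorem -/

section PaleyWiener

variable {n : ℕ} {β : ℝ}

lemma isOpen_tube : IsOpen (tube n β) :=
  isOpen_lt (by fun_prop) continuous_const

/-- `G` is analytic on the tube and decays exponentially in the real directions. -/
structure TubeDecay (β : ℝ) (G : (Fin n → ℂ) → ℂ) (C : ℝ) : Prop where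
  analytic : AnalyticOnNhd ℂ G (tube n β)
  decay : ∀ z ∈ tube n β, ‖G z‖ ≤ C * Real.exp (-∑ j, |(z j).re|)

lemma norm_le_sum_abs (ξ : E n) : ‖ξ‖ ≤ ∑ i, |ξ i| := by
  rw [EuclideanSpace.norm_eq]
  apply Real.sqrt_le_iff.2
  refine ⟨Finset.sum_nonneg fun i _ => abs_nonneg _, ?_⟩
  simp only [Real.norm_eq_abs]
  exact Finset.sum_sq_le_sq_sum_of_nonneg fun i _ => abs_nonneg _

lemma sum_abs_re_linePt (i : Fin n) (w : ℂ) (ξ : E n) :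
    ‖ξ‖ - |w.re| ≤ ∑ j, |(linePt i w ξ j).re| := by
  have h : ∀ j, |ξ j| - Pi.single (M := fun _ => ℝ) i |w.re| j ≤ |(linePt i w ξ j).re| := by
    intro j
    have h1 : |ξ j| ≤ |2 * Real.pi * ξ j| := by
      rw [abs_mul, abs_of_pos Real.two_pi_pos]
      nlinarith [abs_nonneg (ξ j), Real.pi_gt_three]
    by_cases hj : j = i
    · subst hj
      simp only [linePt, Pi.single_eq_same]
      have h2 : (2 * (Real.pi : ℂ) * (ξ j : ℂ) + w).re = 2 * Real.pi * ξ j + w.re := by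
        simp
      rw [h2]
      have := abs_sub_abs_le_abs_sub (2 * Real.pi * ξ j) (-w.re)
      rw [abs_neg, sub_neg_eq_add] at this
      linarith
    · have h2 : (linePt i w ξ j).re = 2 * Real.pi * ξ j := by simp [linePt, hj]
      rw [h2, Pi.single_eq_of_ne hj, sub_zero]
      exact h1
  have h2 := Finset.sum_le_sum fun j (_ : j ∈ Finset.univ) => h j
  rw [Finset.sum_sub_distrib, Finset.sum_pi_single', if_pos (Finset.mem_univ i)] at h2
  linarith [norm_le_sum_abs ξ]

lemma TubeDecay.nonneg {G : (Fin n → ℂ) → ℂ} {C : ℝ} (hG : TubeDecay β G C) (hβ : 0 < β) :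
    0 ≤ C := by
  have h := (norm_nonneg _).trans (hG.decay 0 (by simp [tube, hβ]))
  exact nonneg_of_mul_nonneg_left h (Real.exp_pos _)

lemma TubeDecay.norm_linePt_le {G : (Fin n → ℂ) → ℂ} {C : ℝ} (hG : TubeDecay β G C)
    (hβ : 0 < β) {i : Fin n} {w : ℂ} (hw : 2 * |w.im| < β) (ξ : E n) :
    ‖G (linePt i w ξ)‖ ≤ C * Real.exp |w.re| * Real.exp (-1 * ‖ξ‖) := by
  refine (hG.decay _ (linePt_mem_tube hw ξ)).trans ?_
  rw [mul_assoc, ← Real.exp_add]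
  refine mul_le_mul_of_nonneg_left (Real.exp_le_exp.2 ?_) (hG.nonneg hβ)
  linarith [sum_abs_re_linePt i w ξ]

lemma continuous_linePt (i : Fin n) (w : ℂ) : Continuous (linePt i w) := by
  unfold linePt
  fun_prop

lemma AnalyticOnNhd.continuous_linePt {G : (Fin n → ℂ) → ℂ} (hG : AnalyticOnNhd ℂ G (tube n β))
    {i : Fin n} {w : ℂ} (hw : 2 * |w.im| < β) : Continuous fun ξ => G (linePt i w ξ) :=
  hG.continuousOn.comp_continuous (FokkerPlanck.continuous_linePt i w)
    fun ξ => linePt_mem_tube hw ξ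

lemma TubeDecay.integrable_linePt {G : (Fin n → ℂ) → ℂ} {C : ℝ} (hG : TubeDecay β G C)
    (hβ : 0 < β) {i : Fin n} {w : ℂ} (hw : 2 * |w.im| < β) :
    Integrable fun ξ => G (linePt i w ξ) :=
  ((integrable_exp_neg_norm one_pos).const_mul (C * Real.exp |w.re|)).mono'
    (AnalyticOnNhd.continuous_linePt hG.analytic hw).aestronglyMeasurable
    (Eventually.of_forall fun ξ => hG.norm_linePt_le hβ hw ξ)

lemma TubeDecay.memLp_linePt {G : (Fin n → ℂ) → ℂ} {C : ℝ} (hG : TubeDecay β G C)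
    (hβ : 0 < β) {i : Fin n} {w : ℂ} (hw : 2 * |w.im| < β) :
    MemLp (fun ξ => G (linePt i w ξ)) 2 := by
  have hc := AnalyticOnNhd.continuous_linePt hG.analytic (i := i) hw
  refine (memLp_two_iff_integrable_sq_norm hc.aestronglyMeasurable).2 ?_
  refine ((integrable_exp_neg_norm two_pos).const_mul ((C * Real.exp |w.re|) ^ 2)).mono'
    (hc.norm.pow 2).aestronglyMeasurable (Eventually.of_forall fun ξ => ?_)
  rw [Real.norm_of_nonneg (by positivity)]
  have := pow_le_pow_left₀ (norm_nonneg _) (hG.norm_linePt_le hβ (i := i) hw ξ) 2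
  rw [mul_pow _ (Real.exp (-1 * ‖ξ‖)), ← Real.exp_nat_mul] at this
  refine this.trans (le_of_eq ?_)
  congr 2
  push_cast
  ring

lemma hasDerivAt_linePt (i : Fin n) (w : ℂ) (ξ : E n) :
    HasDerivAt (fun w => linePt i w ξ) (Pi.single i 1) w := by
  rw [hasDerivAt_pi]
  intro j
  simp only [linePt]
  by_cases hj : j = i
  · subst hj
    simpa using (hasDerivAt_id w).const_add (2 * Real.pi * (ξ j : ℂ))
  · simpa [hj] using hasDerivAt_const w (2 * Real.pi * (ξ j : ℂ))

/-- The strip `|Im w| < β / 2`. -/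
def strip (β : ℝ) : Set ℂ := {w | 2 * |w.im| < β}

lemma isOpen_strip : IsOpen (strip β) := isOpen_lt (by fun_prop) continuous_const

lemma isPreconnected_strip : IsPreconnected (strip β) := by
  have h : strip β = Complex.imLm ⁻¹' (Set.Ioo (-(β / 2)) (β / 2)) := by
    ext w
    simp only [strip, Set.mem_ofPred_eq, Set.mem_preimage, Set.mem_Ioo, ← abs_lt]
    constructor <;> intro h
    · exact (by linarith : |w.im| < β / 2)
    · have : |w.im| < β / 2 := h
      linarith
  rw [h]
  exact ((convex_Ioo _ _).linear_preimage _).isPreconnected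

/-- Differentiation under the integral sign. Cauchy's estimate on circles inside the strip bounds
the derivative by values of G, so it inherits the exponential decay of G. -/
lemma TubeDecay.hasDerivAt_integral {G : (Fin n → ℂ) → ℂ} {C : ℝ} (hG : TubeDecay β G C)
    (hβ : 0 < β) (i : Fin n) {w : ℂ} (hw : w ∈ strip β) :
    HasDerivAt (fun w => ∫ ξ, G (linePt i w ξ))
      (∫ ξ, fderiv ℂ G (linePt i w ξ) (Pi.single i 1)) w := by
  obtain ⟨ε, hε, hball⟩ := Metric.isOpen_iff.1 isOpen_strip w hw
  have hdiff : ∀ ξ, ∀ v ∈ strip β, HasDerivAt (fun w => G (linePt i w ξ))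
      (fderiv ℂ G (linePt i v ξ) (Pi.single i 1)) v := fun ξ v hv =>
    ((hG.analytic _ (linePt_mem_tube hv ξ)).differentiableAt.hasFDerivAt).comp_hasDerivAt v
      (hasDerivAt_linePt i v ξ)
  -- The radii satisfy 1/2 + 1/3 < 1, so Cauchy circles of the fixed radius ε/3 stay in the strip
  -- for every v near w.
  have hsub : ∀ v ∈ Metric.ball w (ε / 2), Metric.closedBall v (ε / 3) ⊆ strip β := by
    intro v hv u hu
    apply hball
    rw [Metric.mem_ball] at hv ⊢
    rw [Metric.mem_closedBall] at hu
    linarith [dist_triangle u v w]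
  refine (hasDerivAt_integral_of_dominated_loc_of_deriv_le
    (bound := fun ξ => C * Real.exp (|w.re| + ε) / (ε / 3) * Real.exp (-1 * ‖ξ‖))
    (F' := fun v ξ => fderiv ℂ G (linePt i v ξ) (Pi.single i 1))
    (Metric.ball_mem_nhds w (half_pos hε)) ?_ (hG.integrable_linePt hβ hw) ?_ ?_ ?_ ?_).2
  · filter_upwards [isOpen_strip.mem_nhds hw] with v hv
    exact (AnalyticOnNhd.continuous_linePt hG.analytic hv).aestronglyMeasurable
  · have h1 : Continuous fun ξ => fderiv ℂ G (linePt i w ξ) :=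
      hG.analytic.fderiv.continuousOn.comp_continuous (continuous_linePt i w)
        fun ξ => linePt_mem_tube hw ξ
    exact (h1.clm_apply continuous_const).aestronglyMeasurable
  · refine Eventually.of_forall fun ξ v hv => ?_
    have hv' : v ∈ strip β := hsub v hv (Metric.mem_closedBall_self (by positivity))
    rw [← (hdiff ξ v hv').deriv, div_mul_eq_mul_div]
    refine Complex.norm_deriv_le_of_forall_mem_sphere_norm_le (by positivity) ?_ fun u hu => ?_
    · refine DifferentiableOn.diffContOnCl fun u hu => ?_
      rw [closure_ball _ (by positivity)] at hu
      exact (hdiff ξ u (hsub v hv hu)).differentiableAt.differentiableWithinAt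
    · have hu' := hsub v hv (Metric.sphere_subset_closedBall hu)
      refine (hG.norm_linePt_le hβ hu' ξ).trans ?_
      have h1 : |u.re| ≤ |w.re| + ε := by
        have h2 : |u.re - w.re| ≤ dist u w := by
          rw [dist_eq_norm, ← Complex.sub_re]
          exact Complex.abs_re_le_norm _
        have h3 := abs_sub_abs_le_abs_sub u.re w.re
        have h4 := dist_triangle u v w
        rw [Metric.mem_ball] at hv
        rw [Metric.mem_sphere] at hu
        linarith
      have := hG.nonneg hβ
      gcongr
  · exact (integrable_exp_neg_norm one_pos).const_mul _
  · exact Eventually.of_forall fun ξ v hv =>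
      hdiff ξ v (hsub v hv (Metric.mem_closedBall_self (by positivity)))

/-- A real increment of w is absorbed by a translation of ξ, under which Lebesgue measure is
invariant. -/
lemma integral_linePt_add_real (G : (Fin n → ℂ) → ℂ) (i : Fin n) (w : ℂ) (a : ℝ) :
    ∫ ξ, G (linePt i (w + a) ξ) = ∫ ξ, G (linePt i w ξ) := by
  rw [← integral_add_right_eq_self (fun ξ => G (linePt i w ξ))
    (EuclideanSpace.single i (a / (2 * Real.pi)))]
  refine integral_congr_ae (Eventually.of_forall fun ξ => ?_)
  simp only
  congr 1
  funext j
  have hpi : (Real.pi : ℂ) ≠ 0 := by exact_mod_cast Real.pi_ne_zero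
  by_cases hj : j = i
  · subst hj
    simp [linePt]
    field_simp
    ring
  · simp [linePt, hj]

/-- The contour shift, without rectangles: the integral is holomorphic in w on a connected strip and
constant in the real direction, so its complex derivative vanishes. -/
lemma TubeDecay.integral_linePt {G : (Fin n → ℂ) → ℂ} {C : ℝ} (hG : TubeDecay β G C)
    (hβ : 0 < β) (i : Fin n) {w : ℂ} (hw : w ∈ strip β) :
    ∫ ξ, G (linePt i w ξ) = ∫ ξ, G (linePt i 0 ξ) := by
  refine isOpen_strip.is_const_of_deriv_eq_zero isPreconnected_strip
    (f := fun w => ∫ ξ, G (linePt i w ξ))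
    (fun v hv => (hG.hasDerivAt_integral hβ i hv).differentiableAt.differentiableWithinAt)
    (fun v hv => ?_) hw (by simpa [strip] using hβ)
  have h1 := hG.hasDerivAt_integral hβ i hv
  have h2 : HasDerivAt (fun a : ℝ => ∫ ξ, G (linePt i (v + a) ξ))
      (∫ ξ, fderiv ℂ G (linePt i v ξ) (Pi.single i 1)) 0 := by
    have h3 : HasDerivAt (fun a : ℂ => ∫ ξ, G (linePt i (v + a) ξ))
        (∫ ξ, fderiv ℂ G (linePt i v ξ) (Pi.single i 1)) ((0 : ℝ) : ℂ) := by
      apply HasDerivAt.comp_const_add (f := fun w => ∫ ξ, G (linePt i w ξ)) v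
      simpa using h1
    exact h3.comp_ofReal
  simp_rw [integral_linePt_add_real] at h2
  rw [h1.deriv]
  exact h2.unique (hasDerivAt_const _ _)

lemma analyticAt_expKer (x : E n) (z : Fin n → ℂ) : AnalyticAt ℂ (fun z => expKer z x) z := by
  unfold expKer
  refine AnalyticAt.cexp (analyticAt_const.mul ?_)
  refine Finset.analyticAt_fun_sum _ fun i _ => analyticAt_const.mul ?_
  exact (ContinuousLinearMap.proj (R := ℂ) (φ := fun _ : Fin n => ℂ) i).analyticAt z

lemma TubeDecay.mul_expKer {G : (Fin n → ℂ) → ℂ} {C : ℝ} (hG : TubeDecay β G C) (hβ : 0 < β)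
    (x : E n) : TubeDecay β (fun z => G z * expKer z x) (C * Real.exp (β / 2 * supn x)) where
  analytic := fun z hz => (hG.analytic z hz).mul (analyticAt_expKer x z)
  decay := fun z hz => by
    rw [norm_mul, mul_right_comm]
    have := hG.nonneg hβ
    exact mul_le_mul (hG.decay z hz) (norm_expKer_le (le_of_lt hz) x) (norm_nonneg _)
      (by positivity)

lemma fourierInv_linePt (G : (Fin n → ℂ) → ℂ) (i : Fin n) (w : ℂ) (x : E n) :
    Complex.exp (Complex.I * w * x i) * 𝓕⁻ (fun ξ => G (linePt i w ξ)) x =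
      ∫ ξ, G (linePt i w ξ) * expKer (linePt i w ξ) (-x) := by
  rw [Real.fourierInv_eq', ← integral_const_mul]
  refine integral_congr_ae (Eventually.of_forall fun ξ => ?_)
  simp only [smul_eq_mul, expKer]
  rw [← mul_assoc, ← Complex.exp_add, mul_comm]
  congr 2
  have : ∑ j, ((-x) j : ℂ) * linePt i w ξ j
      = -(2 * Real.pi * ((inner ℝ ξ x : ℝ) : ℂ) + w * x i) := by
    rw [PiLp.inner_apply]
    push_cast
    simp only [linePt, mul_add, Finset.sum_add_distrib, Finset.mul_sum, neg_add,
      ← Finset.sum_neg_distrib]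
    congr 1
    · exact Finset.sum_congr rfl fun j _ => by simp; ring
    · rw [Finset.sum_eq_single i (fun j _ hj => by simp [hj]) (by simp)]
      simp [mul_comm]
  rw [this]
  push_cast
  ring

/-- The contour shift applied to G(z) exp(i x·z) with x fixed. The decay constant of this product
depends on x, which is harmless because the shift is used at one x at a time. -/
lemma TubeDecay.fourierInv_shift {G : (Fin n → ℂ) → ℂ} {C : ℝ} (hG : TubeDecay β G C)
    (hβ : 0 < β) (i : Fin n) {b : ℝ} (hb : 2 * |b| < β) (x : E n) :
    𝓕⁻ (fun ξ => G (linePt i (Complex.I * b) ξ)) x =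
      Real.exp (b * x i) * 𝓕⁻ (fun ξ => G (linePt i 0 ξ)) x := by
  have h1 := fourierInv_linePt G i (Complex.I * b) x
  have h2 := fourierInv_linePt G i 0 x
  have h3 := (hG.mul_expKer hβ (-x)).integral_linePt hβ i (w := Complex.I * b) (by simpa [strip])
  rw [h3, ← h2] at h1
  simp only [mul_zero, zero_mul, Complex.exp_zero, one_mul] at h1
  rw [← h1, ← mul_assoc, Complex.ofReal_exp, ← Complex.exp_add]
  have : ((b * x i : ℝ) : ℂ) + Complex.I * (Complex.I * b) * x i = 0 := by
    rw [← mul_assoc, Complex.I_mul_I]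
    push_cast
    ring
  rw [this, Complex.exp_zero, one_mul]

/-- A Paley-Wiener theorem: an analytic function on the tube with bounded `L²` norms along the
lines `ℝⁿ + i b eᵢ` is the transform of an element of `L²(ω)`. -/
lemma TubeDecay.exists_FL_eq [NeZero n] {G : (Fin n → ℂ) → ℂ} {C : ℝ} (hG : TubeDecay β G C)
    (hβ : 0 < β) {K : ℝ} (hK0 : 0 ≤ K)
    (hK : ∀ (i : Fin n) (b : ℝ), 2 * |b| < β →
      ∫⁻ ξ, ENNReal.ofReal (‖G (linePt i (Complex.I * b) ξ)‖ ^ 2) ≤ ENNReal.ofReal K) :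
    ∃ h : WL2 n β, (∀ ξ : E n, FL h (toComplex ξ) = G (toComplex ξ)) ∧
      ‖h‖ ≤ Real.sqrt (n * K) := by
  have h0 : 2 * |(0 : ℂ).im| < β := by simpa using hβ
  set g : E n → ℂ := fun ξ => G (linePt 0 0 ξ) with hg
  have hgc : Continuous g := AnalyticOnNhd.continuous_linePt hG.analytic h0
  have hgi : Integrable g := hG.integrable_linePt hβ h0
  have hgz : ∀ i : Fin n, (fun ξ => G (linePt i 0 ξ)) = g := fun i => by
    funext ξ
    rw [hg, linePt_zero]
    simp only [linePt_zero]
  have hinvc : Continuous (𝓕⁻ g) := by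
    have : 𝓕⁻ g = fun x => 𝓕 g (-x) := by
      funext x
      rw [Real.fourierInv_eq_fourier_neg]
    rw [this]
    exact (VectorFourier.fourierIntegral_continuous Real.continuous_fourierChar
      continuous_inner hgi).comp continuous_neg
  -- The candidate is the inverse transform of G on ℝⁿ. Its exponentially weighted norms are, by the
  -- shift and Plancherel, the norms of G on the shifted spaces.
  obtain ⟨h, hh, hn⟩ := exists_mem_of_lintegral_le (n := n) hβ (h := 𝓕⁻ g)
    hinvc.aestronglyMeasurable hK0 (fun i b hb => by
      have hb' : 2 * |(Complex.I * b).im| < β := by simpa using hb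
      refine le_trans (le_of_eq ?_) (hK i b hb)
      rw [← lintegral_sq_fourierInv (hG.integrable_linePt hβ hb') (hG.memLp_linePt hβ hb')]
      refine lintegral_congr fun x => ?_
      rw [hG.fourierInv_shift hβ i hb, hgz, norm_mul, mul_pow, Complex.norm_real,
        Real.norm_of_nonneg (Real.exp_pos _).le, ← Real.exp_nat_mul]
      push_cast
      ring_nf)
  refine ⟨h, fun ξ => ?_, hn⟩
  -- Membership in L²(ω), just established, gives the integrability needed for Fourier inversion.
  have hint : Integrable (𝓕⁻ g) := by
    have := integrable_exp_mul (i := 0) (b := 0) (by simpa using hβ) h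
    refine this.congr ?_
    filter_upwards [hh] with x hx
    simp [hx]
  have hint' : Integrable (𝓕 g) := by
    refine hint.comp_neg.congr (Eventually.of_forall fun x => ?_)
    simp only [Real.fourierInv_eq_fourier_neg, neg_neg]
  have hinv := hgc.fourier_fourierInv_eq hgi hint'
  have hξ : toComplex ξ = linePt 0 0 ((2 * Real.pi)⁻¹ • ξ) := by
    rw [linePt_zero, smul_smul, mul_inv_cancel₀ Real.two_pi_pos.ne', one_smul]
  rw [hξ, FL_linePt]
  have e1 : (fun x : E n => Complex.exp (-Complex.I * 0 * x 0) * h x) =ᵐ[volume] 𝓕⁻ g := by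
    filter_upwards [hh] with x hx
    simp [hx]
  rw [Real.fourier_congr_ae e1, hinv]

end PaleyWiener

/-! ### Polynomials times Gaussians -/

section PolyGauss

open MvPolynomial (eval monomial)

variable {n : ℕ} {β : ℝ} {c : Fin n → ℝ}

/-- The product of a polynomial and the Gaussian `μ₀`. -/
def polyGauss (c : Fin n → ℝ) (p : MvPolynomial (Fin n) ℂ) : E n → ℂ :=
  fun x => eval (toComplex x) p * mu0 c x

/-- The operator on polynomials which corresponds to `∂ⱼ` on `p μ₀`. -/
def gaussDeriv (c : Fin n → ℝ) (j : Fin n) :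
    MvPolynomial (Fin n) ℂ →ₗ[ℂ] MvPolynomial (Fin n) ℂ :=
  (MvPolynomial.pderiv j).toLinearMap -
    LinearMap.mulLeft ℂ (MvPolynomial.C (c j : ℂ) * MvPolynomial.X j)

lemma gaussDeriv_apply (j : Fin n) (p : MvPolynomial (Fin n) ℂ) :
    gaussDeriv c j p =
      MvPolynomial.pderiv j p - MvPolynomial.C (c j : ℂ) * MvPolynomial.X j * p := rfl

lemma contDiff_coord (i : Fin n) : ContDiff ℝ ∞ (fun x : E n => x i) :=
  (EuclideanSpace.proj i : E n →L[ℝ] ℝ).contDiff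

lemma proj_single (i j : Fin n) :
    (EuclideanSpace.proj i : E n →L[ℝ] ℝ) (EuclideanSpace.single j 1) = if i = j then 1 else 0 := by
  change (EuclideanSpace.single j (1 : ℝ) : E n) i = _
  simp

lemma contDiff_eval (p : MvPolynomial (Fin n) ℂ) :
    ContDiff ℝ ∞ (fun x : E n => eval (toComplex x) p) := by
  induction p using MvPolynomial.induction_on with
  | C a => simpa using contDiff_const
  | add p q hp hq => simpa using hp.add hq
  | mul_X p i hp =>
    simp only [map_mul, MvPolynomial.eval_X]
    refine hp.mul ?_
    exact Complex.ofRealCLM.contDiff.comp (contDiff_coord i)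

lemma contDiff_mu0 : ContDiff ℝ ∞ (mu0 c) := by
  unfold mu0
  refine Complex.ofRealCLM.contDiff.comp (contDiff_const.mul (Real.contDiff_exp.comp ?_))
  refine contDiff_const.mul (ContDiff.sum fun i _ => contDiff_const.mul ?_)
  exact (contDiff_coord i).pow 2

lemma contDiff_polyGauss (p : MvPolynomial (Fin n) ℂ) : ContDiff ℝ ∞ (polyGauss c p) :=
  (contDiff_eval p).mul contDiff_mu0

lemma pderiv_mul {f g : E n → ℂ} (hf : ContDiff ℝ ∞ f) (hg : ContDiff ℝ ∞ g) (j : Fin n) (x : E n) :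
    pderiv j (fun x => f x * g x) x = pderiv j f x * g x + f x * pderiv j g x := by
  simp only [pderiv]
  rw [fderiv_fun_mul (hf.differentiable (by simp) x) (hg.differentiable (by simp) x)]
  simp only [add_apply, smul_apply, smul_eq_mul]
  ring

lemma pderiv_coord (i j : Fin n) (x : E n) :
    pderiv j (fun x => (x i : ℂ)) x = if i = j then 1 else 0 := by
  have h : HasFDerivAt (fun x : E n => (x i : ℂ))
      (Complex.ofRealCLM.comp (EuclideanSpace.proj i)) x :=
    (Complex.ofRealCLM.comp (EuclideanSpace.proj i : E n →L[ℝ] ℝ)).hasFDerivAt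
  rw [pderiv, h.fderiv]
  simp only [ContinuousLinearMap.comp_apply, proj_single]
  split_ifs <;> simp

lemma pderiv_eval (p : MvPolynomial (Fin n) ℂ) (j : Fin n) (x : E n) :
    pderiv j (fun x => eval (toComplex x) p) x = eval (toComplex x) (MvPolynomial.pderiv j p) := by
  induction p using MvPolynomial.induction_on with
  | C a => simp [pderiv]
  | add p q hp hq =>
    have := congrFun (pderiv_add j (contDiff_eval p) (contDiff_eval q)) x
    simp only [Pi.add_apply, hp, hq] at this
    simp only [map_add]
    exact this
  | mul_X p i hp =>
    have hX : ContDiff ℝ ∞ (fun x : E n => (x i : ℂ)) :=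
      Complex.ofRealCLM.contDiff.comp (contDiff_coord i)
    have := pderiv_mul (contDiff_eval p) hX j x
    have e : (fun x : E n => eval (toComplex x) (p * MvPolynomial.X i)) =
        fun x => eval (toComplex x) p * (x i : ℂ) := by
      funext x
      rw [map_mul, MvPolynomial.eval_X]
      rfl
    rw [e, this, pderiv_coord, hp, MvPolynomial.pderiv_mul, map_add, map_mul, map_mul,
      MvPolynomial.eval_X]
    by_cases h : i = j
    · subst h
      simp [toComplex]
    · rw [MvPolynomial.pderiv_X_of_ne h]
      simp [toComplex, h]

lemma pderiv_mu0 (j : Fin n) (x : E n) : pderiv j (mu0 c) x = -(c j * x j : ℂ) * mu0 c x := by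
  have h1 : HasFDerivAt (fun x : E n => -(1 / 2) * ∑ i, c i * x i ^ 2)
      (((-(1 / 2) : ℝ)) • ∑ i, c i • (2 * x i) • (EuclideanSpace.proj i : E n →L[ℝ] ℝ)) x := by
    refine HasFDerivAt.const_mul ?_ _
    refine HasFDerivAt.fun_sum fun i _ => HasFDerivAt.const_mul ?_ _
    have := (EuclideanSpace.proj i : E n →L[ℝ] ℝ).hasFDerivAt (x := x) |>.pow 2
    simpa using this
  have h2 := Complex.ofRealCLM.hasFDerivAt.comp x
    ((h1.exp).const_mul (Real.sqrt (∏ i, c i / (2 * Real.pi))))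
  have h3 : HasFDerivAt (mu0 c) _ x := h2
  rw [pderiv, h3.fderiv]
  simp only [ContinuousLinearMap.comp_apply, smul_apply,
    sum_apply, proj_single, smul_eq_mul,
    mul_ite, mul_one, mul_zero, Finset.sum_ite_eq', Finset.mem_univ, if_true, mu0,
    Complex.ofRealCLM_apply]
  push_cast
  ring

lemma pderiv_polyGauss (p : MvPolynomial (Fin n) ℂ) (j : Fin n) :
    pderiv j (polyGauss c p) = polyGauss c (gaussDeriv c j p) := by
  funext x
  have e : pderiv j (polyGauss c p) x = _ := pderiv_mul (contDiff_eval p) contDiff_mu0 j x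
  rw [e, polyGauss, pderiv_eval, pderiv_mu0, gaussDeriv_apply]
  simp only [map_sub, map_mul, MvPolynomial.eval_C, MvPolynomial.eval_X, toComplex]
  ring

lemma exists_norm_eval_le (p : MvPolynomial (Fin n) ℂ) :
    ∃ C R : ℝ, 0 ≤ C ∧ ∀ x : E n, ‖eval (toComplex x) p‖ ≤ C * Real.exp (R * supn x) := by
  induction p using MvPolynomial.induction_on with
  | C a => exact ⟨‖a‖, 0, norm_nonneg _, fun x => by simp⟩
  | add p q hp hq =>
    obtain ⟨C, R, hC, h⟩ := hp
    obtain ⟨C', R', hC', h'⟩ := hq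
    refine ⟨C + C', max R R', by positivity, fun x => ?_⟩
    rw [map_add, add_mul]
    refine (norm_add_le _ _).trans (add_le_add ((h x).trans ?_) ((h' x).trans ?_))
    · gcongr
      · exact supn_nonneg x
      · exact le_max_left _ _
    · gcongr
      · exact supn_nonneg x
      · exact le_max_right _ _
  | mul_X p i hp =>
    obtain ⟨C, R, hC, h⟩ := hp
    refine ⟨C, R + 1, hC, fun x => ?_⟩
    rw [map_mul, MvPolynomial.eval_X, norm_mul, toComplex, Complex.norm_real, add_mul, Real.exp_add,
      ← mul_assoc]
    refine mul_le_mul (h x) ?_ (norm_nonneg _) (by positivity)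
    rw [one_mul, Real.norm_eq_abs]
    have := Real.add_one_le_exp (supn x)
    linarith [abs_le_supn x i]

lemma norm_mu0 (x : E n) : ‖mu0 c x‖ = Real.sqrt (∏ i, c i / (2 * Real.pi)) *
    Real.exp (-(1 / 2) * ∑ i, c i * x i ^ 2) := by
  rw [mu0, Complex.norm_real, Real.norm_of_nonneg (by positivity)]

lemma exists_norm_mu0_le [NeZero n] (hc : ∀ i, 0 < c i) (R : ℝ) :
    ∃ C : ℝ, 0 ≤ C ∧ ∀ x : E n, ‖mu0 c x‖ ≤ C * Real.exp (-R * supn x) := by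
  obtain ⟨i₀, _, hi₀⟩ := Finset.exists_min_image (Finset.univ : Finset (Fin n)) c
    Finset.univ_nonempty
  have hm := hc i₀
  refine ⟨Real.sqrt (∏ i, c i / (2 * Real.pi)) * Real.exp (R ^ 2 / (2 * c i₀)), by positivity,
    fun x => ?_⟩
  rw [norm_mu0, mul_assoc, ← Real.exp_add]
  gcongr
  obtain ⟨i, hi⟩ := exists_supn_eq x
  have h1 : c i₀ * supn x ^ 2 ≤ ∑ i, c i * x i ^ 2 := by
    rw [hi, sq_abs]
    refine le_trans ?_ (Finset.single_le_sum (f := fun i => c i * x i ^ 2)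
      (fun i _ => mul_nonneg (hc i).le (sq_nonneg _)) (Finset.mem_univ i))
    exact mul_le_mul_of_nonneg_right (hi₀ i (Finset.mem_univ i)) (sq_nonneg _)
  -- Completing the square; this is the origin of the constant exp(R²/(2 min c)).
  have h2 : R ^ 2 / (2 * c i₀) - R * supn x + 1 / 2 * (c i₀ * supn x ^ 2)
      = (R - c i₀ * supn x) ^ 2 / (2 * c i₀) := by
    field_simp
    ring
  have h3 : 0 ≤ (R - c i₀ * supn x) ^ 2 / (2 * c i₀) := by positivity
  linarith

/-- Products of polynomials and Gaussians decay faster than any exponential. -/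
lemma exists_norm_polyGauss_le [NeZero n] (hc : ∀ i, 0 < c i) (p : MvPolynomial (Fin n) ℂ) (R : ℝ) :
    ∃ C : ℝ, 0 ≤ C ∧ ∀ x : E n, ‖polyGauss c p x‖ ≤ C * Real.exp (-R * supn x) := by
  obtain ⟨C, r, hC, h⟩ := exists_norm_eval_le p
  obtain ⟨C', hC', h'⟩ := exists_norm_mu0_le hc (R + r)
  refine ⟨C * C', by positivity, fun x => ?_⟩
  rw [polyGauss, norm_mul]
  refine (mul_le_mul (h x) (h' x) (norm_nonneg _) (by positivity)).trans (le_of_eq ?_)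
  rw [mul_mul_mul_comm, ← Real.exp_add]
  ring_nf

lemma continuous_polyGauss (p : MvPolynomial (Fin n) ℂ) : Continuous (polyGauss c p) :=
  (contDiff_polyGauss p).continuous

lemma integrable_of_superexp {g : E n → ℂ} (hg : AEStronglyMeasurable g) {C : ℝ}
    (h : ∀ x, ‖g x‖ ≤ C * Real.exp (-1 * supn x)) : Integrable g :=
  ((integrable_exp_neg_supn one_pos).const_mul C).mono' hg (Eventually.of_forall h)

lemma memLp_of_superexp [NeZero n] (hβ : 0 ≤ β) {g : E n → ℂ} (hg : AEStronglyMeasurable g) {C : ℝ}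
    (h : ∀ x, ‖g x‖ ≤ C * Real.exp (-(β + 1) * supn x)) : MemLp g 2 (weightMeasure n β) := by
  refine memLp_of_integrable hg ?_
  refine ((integrable_exp_neg_supn one_pos).const_mul (n * C ^ 2)).mono'
    (continuous_weight.aestronglyMeasurable.mul (hg.norm.pow 2)) (Eventually.of_forall fun x => ?_)
  have hw := weight_le_exp hβ x
  have hs := supn_nonneg x
  rw [Real.norm_of_nonneg (mul_nonneg (weight_pos x).le (by positivity))]
  calc weight β x * ‖g x‖ ^ 2
      ≤ n * Real.exp (β * supn x) * (C * Real.exp (-(β + 1) * supn x)) ^ 2 := by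
        gcongr
        exact h x
    _ = n * C ^ 2 * Real.exp (β * supn x + 2 * (-(β + 1) * supn x)) := by
        rw [mul_pow, ← Real.exp_nat_mul, Real.exp_add]
        push_cast
        ring
    _ ≤ n * C ^ 2 * Real.exp (-1 * supn x) := by
        gcongr
        nlinarith

lemma memLp_polyGauss [NeZero n] (hc : ∀ i, 0 < c i) (hβ : 0 ≤ β) (p : MvPolynomial (Fin n) ℂ) :
    MemLp (polyGauss c p) 2 (weightMeasure n β) := by
  obtain ⟨C, _, h⟩ := exists_norm_polyGauss_le hc p (β + 1)
  exact memLp_of_superexp hβ (continuous_polyGauss p).aestronglyMeasurable h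

/-- Products of polynomials and Gaussians as elements of `L²(ω)`. -/
def polyGaussL [NeZero n] (hc : ∀ i, 0 < c i) (hβ : 0 ≤ β) :
    MvPolynomial (Fin n) ℂ →ₗ[ℂ] WL2 n β where
  toFun p := (memLp_polyGauss hc hβ p).toLp
  map_add' p q := by
    rw [← MemLp.toLp_add]
    congr 1
    funext x
    simp [polyGauss, add_mul]
  map_smul' a p := by
    rw [RingHom.id_apply, ← MemLp.toLp_const_smul]
    congr 1
    funext x
    simp [polyGauss, mul_assoc]

lemma coeFn_polyGaussL [NeZero n] (hc : ∀ i, 0 < c i) (hβ : 0 ≤ β) (p : MvPolynomial (Fin n) ℂ) :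
    polyGaussL hc hβ p =ᵐ[weightMeasure n β] polyGauss c p :=
  (memLp_polyGauss hc hβ p).coeFn_toLp

lemma FL_congr {f g : E n → ℂ} (h : f =ᵐ[volume] g) (z : Fin n → ℂ) : FL f z = FL g z :=
  integral_congr_ae (h.mono fun x hx => by simp only [hx])

lemma integrable_polyGauss_mul_expKer [NeZero n] (hc : ∀ i, 0 < c i) (p : MvPolynomial (Fin n) ℂ)
    (z : Fin n → ℂ) : Integrable (fun x => polyGauss c p x * expKer z x) := by
  obtain ⟨C, hC, h⟩ := exists_norm_polyGauss_le hc p (∑ i, |(z i).im| + 1)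
  refine integrable_of_superexp (C := C)
    ((continuous_polyGauss p).mul (continuous_expKer z)).aestronglyMeasurable fun x => ?_
  rw [norm_mul]
  refine (mul_le_mul (h x) (norm_expKer_le le_rfl x) (norm_nonneg _) (by positivity)).trans
    (le_of_eq ?_)
  rw [mul_assoc, ← Real.exp_add]
  ring_nf

lemma contDiff_expKer (z : Fin n → ℂ) : ContDiff ℝ ∞ (expKer z) := by
  unfold expKer
  refine Complex.contDiff_exp.comp (contDiff_const.mul (ContDiff.sum fun i _ => ?_))
  exact (Complex.ofRealCLM.contDiff.comp (contDiff_coord i)).mul contDiff_const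

lemma pderiv_expKer (z : Fin n → ℂ) (j : Fin n) (x : E n) :
    pderiv j (expKer z) x = -Complex.I * z j * expKer z x := by
  have h1 : HasFDerivAt (fun x : E n => -Complex.I * ∑ i, (x i : ℂ) * z i)
      (-Complex.I • ∑ i, z i • Complex.ofRealCLM.comp (EuclideanSpace.proj i : E n →L[ℝ] ℝ)) x := by
    refine HasFDerivAt.const_mul ?_ _
    refine HasFDerivAt.fun_sum fun i _ => ?_
    exact ((Complex.ofRealCLM.comp
      (EuclideanSpace.proj i : E n →L[ℝ] ℝ)).hasFDerivAt).mul_const (z i)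
  have h3 : HasFDerivAt (expKer z) _ x := h1.cexp
  rw [pderiv, h3.fderiv]
  simp only [ContinuousLinearMap.comp_apply, smul_apply,
    sum_apply, proj_single, smul_eq_mul,
    Complex.ofRealCLM_apply]
  have hs : ∑ i, z i * (((if i = j then 1 else 0 : ℝ)) : ℂ) = z j := by
    rw [Finset.sum_eq_single j (fun i _ hi => by rw [if_neg hi, Complex.ofReal_zero, mul_zero])
      (fun h => absurd (Finset.mem_univ j) h), if_pos rfl, Complex.ofReal_one, mul_one]
  rw [hs, expKer]
  ring

/-- Integration by parts, legitimate for every complex z since the Gaussian beats all exponentials.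
Iterated, it yields the transforms of all μ_k. -/
lemma FL_gaussDeriv [NeZero n] (hc : ∀ i, 0 < c i) (p : MvPolynomial (Fin n) ℂ) (j : Fin n)
    (z : Fin n → ℂ) :
    FL (polyGauss c (gaussDeriv c j p)) z = Complex.I * z j * FL (polyGauss c p) z := by
  have h := integral_mul_fderiv_eq_neg_fderiv_mul_of_integrable (μ := volume)
    (f := polyGauss c p) (g := expKer z) (v := EuclideanSpace.single j (1 : ℝ)) ?_ ?_
    (integrable_polyGauss_mul_expKer hc p z)
    (fun x _ => (contDiff_polyGauss p).differentiable (by simp) x)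
    (fun x _ => (contDiff_expKer z).differentiable (by simp) x)
  · have e1 : ∀ x, fderiv ℝ (expKer z) x (EuclideanSpace.single j (1 : ℝ)) =
      -Complex.I * z j * expKer z x := pderiv_expKer z j
    have e2 : ∀ x, fderiv ℝ (polyGauss c p) x (EuclideanSpace.single j (1 : ℝ)) =
      polyGauss c (gaussDeriv c j p) x := congrFun (pderiv_polyGauss p j)
    simp only [e1, e2] at h
    rw [FL, FL, ← integral_const_mul, ← neg_eq_iff_eq_neg.2 h, ← integral_neg]
    refine integral_congr_ae (Eventually.of_forall fun x => ?_)
    simp only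
    ring
  · refine (integrable_polyGauss_mul_expKer hc (gaussDeriv c j p) z).congr
      (Eventually.of_forall fun x => ?_)
    simp only
    rw [← pderiv_polyGauss]
    rfl
  · refine ((integrable_polyGauss_mul_expKer hc p z).const_mul (-Complex.I * z j)).congr
      (Eventually.of_forall fun x => ?_)
    simp only
    rw [show fderiv ℝ (expKer z) x (EuclideanSpace.single j (1 : ℝ)) =
      -Complex.I * z j * expKer z x from pderiv_expKer z j x]
    ring

lemma FL_mu0 (hc : ∀ i, 0 < c i) (z : Fin n → ℂ) :
    FL (mu0 c) z = Complex.exp (-∑ i, z i ^ 2 / (2 * c i)) := by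
  have hpi := Real.pi_pos
  have h := GaussianFourier.integral_cexp_neg_sum_mul_add (b := fun i => ((c i / 2 : ℝ) : ℂ))
    (fun i => by rw [Complex.ofReal_re]; exact half_pos (hc i)) (fun i => -Complex.I * z i)
  have e1 : FL (mu0 c) z = (Real.sqrt (∏ i, c i / (2 * Real.pi)) : ℂ) *
      ∫ v : Fin n → ℝ, Complex.exp (-∑ i, ((c i / 2 : ℝ) : ℂ) * (v i : ℂ) ^ 2
        + ∑ i, -Complex.I * z i * v i) := by
    rw [← integral_const_mul, FL, ← (PiLp.volume_preserving_toLp (Fin n)).integral_comp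
      (MeasurableEquiv.toLp 2 _).measurableEmbedding]
    refine integral_congr_ae (Eventually.of_forall fun v => ?_)
    simp only [mu0, expKer]
    rw [Complex.ofReal_mul, mul_assoc, Complex.ofReal_exp, ← Complex.exp_add]
    congr 2
    push_cast
    rw [Finset.mul_sum, Finset.mul_sum, ← Finset.sum_neg_distrib]
    congr 1 <;> exact Finset.sum_congr rfl fun i _ => by ring
  rw [e1, h, Finset.prod_mul_distrib, ← Complex.exp_sum, ← mul_assoc]
  -- The normalising constant of μ₀ cancels the Gaussian integral, so the transform of μ₀ is 1 at
  -- the origin.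
  have e2 : (Real.sqrt (∏ i, c i / (2 * Real.pi)) : ℂ) *
      ∏ i, ((Real.pi : ℂ) / ((c i / 2 : ℝ) : ℂ)) ^ (1 / 2 : ℂ) = 1 := by
    have e3 : ∀ i, ((Real.pi : ℂ) / ((c i / 2 : ℝ) : ℂ)) ^ (1 / 2 : ℂ) =
        ((Real.sqrt ((c i / (2 * Real.pi))⁻¹) : ℝ) : ℂ) := fun i => by
      rw [Real.sqrt_eq_rpow, Complex.ofReal_cpow (by have := hc i; positivity)]
      congr 1
      · push_cast
        have : (c i : ℂ) ≠ 0 := by exact_mod_cast (hc i).ne'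
        field_simp
      · push_cast
        rfl
    simp only [e3]
    rw [← Complex.ofReal_prod, ← Complex.ofReal_mul, ← Real.sqrt_prod _ fun i _ => by
        have := hc i
        positivity,
      ← Real.sqrt_mul (Finset.prod_nonneg fun i _ => by have := hc i; positivity),
      ← Finset.prod_mul_distrib]
    rw [Finset.prod_eq_one fun i _ => mul_inv_cancel₀ (by have := hc i; positivity)]
    simp
  rw [e2, one_mul, ← Finset.sum_neg_distrib]
  congr 1
  refine Finset.sum_congr rfl fun i _ => ?_
  have : (c i : ℂ) ≠ 0 := by exact_mod_cast (hc i).ne'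
  push_cast
  rw [mul_pow, neg_pow, Complex.I_sq]
  field_simp
  ring

end PolyGauss

/-! ### The functions `μ_k` and their density -/

section Hermite

open MvPolynomial (eval monomial)

variable {n : ℕ} {β : ℝ} {c : Fin n → ℝ}

/-- The polynomial `p` with `μ_k = p μ₀`. -/
def hermitePoly (c : Fin n → ℝ) (k : Fin n → ℕ) : MvPolynomial (Fin n) ℂ :=
  (List.finRange n).foldr (fun i p => (gaussDeriv c i)^[k i] p) 1

lemma iterate_pderiv_polyGauss (p : MvPolynomial (Fin n) ℂ) (i : Fin n) (m : ℕ) :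
    (pderiv i)^[m] (polyGauss c p) = polyGauss c ((gaussDeriv c i)^[m] p) := by
  induction m generalizing p with
  | zero => rfl
  | succ m ih => rw [Function.iterate_succ_apply, pderiv_polyGauss, ih, Function.iterate_succ_apply]

lemma polyGauss_one : polyGauss c 1 = mu0 c := by
  funext x
  simp [polyGauss]

lemma mu_eq_polyGauss (k : Fin n → ℕ) : mu c k = polyGauss c (hermitePoly c k) := by
  unfold mu mpderiv hermitePoly
  induction List.finRange n with
  | nil => exact polyGauss_one.symm
  | cons i l ih =>
    rw [List.foldr_cons, List.foldr_cons, ih, iterate_pderiv_polyGauss]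

lemma FL_mu [NeZero n] (hc : ∀ i, 0 < c i) (k : Fin n → ℕ) (z : Fin n → ℂ) :
    FL (mu c k) z = (∏ i, (Complex.I * z i) ^ k i) * Complex.exp (-∑ i, z i ^ 2 / (2 * c i)) := by
  have hiter : ∀ (i : Fin n) (m : ℕ) (p : MvPolynomial (Fin n) ℂ),
      FL (polyGauss c ((gaussDeriv c i)^[m] p)) z
        = (Complex.I * z i) ^ m * FL (polyGauss c p) z := by
    intro i m p
    induction m generalizing p with
    | zero => simp
    | succ m ih => rw [Function.iterate_succ_apply, ih, FL_gaussDeriv hc]; ring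
  rw [mu_eq_polyGauss, hermitePoly, ← List.prod_ofFn, List.ofFn_eq_map]
  induction List.finRange n with
  | nil => simp [polyGauss_one, FL_mu0 hc]
  | cons i l ih => rw [List.foldr_cons, hiter, ih, List.map_cons, List.prod_cons, mul_assoc]

/-- The commutator of two derivations is a derivation, and it kills every variable. -/
lemma pderiv_comm_poly (i j : Fin n) (p : MvPolynomial (Fin n) ℂ) :
    MvPolynomial.pderiv i (MvPolynomial.pderiv j p)
      = MvPolynomial.pderiv j (MvPolynomial.pderiv i p) := by
  have h : ⁅MvPolynomial.pderiv (R := ℂ) i, MvPolynomial.pderiv (R := ℂ) j⁆ = 0 := by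
    apply MvPolynomial.derivation_ext
    intro l
    classical
    simp only [Derivation.commutator_apply, MvPolynomial.pderiv_X, Derivation.zero_apply]
    simp only [Pi.single_apply]
    split_ifs <;> simp
  have := congrArg (fun D => D p) h
  simp only [Derivation.commutator_apply, Derivation.zero_apply] at this
  exact sub_eq_zero.1 this

lemma gaussDeriv_comm (i j : Fin n) :
    Function.Commute (gaussDeriv c i) (gaussDeriv c j) := by
  intro p
  rcases eq_or_ne i j with rfl | h
  · rfl
  simp only [gaussDeriv_apply, map_sub, MvPolynomial.pderiv_mul, MvPolynomial.pderiv_C,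
    MvPolynomial.pderiv_X_of_ne h, MvPolynomial.pderiv_X_of_ne h.symm]
  rw [pderiv_comm_poly]
  ring

/-- The mixed derivatives are taken in a fixed order, so raising one exponent inserts a factor in
the middle of the product. Commutation brings it to the front; duplicate-freeness makes it occur
only once. -/
lemma foldr_iterate_succ {ι α : Type*} [DecidableEq ι] (f : ι → α → α)
    (hf : ∀ i j, Function.Commute (f i) (f j)) (k : ι → ℕ) (j : ι) (a : α) (l : List ι)
    (hl : l.Nodup) :
    l.foldr (fun i h => (f i)^[Function.update k j (k j + 1) i] h) a =
      if j ∈ l then f j (l.foldr (fun i h => (f i)^[k i] h) a)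
      else l.foldr (fun i h => (f i)^[k i] h) a := by
  induction l with
  | nil => simp
  | cons i l ih =>
    rw [List.nodup_cons] at hl
    rw [List.foldr_cons, List.foldr_cons, ih hl.2]
    by_cases hij : j = i
    · subst hij
      rw [if_neg hl.1, if_pos List.mem_cons_self, Function.update_self,
        Function.iterate_succ_apply']
    · rw [Function.update_of_ne (Ne.symm hij)]
      by_cases hjl : j ∈ l
      · rw [if_pos hjl, if_pos (List.mem_cons_of_mem _ hjl)]
        exact ((hf i j).iterate_left (k i)) _
      · rw [if_neg hjl, if_neg (by simp [hij, hjl])]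

lemma gaussDeriv_hermitePoly (k : Fin n → ℕ) (j : Fin n) :
    gaussDeriv c j (hermitePoly c k) = hermitePoly c (Function.update k j (k j + 1)) := by
  unfold hermitePoly
  rw [foldr_iterate_succ (fun i => gaussDeriv c i) (fun i j => gaussDeriv_comm i j) k j 1 _
    (List.nodup_finRange n), if_pos (List.mem_finRange j)]

/-- The polynomials of the `μ_k` span all polynomials. -/
lemma span_hermitePoly (hc : ∀ i, 0 < c i) :
    Submodule.span ℂ (Set.range (hermitePoly c)) = ⊤ := by
  set W := Submodule.span ℂ (Set.range (hermitePoly c))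
  have hD : ∀ j, ∀ p ∈ W, gaussDeriv c j p ∈ W := by
    intro j p hp
    have : W ≤ W.comap (gaussDeriv c j) := by
      refine Submodule.span_le.2 ?_
      rintro _ ⟨k, rfl⟩
      change gaussDeriv c j (hermitePoly c k) ∈ W
      rw [gaussDeriv_hermitePoly]
      exact Submodule.subset_span ⟨_, rfl⟩
    exact this hp
  have hone : (1 : MvPolynomial (Fin n) ℂ) ∈ W := by
    refine Submodule.subset_span ⟨0, ?_⟩
    unfold hermitePoly
    induction List.finRange n with
    | nil => rfl
    | cons i l ih => rw [List.foldr_cons, ih]; rfl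
  -- Multiplication by X j is recovered as (∂ⱼ - `gaussDeriv c j`)/cⱼ. The second operator preserves
  -- W, and the first lowers the degree, which feeds the strong induction.
  have hmon : ∀ d : ℕ, ∀ s : Fin n →₀ ℕ, s.degree = d → monomial s (1 : ℂ) ∈ W := by
    intro d
    induction d using Nat.strong_induction_on with
    | _ d ih =>
      intro s hs
      rcases eq_or_ne s 0 with rfl | h0
      · exact hone
      obtain ⟨j, hj⟩ := Finsupp.support_nonempty_iff.2 h0
      have hj' : 1 ≤ s j := Nat.one_le_iff_ne_zero.2 (Finsupp.mem_support_iff.1 hj)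
      set s' := s - Finsupp.single j 1 with hs'
      have hss : s = s' + Finsupp.single j 1 := by
        rw [hs', tsub_add_cancel_of_le (Finsupp.single_le_iff.2 hj')]
      have hdeg : s'.degree + 1 = d := by
        rw [← hs, hss, map_add, Finsupp.degree_single]
      have h1 : monomial s' (1 : ℂ) ∈ W := ih _ (by omega) s' rfl
      have h2 : MvPolynomial.pderiv j (monomial s' (1 : ℂ)) ∈ W := by
        rw [MvPolynomial.pderiv_monomial, one_mul]
        have : monomial (s' - Finsupp.single j 1) (s' j : ℂ)
            = (s' j : ℂ) • monomial (s' - Finsupp.single j 1) (1 : ℂ) := by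
          rw [MvPolynomial.smul_monomial, smul_eq_mul, mul_one]
        rw [this]
        refine W.smul_mem _ (ih _ ?_ _ rfl)
        have : (s' - Finsupp.single j 1).degree ≤ s'.degree :=
          Finsupp.degree_mono tsub_le_self
        omega
      have h3 := W.smul_mem ((c j : ℂ)⁻¹) (W.sub_mem h2 (hD j _ h1))
      rw [gaussDeriv_apply, sub_sub_cancel, mul_assoc, ← MvPolynomial.smul_eq_C_mul, smul_smul,
        inv_mul_cancel₀ (by exact_mod_cast (hc j).ne'), one_smul] at h3
      rw [hss, add_comm, MvPolynomial.monomial_single_add, pow_one]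
      exact h3
  rw [eq_top_iff]
  intro p _
  rw [p.as_sum]
  refine W.sum_mem fun s _ => ?_
  have : monomial s (p.coeff s) = p.coeff s • monomial s (1 : ℂ) := by
    rw [MvPolynomial.smul_monomial, smul_eq_mul, mul_one]
  rw [this]
  exact W.smul_mem _ (hmon _ s rfl)

/-- The functions `μ_k` as elements of `L²(ω)`. -/
def muL [NeZero n] (hc : ∀ i, 0 < c i) (hβ : 0 ≤ β) (k : Fin n → ℕ) : WL2 n β :=
  polyGaussL hc hβ (hermitePoly c k)

lemma coeFn_muL [NeZero n] (hc : ∀ i, 0 < c i) (hβ : 0 ≤ β) (k : Fin n → ℕ) :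
    muL hc hβ k =ᵐ[volume] mu c k := by
  rw [mu_eq_polyGauss]
  exact ae_volume_of_ae_weight (coeFn_polyGaussL hc hβ _)

lemma FL_muL [NeZero n] (hc : ∀ i, 0 < c i) (hβ : 0 ≤ β) (k : Fin n → ℕ) (z : Fin n → ℂ) :
    FL (muL hc hβ k) z =
      (∏ i, (Complex.I * z i) ^ k i) * Complex.exp (-∑ i, z i ^ 2 / (2 * c i)) := by
  rw [FL_congr (coeFn_muL hc hβ k), FL_mu hc]

lemma polyGaussL_mem_span [NeZero n] (hc : ∀ i, 0 < c i) (hβ : 0 ≤ β)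
    (p : MvPolynomial (Fin n) ℂ) :
    polyGaussL hc hβ p ∈ Submodule.span ℂ (Set.range (muL (β := β) hc hβ)) := by
  have hp : p ∈ Submodule.span ℂ (Set.range (hermitePoly c)) := by
    rw [span_hermitePoly hc]
    trivial
  have : Submodule.span ℂ (Set.range (hermitePoly c)) ≤
      (Submodule.span ℂ (Set.range (muL (β := β) hc hβ))).comap (polyGaussL hc hβ) := by
    refine Submodule.span_le.2 ?_
    rintro _ ⟨k, rfl⟩
    exact Submodule.subset_span ⟨k, rfl⟩
  exact this hp

lemma integral_weightMeasure_complex [NeZero n] (g : E n → ℂ) :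
    ∫ x, g x ∂(weightMeasure n β) = ∫ x, (weight β x : ℂ) * g x := by
  rw [weightMeasure, integral_withDensity_eq_integral_toReal_smul (by
    exact continuous_weight.measurable.ennreal_ofReal) (by simp)]
  refine integral_congr_ae (Eventually.of_forall fun x => ?_)
  simp only
  rw [ENNReal.toReal_ofReal (weight_pos x).le, Complex.real_smul]

/-- The span of the functions `μ_k` is dense in `L²(ω)`. -/
lemma dense_span_muL [NeZero n] (hc : ∀ i, 0 < c i) (hβ : 0 < β) :
    (Submodule.span ℂ (Set.range (muL (β := β) hc hβ.le))).topologicalClosure = ⊤ := by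
  rw [Submodule.topologicalClosure_eq_top_iff, Submodule.eq_bot_iff]
  intro h hh
  obtain ⟨C, hC0, hC⟩ := exists_norm_mu0_le hc (β + (β + 1))
  -- Orthogonality of h to polynomials times μ₀ says that all moments of u vanish. The Gaussian lets
  -- the transform of u be expanded in moments, so it is zero and u = 0; then h = 0 because ω μ₀ has
  -- no zeros.
  set u : E n → ℂ := fun x => h x * ((weight β x : ℂ) * mu0 c x) with hu
  have hwm : ∀ x : E n, ‖(weight β x : ℂ) * mu0 c x‖ ≤ n * C * Real.exp (-(β + 1) * supn x) := by
    intro x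
    rw [norm_mul, Complex.norm_real, Real.norm_of_nonneg (weight_pos x).le]
    refine (mul_le_mul (weight_le_exp hβ.le x) (hC x) (norm_nonneg _) (by positivity)).trans
      (le_of_eq ?_)
    rw [mul_mul_mul_comm, ← Real.exp_add]
    ring_nf
  have hwm1 : ∀ x : E n, ‖(weight β x : ℂ) * mu0 c x‖ ≤ n * C := fun x => by
    refine (hwm x).trans (mul_le_of_le_one_right (by positivity) (Real.exp_le_one_iff.2 ?_))
    have := mul_nonneg (by linarith : 0 ≤ β + 1) (supn_nonneg x)
    linarith
  have hcm : Continuous fun x : E n => (weight β x : ℂ) * mu0 c x :=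
    (Complex.continuous_ofReal.comp continuous_weight).mul contDiff_mu0.continuous
  have hum : AEStronglyMeasurable u :=
    (aestronglyMeasurable_volume h).mul hcm.aestronglyMeasurable
  have huL : MemLp u 2 (weightMeasure n β) := by
    refine MemLp.of_le_mul (c := n * C) (Lp.memLp h) (hum.mono_ac weightMeasure_ac_volume)
      (Eventually.of_forall fun x => ?_)
    rw [hu, norm_mul, mul_comm]
    exact mul_le_mul_of_nonneg_right (hwm1 x) (norm_nonneg _)
  -- all moments of `u` vanish
  have hmom : ∀ (ξ : E n) (j : ℕ), ∫ x, u x * ((∑ i, x i * ξ i : ℝ) : ℂ) ^ j = 0 := by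
    intro ξ j
    set p : MvPolynomial (Fin n) ℂ := (∑ i, MvPolynomial.C (ξ i : ℂ) * MvPolynomial.X i) ^ j with hp
    have hpe : ∀ x : E n, eval (toComplex x) p = ((∑ i, x i * ξ i : ℝ) : ℂ) ^ j := fun x => by
      simp [hp, toComplex, mul_comm]
    have h1 := (Submodule.mem_orthogonal _ _).1 hh _ (polyGaussL_mem_span hc hβ.le p)
    rw [L2.inner_def] at h1
    have h2 : ∫ x, (fun x => h x * (eval (toComplex x) p * mu0 c x)) x ∂(weightMeasure n β) = 0 := by
      rw [← h1]
      refine integral_congr_ae ?_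
      filter_upwards [coeFn_polyGaussL hc hβ.le p] with x hx
      rw [hx, RCLike.inner_apply]
      congr 1
      rw [polyGauss, hpe, map_mul, map_pow, Complex.conj_ofReal, mu0, Complex.conj_ofReal]
    rw [integral_weightMeasure_complex] at h2
    rw [← h2]
    refine integral_congr_ae (Eventually.of_forall fun x => ?_)
    simp only [hu, hpe]
    ring
  have huz : huL.toLp u = 0 := by
    refine ext_FL hβ fun ξ => ?_
    set R := ∑ i, |ξ i| with hR
    obtain ⟨C', hC0', hC'⟩ := exists_norm_mu0_le hc (β + R)
    have hub : ∀ x : E n, ‖u x‖ * Real.exp |∑ i, x i * ξ i| ≤ n * C' * ‖h x‖ := by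
      intro x
      have h1 : Real.exp |∑ i, x i * ξ i| ≤ Real.exp (R * supn x) :=
        Real.exp_le_exp.2 (abs_sum_mul_le x ξ)
      have h2 := weight_le_exp hβ.le x
      simp only [hu]
      rw [norm_mul, norm_mul, Complex.norm_real, Real.norm_of_nonneg (weight_pos x).le]
      calc ‖h x‖ * (weight β x * ‖mu0 c x‖) * Real.exp |∑ i, x i * ξ i|
          ≤ ‖h x‖ * (n * Real.exp (β * supn x) * (C' * Real.exp (-(β + R) * supn x)))
            * Real.exp (R * supn x) := by
            gcongr
            exact hC' x
        _ = n * C' * ‖h x‖ *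
            Real.exp (β * supn x + (-(β + R) * supn x) + R * supn x) := by
            rw [Real.exp_add, Real.exp_add]
            ring
        _ = n * C' * ‖h x‖ := by
            rw [show β * supn x + (-(β + R) * supn x) + R * supn x = 0 by ring, Real.exp_zero,
              mul_one]
    have hr : Integrable (fun x => n * C' * ‖h x‖) := by
      obtain ⟨K, _, hK⟩ := exists_integral_exp_le (n := n) (β := β) (r := 0) (by linarith)
      refine ((hK h).1.const_mul (n * C')).congr (Eventually.of_forall fun x => ?_)
      simp
    -- The exponential series is integrated term by term. Its absolute sum is |u| exp|x·ξ|, which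
    -- the Gaussian factor in u reduces to a multiple of |h|.
    have hsum := hasSum_integral_of_dominated_convergence (μ := (volume : Measure (E n)))
      (F := fun (j : ℕ) x => u x * ((-Complex.I * ((∑ i, x i * ξ i : ℝ) : ℂ)) ^ j / j.factorial))
      (f := fun x => u x * expKer (toComplex ξ) x)
      (fun j x => ‖u x‖ * (|∑ i, x i * ξ i| ^ j / j.factorial))
      (fun j => hum.mul (by fun_prop))
      (fun j => Eventually.of_forall fun x => by
        rw [norm_mul (u x), norm_div, norm_pow, norm_mul (-Complex.I), Complex.norm_real,
          norm_neg, Complex.norm_I, one_mul, Complex.norm_natCast, Real.norm_eq_abs])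
      (Eventually.of_forall fun x => (Real.summable_pow_div_factorial _).mul_left _)
      (by
        have e : ∀ x : E n, ∑' j : ℕ, ‖u x‖ * (|∑ i, x i * ξ i| ^ j / j.factorial)
            = ‖u x‖ * Real.exp |∑ i, x i * ξ i| := fun x => by
          rw [tsum_mul_left, Real.exp_eq_exp_ℝ, NormedSpace.exp_eq_tsum_div]
        simp_rw [e]
        refine hr.mono' (hum.norm.mul (by fun_prop)) (Eventually.of_forall fun x => ?_)
        rw [Real.norm_of_nonneg (by positivity)]
        exact hub x)
      (Eventually.of_forall fun x => by
        refine HasSum.mul_left _ ?_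
        have := NormedSpace.expSeries_div_hasSum_exp (𝔸 := ℂ)
          (-Complex.I * ((∑ i, x i * ξ i : ℝ) : ℂ))
        rw [← Complex.exp_eq_exp_ℂ] at this
        have e : expKer (toComplex ξ) x
            = Complex.exp (-Complex.I * ((∑ i, x i * ξ i : ℝ) : ℂ)) := by
          rw [expKer]
          push_cast
          rfl
        rw [e]
        exact this)
    have hzero : ∀ j : ℕ, ∫ x, u x *
        ((-Complex.I * ((∑ i, x i * ξ i : ℝ) : ℂ)) ^ j / j.factorial) = 0 := fun j => by
      rw [← mul_zero ((-Complex.I) ^ j / j.factorial), ← hmom ξ j, ← integral_const_mul]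
      refine integral_congr_ae (Eventually.of_forall fun x => ?_)
      simp only
      rw [mul_pow]
      ring
    simp only [hzero] at hsum
    have h5 : FL u (toComplex ξ) = 0 := hsum.unique hasSum_zero
    have h6 : FL (0 : WL2 n β) (toComplex ξ) = 0 := by
      rw [← FLc_apply (toComplex_mem_tube hβ ξ), map_zero]
    rw [h6, ← h5]
    exact FL_congr (ae_volume_of_ae_weight huL.coeFn_toLp) _
  have h3 : ∀ᵐ x ∂(weightMeasure n β), h x = 0 := by
    have h4 := huL.coeFn_toLp
    rw [huz] at h4
    filter_upwards [h4, Lp.coeFn_zero ℂ 2 (weightMeasure n β)] with x hx h0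
    rw [h0, hu, Pi.zero_apply] at hx
    have hne : (weight β x : ℂ) * mu0 c x ≠ 0 := by
      refine mul_ne_zero (by exact_mod_cast (weight_pos x).ne') ?_
      rw [mu0, Complex.ofReal_ne_zero]
      have : 0 < ∏ i, c i / (2 * Real.pi) :=
        Finset.prod_pos fun i _ => div_pos (hc i) Real.two_pi_pos
      positivity
    exact (mul_eq_zero.1 hx.symm).resolve_right hne
  exact (Lp.eq_zero_iff_ae_eq_zero).2 h3

end Hermite

/-! ### Fourier multipliers -/

section Multiplier

variable {n : ℕ} {β : ℝ} {c : Fin n → ℝ}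

/-- Construction of a bounded operator from its values on a dense subspace, where the values are
described by a separating family of functionals. -/
lemma exists_clm_of_dense {X ι : Type*} [NormedAddCommGroup X] [NormedSpace ℂ X] [CompleteSpace X]
    {W : Submodule ℂ X} (hW : W.topologicalClosure = ⊤) (a b : ι → X →L[ℂ] ℂ)
    (hb : ∀ x y : X, (∀ i, b i x = b i y) → x = y) {K : ℝ} (hK : 0 ≤ K)
    (h : ∀ x ∈ W, ∃ y, (∀ i, b i y = a i x) ∧ ‖y‖ ≤ K * ‖x‖) :
    ∃ A : X →L[ℂ] X, (∀ x i, b i (A x) = a i x) ∧ ‖A‖ ≤ K := by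
  have hall : ∀ x : X, ∃ y, (∀ i, b i y = a i x) ∧ ‖y‖ ≤ K * ‖x‖ := by
    intro x
    have hx : x ∈ closure (W : Set X) := by
      rw [← Submodule.topologicalClosure_coe, hW]
      trivial
    obtain ⟨w, hw, hlim⟩ := mem_closure_iff_seq_limit.1 hx
    choose y hy hyn using fun j => h (w j) (hw j)
    -- The solution attached to the difference wⱼ - w_l must be yⱼ - y_l, since the functionals b
    -- separate points. Thus the bound on norms becomes a Lipschitz bound.
    have hdiff : ∀ j l, ‖y j - y l‖ ≤ K * ‖w j - w l‖ := by
      intro j l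
      obtain ⟨y', hy', hn⟩ := h (w j - w l) (W.sub_mem (hw j) (hw l))
      have : y j - y l = y' := hb _ _ fun i => by rw [map_sub, hy, hy, hy', map_sub]
      rwa [this]
    have hc : CauchySeq y := by
      have hwc := hlim.cauchySeq
      rw [Metric.cauchySeq_iff'] at hwc ⊢
      intro ε hε
      obtain ⟨N, hN⟩ := hwc (ε / (K + 1)) (by positivity)
      refine ⟨N, fun j hj => ?_⟩
      have h1 := hN j hj
      rw [dist_eq_norm] at h1 ⊢
      rw [lt_div_iff₀ (by positivity)] at h1
      have h2 := hdiff j N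
      nlinarith [norm_nonneg (w j - w N)]
    obtain ⟨y₀, hy₀⟩ := cauchySeq_tendsto_of_complete hc
    refine ⟨y₀, fun i => ?_, ?_⟩
    · have h1 := ((b i).continuous.tendsto y₀).comp hy₀
      have h2 := ((a i).continuous.tendsto x).comp hlim
      refine tendsto_nhds_unique h1 (h2.congr fun j => ?_)
      simp only [Function.comp_apply, hy]
    · exact le_of_tendsto_of_tendsto hy₀.norm (hlim.norm.const_mul K)
        (Eventually.of_forall fun j => hyn j)
  choose A hA hAn using hall
  let L : X →ₗ[ℂ] X :=
    { toFun := A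
      map_add' := fun x y => hb _ _ fun i => by simp only [hA, map_add]
      map_smul' := fun r x => hb _ _ fun i => by simp [hA] }
  exact ⟨L.mkContinuous K hAn, fun x i => hA x i, L.mkContinuous_norm_le hK _⟩

lemma TubeDecay.add {F G : (Fin n → ℂ) → ℂ} {C C' : ℝ} (hF : TubeDecay β F C)
    (hG : TubeDecay β G C') : TubeDecay β (fun z => F z + G z) (C + C') where
  analytic := hF.analytic.add hG.analytic
  decay := fun z hz => by
    rw [add_mul]
    exact (norm_add_le _ _).trans (add_le_add (hF.decay z hz) (hG.decay z hz))

lemma TubeDecay.mul_bounded {F m : (Fin n → ℂ) → ℂ} {C M : ℝ} (hF : TubeDecay β F C)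
    (hm : AnalyticOnNhd ℂ m (tube n β)) (hM : ∀ z ∈ tube n β, ‖m z‖ ≤ M) :
    TubeDecay β (fun z => m z * F z) (M * C) where
  analytic := hm.mul hF.analytic
  decay := fun z hz => by
    rw [norm_mul, mul_assoc]
    exact mul_le_mul (hM z hz) (hF.decay z hz) (norm_nonneg _) ((norm_nonneg _).trans (hM z hz))

/-- On a horizontal strip the Gaussian beats exp(-2|Re z|): one factor exp(-|Re z|) pays for the
power of z and the other remains as decay. -/
lemma norm_pow_mul_gauss_le {B a : ℝ} (hB : 0 ≤ B) (ha : 0 < a) (k : ℕ) :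
    ∃ C : ℝ, 0 ≤ C ∧ ∀ z : ℂ, |z.im| ≤ B →
      ‖(Complex.I * z) ^ k * Complex.exp (-(z ^ 2 / (2 * a)))‖ ≤ C * Real.exp (-|z.re|) := by
  refine ⟨k.factorial * Real.exp (B + 2 * a + B ^ 2 / (2 * a)), by positivity, fun z hz => ?_⟩
  have h1 : ‖z‖ ^ k ≤ k.factorial * Real.exp (|z.re| + B) := by
    have h2 := Real.pow_div_factorial_le_exp (|z.re| + B) (by positivity) k
    rw [div_le_iff₀ (by positivity), mul_comm] at h2
    refine le_trans ?_ h2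
    gcongr
    exact (Complex.norm_le_abs_re_add_abs_im z).trans (by gcongr)
  have h3 : (-(z ^ 2 / (2 * (a : ℂ)))).re = -(z.re ^ 2 / (2 * a)) + z.im ^ 2 / (2 * a) := by
    have : (2 * (a : ℂ)) = ((2 * a : ℝ) : ℂ) := by push_cast; rfl
    rw [this, Complex.neg_re, Complex.div_ofReal_re, sq, Complex.mul_re]
    ring
  have h4 : z.im ^ 2 / (2 * a) ≤ B ^ 2 / (2 * a) := by
    rw [← sq_abs z.im]
    gcongr
  have h5 : 2 * |z.re| ≤ 2 * a + z.re ^ 2 / (2 * a) := by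
    rw [← sq_abs z.re]
    have : 2 * a + |z.re| ^ 2 / (2 * a) - 2 * |z.re| = (|z.re| - 2 * a) ^ 2 / (2 * a) := by
      field_simp
      ring
    have h6 : 0 ≤ (|z.re| - 2 * a) ^ 2 / (2 * a) := by positivity
    linarith
  rw [norm_mul, norm_pow, norm_mul, Complex.norm_I, one_mul, Complex.norm_exp, h3]
  refine (mul_le_mul_of_nonneg_right h1 (Real.exp_pos _).le).trans ?_
  rw [mul_assoc, mul_assoc, ← Real.exp_add, ← Real.exp_add]
  refine mul_le_mul_of_nonneg_left (Real.exp_le_exp.2 ?_) (by positivity)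
  linarith

lemma abs_im_le_of_mem_tube {z : Fin n → ℂ} (hz : z ∈ tube n β) (i : Fin n) :
    |(z i).im| ≤ β / 2 :=
  (Finset.single_le_sum (f := fun i => |(z i).im|) (fun _ _ => abs_nonneg _)
    (Finset.mem_univ i)).trans (le_of_lt hz)

lemma analyticAt_coord (i : Fin n) (z : Fin n → ℂ) : AnalyticAt ℂ (fun z : Fin n → ℂ => z i) z :=
  (ContinuousLinearMap.proj (R := ℂ) (φ := fun _ : Fin n => ℂ) i).analyticAt z

lemma analyticOnNhd_gauss (a : Fin n → ℂ) (s : Set (Fin n → ℂ)) :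
    AnalyticOnNhd ℂ (fun z : Fin n → ℂ => Complex.exp (-∑ i, a i * z i ^ 2)) s := fun z _ =>
  (Finset.analyticAt_fun_sum _ fun i _ => analyticAt_const.mul ((analyticAt_coord i z).pow 2)).neg.cexp

/-- The transform of μ_k factorises over the coordinates, so the one-variable strip estimate
suffices. -/
lemma exists_tubeDecay_muL [NeZero n] (hc : ∀ i, 0 < c i) (hβ : 0 ≤ β) (k : Fin n → ℕ) :
    ∃ C, TubeDecay β (FL (muL (β := β) hc hβ k)) C := by
  choose C hC0 hC using fun i => norm_pow_mul_gauss_le (div_nonneg hβ zero_le_two) (hc i) (k i)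
  have he : FL (muL (β := β) hc hβ k) = fun z : Fin n → ℂ =>
      (∏ i, (Complex.I * z i) ^ k i) * Complex.exp (-∑ i, z i ^ 2 / (2 * (c i : ℂ))) :=
    funext fun z => FL_muL hc hβ k z
  refine ⟨∏ i, C i, ?_, fun z hz => ?_⟩
  · rw [he]
    intro z hz
    refine AnalyticAt.mul ?_ ?_
    · exact Finset.analyticAt_fun_prod _ fun i _ =>
        (analyticAt_const.mul (analyticAt_coord i z)).pow _
    · refine (analyticOnNhd_gauss (fun i => (2 * (c i : ℂ))⁻¹) _ z hz).congr
        (Eventually.of_forall fun w => ?_)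
      simp only [div_eq_mul_inv, mul_comm]
  · rw [he]
    simp only
    rw [← Finset.sum_neg_distrib, Complex.exp_sum, ← Finset.prod_mul_distrib, norm_prod,
      ← Finset.sum_neg_distrib, Real.exp_sum, ← Finset.prod_mul_distrib]
    exact Finset.prod_le_prod (fun i _ => norm_nonneg _) fun i _ =>
      hC i (z i) (abs_im_le_of_mem_tube hz i)

lemma FL_add [NeZero n] (f g : WL2 n β) {z : Fin n → ℂ} (hz : z ∈ tube n β) :
    FL (f + g : WL2 n β) z = FL f z + FL g z := by
  rw [← FLc_apply hz, map_add, FLc_apply, FLc_apply]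

lemma FL_smul [NeZero n] (a : ℂ) (f : WL2 n β) {z : Fin n → ℂ} (hz : z ∈ tube n β) :
    FL (a • f : WL2 n β) z = a * FL f z := by
  rw [← FLc_apply hz, map_smul, FLc_apply, smul_eq_mul]

lemma FL_zero [NeZero n] {z : Fin n → ℂ} (hz : z ∈ tube n β) : FL (0 : WL2 n β) z = 0 := by
  rw [← FLc_apply hz, map_zero]

lemma TubeDecay.congr {F G : (Fin n → ℂ) → ℂ} {C : ℝ} (hF : TubeDecay β F C)
    (h : ∀ z ∈ tube n β, F z = G z) : TubeDecay β G C where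
  analytic := fun z hz => (hF.analytic z hz).congr
    (Filter.eventually_of_mem (isOpen_tube.mem_nhds hz) h)
  decay := fun z hz => h z hz ▸ hF.decay z hz

lemma exists_tubeDecay_span [NeZero n] (hc : ∀ i, 0 < c i) (hβ : 0 < β) {f : WL2 n β}
    (hf : f ∈ Submodule.span ℂ (Set.range (muL (β := β) hc hβ.le))) :
    ∃ C, TubeDecay β (FL f) C := by
  induction hf using Submodule.span_induction with
  | mem f hf =>
    obtain ⟨k, rfl⟩ := hf
    exact exists_tubeDecay_muL hc hβ.le k
  | zero =>
    refine ⟨0, TubeDecay.congr (F := fun _ => 0) ⟨analyticOnNhd_const, fun z _ => by simp⟩ ?_⟩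
    exact fun z hz => (FL_zero hz).symm
  | add f g _ _ hf hg =>
    obtain ⟨C, hC⟩ := hf
    obtain ⟨C', hC'⟩ := hg
    exact ⟨C + C', (hC.add hC').congr fun z hz => (FL_add f g hz).symm⟩
  | smul a f _ hf =>
    obtain ⟨C, hC⟩ := hf
    exact ⟨‖a‖ * C, (hC.mul_bounded (m := fun _ => a) analyticOnNhd_const
      fun _ _ => le_rfl).congr fun z hz => (FL_smul a f hz).symm⟩

lemma lintegral_exp_sq_le [NeZero n] {b : ℝ} (hb : 2 * |b| ≤ β) (i : Fin n) (f : WL2 n β) :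
    ∫⁻ x, ENNReal.ofReal (Real.exp (2 * b * x i) * ‖f x‖ ^ 2) ≤ ENNReal.ofReal (2 * ‖f‖ ^ 2) := by
  rw [← ofReal_integral_eq_lintegral_ofReal (integrable_exp_sq hb i f)
    (Eventually.of_forall fun x => by positivity)]
  exact ENNReal.ofReal_le_ofReal (integral_exp_sq_le hb i f)

/-- A bounded analytic function on the tube is a Fourier multiplier on `L²(ω)`. -/
theorem exists_multiplier [NeZero n] (hβ : 0 < β) {m : (Fin n → ℂ) → ℂ}
    (hm : AnalyticOnNhd ℂ m (tube n β)) {M : ℝ} (hM : ∀ z ∈ tube n β, ‖m z‖ ≤ M) :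
    ∃ A : WL2 n β →L[ℂ] WL2 n β, ∀ (f : WL2 n β) (ξ : E n),
      FL (A f) (toComplex ξ) = m (toComplex ξ) * FL f (toComplex ξ) := by
  have hM0 : 0 ≤ M := (norm_nonneg _).trans (hM _ (toComplex_mem_tube hβ 0))
  -- The statement does not involve C; any Gaussian provides a dense subspace, so the standard one
  -- is taken.
  have hc : ∀ i : Fin n, (0 : ℝ) < (fun _ => 1 : Fin n → ℝ) i := fun i => one_pos
  obtain ⟨A, hA, _⟩ := exists_clm_of_dense (ι := E n) (dense_span_muL hc hβ)
    (a := fun ξ => m (toComplex ξ) • FLc β (toComplex ξ) (toComplex_mem_tube hβ ξ))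
    (b := fun ξ => FLc β (toComplex ξ) (toComplex_mem_tube hβ ξ))
    (fun f g h => ext_FL hβ fun ξ => by simpa using h ξ)
    (K := Real.sqrt (n * (M ^ 2 * 2))) (by positivity) (fun f hf => by
      obtain ⟨C, hC⟩ := exists_tubeDecay_span hc hβ hf
      -- The Paley-Wiener theorem is applied to the product of m and the transform of f. Its L²
      -- norms on the shifted spaces are at most M times those of f, uniformly in the shift.
      obtain ⟨h, h1, h2⟩ := (hC.mul_bounded hm hM).exists_FL_eq hβ (K := M ^ 2 * (2 * ‖f‖ ^ 2))
        (by positivity) (fun i b hb => by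
          calc ∫⁻ ξ, ENNReal.ofReal (‖m (linePt i (Complex.I * b) ξ) *
                FL f (linePt i (Complex.I * b) ξ)‖ ^ 2)
              ≤ ∫⁻ ξ, ENNReal.ofReal (M ^ 2) *
                ENNReal.ofReal (‖FL f (linePt i (Complex.I * b) ξ)‖ ^ 2) := by
                refine lintegral_mono fun ξ => ?_
                rw [← ENNReal.ofReal_mul (by positivity), norm_mul, mul_pow]
                refine ENNReal.ofReal_le_ofReal ?_
                gcongr
                exact hM _ (linePt_mem_tube (by simpa using hb) ξ)
            _ = ENNReal.ofReal (M ^ 2) *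
                ∫⁻ x, ENNReal.ofReal (Real.exp (2 * b * x i) * ‖f x‖ ^ 2) := by
                rw [lintegral_const_mul' _ _ ENNReal.ofReal_ne_top, lintegral_FL_linePt hb]
            _ ≤ ENNReal.ofReal (M ^ 2) * ENNReal.ofReal (2 * ‖f‖ ^ 2) := by
                gcongr
                exact lintegral_exp_sq_le hb.le i f
            _ = ENNReal.ofReal (M ^ 2 * (2 * ‖f‖ ^ 2)) :=
                (ENNReal.ofReal_mul (by positivity)).symm)
      refine ⟨h, fun ξ => by simpa using h1 ξ, h2.trans (le_of_eq ?_)⟩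
      rw [show (n : ℝ) * (M ^ 2 * (2 * ‖f‖ ^ 2)) = n * (M ^ 2 * 2) * ‖f‖ ^ 2 by ring,
        Real.sqrt_mul (by positivity), Real.sqrt_sq (norm_nonneg f)])
  exact ⟨A, fun f ξ => by simpa using hA f ξ⟩

end Multiplier

/-! ### The semigroup generated by the Fokker-Planck operator -/

section Semigroup

variable {n : ℕ} {β : ℝ} {c : Fin n → ℝ}

lemma lintegral_diag (d : Fin n → ℝ) (hd : ∀ i, 0 < d i) {g : E n → ENNReal} (hg : Measurable g) :
    ENNReal.ofReal (∏ i, d i) * ∫⁻ ξ : E n, g (WithLp.toLp 2 fun i => d i * ξ i) = ∫⁻ ξ, g ξ := by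
  classical
  have hdet : (Matrix.diagonal d).det = ∏ i, d i := Matrix.det_diagonal
  have hpos : 0 < ∏ i, d i := Finset.prod_pos fun i _ => hd i
  have hvol := Real.smul_map_diagonal_volume_pi (D := d) (by rw [hdet]; exact hpos.ne')
  rw [hdet, abs_of_pos hpos] at hvol
  have hmp := PiLp.volume_preserving_toLp (Fin n)
  have hemb := (MeasurableEquiv.toLp 2 (Fin n → ℝ)).measurableEmbedding
  rw [← hmp.lintegral_comp_emb hemb g, ← hmp.lintegral_comp_emb hemb]
  have hlin : Measurable (Matrix.toLin' (Matrix.diagonal d)) :=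
    (LinearMap.continuous_of_finiteDimensional _).measurable
  have hgm : Measurable fun a : Fin n → ℝ => g (WithLp.toLp 2 a) := hg.comp hemb.measurable
  conv_rhs => rw [← hvol]
  refine Eq.trans ?_ (lintegral_smul_measure _ _).symm
  refine Eq.trans ?_ (congrArg (ENNReal.ofReal (∏ i, d i) • ·) (lintegral_map hgm hlin).symm)
  rw [smul_eq_mul]
  congr 1
  refine lintegral_congr fun v => ?_
  congr 2
  funext i
  rw [Matrix.toLin'_apply, Matrix.mulVec_diagonal]

lemma norm_le_of_lintegral_le [NeZero n] (hβ : 0 < β) {h : WL2 n β} {K : ℝ} (hK0 : 0 ≤ K)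
    (hK : ∀ (i : Fin n) (b : ℝ), 2 * |b| < β →
      ∫⁻ x, ENNReal.ofReal (Real.exp (2 * b * x i) * ‖h x‖ ^ 2) ≤ ENNReal.ofReal K) :
    ‖h‖ ≤ Real.sqrt (n * K) := by
  obtain ⟨f, hf, hn⟩ := exists_mem_of_lintegral_le hβ (aestronglyMeasurable_volume h) hK0 hK
  have : f = h := Lp.ext (weightMeasure_ac_volume.ae_le hf)
  rwa [this] at hn

/-- The point `e^{-tC} z`. -/
def scaleC (c : Fin n → ℝ) (t : ℝ) (z : Fin n → ℂ) : Fin n → ℂ :=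
  fun i => (Real.exp (-(c i * t)) : ℂ) * z i

/-- The numbers `(1 - e^{-2 cᵢ t}) / (2 cᵢ)`. -/
def ouVar (c : Fin n → ℝ) (t : ℝ) (i : Fin n) : ℝ := (1 - Real.exp (-(c i * t)) ^ 2) / (2 * c i)

/-- The Fourier transform of the Gaussian transition kernel at time `t`. -/
def ouGauss (c : Fin n → ℝ) (t : ℝ) (z : Fin n → ℂ) : ℂ :=
  Complex.exp (-∑ i, (ouVar c t i : ℂ) * z i ^ 2)

lemma scaleC_scaleC (s t : ℝ) (z : Fin n → ℂ) : scaleC c t (scaleC c s z) = scaleC c (s + t) z := by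
  funext i
  simp only [scaleC]
  rw [← mul_assoc, ← Complex.ofReal_mul, ← Real.exp_add]
  congr 3
  ring

lemma scaleC_zero (z : Fin n → ℂ) : scaleC c 0 z = z := by
  funext i
  simp [scaleC]

lemma exp_neg_le_one (hc : ∀ i, 0 < c i) {t : ℝ} (ht : 0 ≤ t) (i : Fin n) :
    Real.exp (-(c i * t)) ≤ 1 :=
  Real.exp_le_one_iff.2 (neg_nonpos.2 (mul_nonneg (hc i).le ht))

lemma sum_abs_im_scaleC_le (hc : ∀ i, 0 < c i) {t : ℝ} (ht : 0 ≤ t) (z : Fin n → ℂ) :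
    ∑ i, |(scaleC c t z i).im| ≤ ∑ i, |(z i).im| := by
  refine Finset.sum_le_sum fun i _ => ?_
  rw [scaleC, Complex.im_ofReal_mul, abs_mul, abs_of_pos (Real.exp_pos _)]
  exact mul_le_of_le_one_left (abs_nonneg _) (exp_neg_le_one hc ht i)

lemma scaleC_mem_tube (hc : ∀ i, 0 < c i) {t : ℝ} (ht : 0 ≤ t) {z : Fin n → ℂ}
    (hz : z ∈ tube n β) : scaleC c t z ∈ tube n β :=
  (sum_abs_im_scaleC_le hc ht z).trans_lt hz

/-- The cocycle identity over the flow e^{-tC}; it is the semigroup law in Fourier variables. -/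
lemma ouGauss_mul (hc : ∀ i, 0 < c i) (s t : ℝ) (z : Fin n → ℂ) :
    ouGauss c s z * ouGauss c t (scaleC c s z) = ouGauss c (s + t) z := by
  simp only [ouGauss]
  rw [← Complex.exp_add, ← neg_add, ← Finset.sum_add_distrib]
  congr 2
  refine Finset.sum_congr rfl fun i _ => ?_
  have hci : (c i : ℂ) ≠ 0 := by exact_mod_cast (hc i).ne'
  have he : Real.exp (-(c i * (s + t))) = Real.exp (-(c i * s)) * Real.exp (-(c i * t)) := by
    rw [← Real.exp_add]
    congr 1
    ring
  simp only [ouVar, scaleC, he]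
  push_cast
  field_simp
  ring

lemma ouGauss_zero (z : Fin n → ℂ) : ouGauss c 0 z = 1 := by
  simp [ouGauss, ouVar]

lemma ouVar_nonneg (hc : ∀ i, 0 < c i) {t : ℝ} (ht : 0 ≤ t) (i : Fin n) : 0 ≤ ouVar c t i := by
  have h1 := exp_neg_le_one hc ht i
  have h2 := Real.exp_pos (-(c i * t))
  have := hc i
  refine div_nonneg ?_ (by linarith)
  nlinarith

lemma ouVar_le (hc : ∀ i, 0 < c i) (t : ℝ) (i : Fin n) : ouVar c t i ≤ 1 / (2 * c i) := by
  have := hc i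
  refine div_le_div_of_nonneg_right ?_ (by linarith)
  linarith [sq_nonneg (Real.exp (-(c i * t)))]

lemma norm_ouGauss (t : ℝ) (z : Fin n → ℂ) :
    ‖ouGauss c t z‖ =
      Real.exp (-∑ i, ouVar c t i * (z i).re ^ 2) * Real.exp (∑ i, ouVar c t i * (z i).im ^ 2) := by
  rw [ouGauss, Complex.norm_exp, ← Real.exp_add, Complex.neg_re, Complex.re_sum, neg_add_eq_sub,
    ← Finset.sum_sub_distrib, ← Finset.sum_neg_distrib]
  congr 1
  refine Finset.sum_congr rfl fun i _ => ?_
  rw [Complex.re_ofReal_mul, sq, Complex.mul_re]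
  ring

/-- On the tube |Im zᵢ| ≤ β/2, and the variances stay below 1/(2cᵢ), so imaginary parts cost only a
constant independent of t. The decay in Re z is retained for the estimate on 𝓗_k. -/
lemma norm_ouGauss_le (hc : ∀ i, 0 < c i) {t : ℝ} (ht : 0 ≤ t) {z : Fin n → ℂ}
    (hz : z ∈ tube n β) : ‖ouGauss c t z‖ ≤
      Real.exp (-∑ i, ouVar c t i * (z i).re ^ 2) * Real.exp (∑ i, β ^ 2 / (8 * c i)) := by
  rw [norm_ouGauss]
  refine mul_le_mul_of_nonneg_left (Real.exp_le_exp.2 (Finset.sum_le_sum fun i _ => ?_))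
    (Real.exp_pos _).le
  have h1 := ouVar_nonneg hc ht i
  have h2 := ouVar_le hc t i
  have h3 := abs_im_le_of_mem_tube hz i
  have := hc i
  calc ouVar c t i * (z i).im ^ 2 ≤ 1 / (2 * c i) * (β / 2) ^ 2 := by
        rw [← sq_abs (z i).im]
        gcongr
    _ = β ^ 2 / (8 * c i) := by
        field_simp
        ring

lemma scaleC_linePt (t : ℝ) (i : Fin n) (w : ℂ) (ξ : E n) :
    scaleC c t (linePt i w ξ) = linePt i (Real.exp (-(c i * t)) * w)
      (WithLp.toLp 2 fun j => Real.exp (-(c j * t)) * ξ j) := by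
  funext j
  by_cases hj : j = i
  · subst hj
    simp [scaleC, linePt]
    ring
  · simp [scaleC, linePt, hj]
    ring

lemma measurable_FL_linePt [NeZero n] {i : Fin n} {b : ℝ} (hb : 2 * |b| < β) (f : WL2 n β) :
    Measurable fun ξ => FL f (linePt i (Complex.I * b) ξ) := by
  simp_rw [FL_linePt]
  exact (VectorFourier.fourierIntegral_continuous Real.continuous_fourierChar
    continuous_inner (integrable_exp_mul hb f)).measurable

/-- The flow sends the shifted space at height b to that at height e^{-cᵢ t} b, still inside the
tube, and contributes the Jacobian e^{t tr C}. This growth is crude but harmless: only local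
boundedness in t is drawn from it. -/
lemma norm_le_of_FL_eq [NeZero n] (hc : ∀ i, 0 < c i) (hβ : 0 < β) {t : ℝ} (ht : 0 ≤ t)
    {f h : WL2 n β}
    (hfh : ∀ z ∈ tube n β, FL h z = ouGauss c t z * FL f (scaleC c t z)) :
    ‖h‖ ≤ Real.sqrt (n * (Real.exp (∑ i, β ^ 2 / (8 * c i)) ^ 2 *
      (Real.exp (t * ∑ i, c i) * 2))) * ‖f‖ := by
  set κ := Real.exp (∑ i, β ^ 2 / (8 * c i)) with hκ
  have hκ0 : 0 < κ := Real.exp_pos _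
  set K := κ ^ 2 * (Real.exp (t * ∑ i, c i) * (2 * ‖f‖ ^ 2)) with hK
  have hmain := norm_le_of_lintegral_le hβ (h := h) (K := K) (by positivity) fun i b hb => ?_
  · refine hmain.trans (le_of_eq ?_)
    rw [show (n : ℝ) * K = n * (κ ^ 2 * (Real.exp (t * ∑ i, c i) * 2)) * ‖f‖ ^ 2 by
      rw [hK]; ring, Real.sqrt_mul (by positivity), Real.sqrt_sq (norm_nonneg f)]
  set b' := Real.exp (-(c i * t)) * b with hb'
  have hb'' : 2 * |b'| < β := by
    rw [hb', abs_mul, abs_of_pos (Real.exp_pos _)]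
    have := mul_le_of_le_one_left (abs_nonneg b) (exp_neg_le_one hc ht i)
    linarith
  have hpt : ∀ ξ : E n, scaleC c t (linePt i (Complex.I * b) ξ) = linePt i (Complex.I * b')
      (WithLp.toLp 2 fun j => Real.exp (-(c j * t)) * ξ j) := fun ξ => by
    rw [scaleC_linePt, hb']
    push_cast
    ring_nf
  have hprod : ∏ j, Real.exp (-(c j * t)) = (Real.exp (t * ∑ i, c i))⁻¹ := by
    rw [← Real.exp_sum, ← Real.exp_neg, Finset.mul_sum, ← Finset.sum_neg_distrib]
    congr 1
    exact Finset.sum_congr rfl fun j _ => by ring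
  have hdiag := lintegral_diag (fun j => Real.exp (-(c j * t))) (fun j => Real.exp_pos _)
    (g := fun ξ => ENNReal.ofReal (‖FL f (linePt i (Complex.I * b') ξ)‖ ^ 2))
    ((measurable_FL_linePt hb'' f).norm.pow_const 2).ennreal_ofReal
  rw [hprod] at hdiag
  have hE := Real.exp_pos (t * ∑ i, c i)
  calc ∫⁻ x, ENNReal.ofReal (Real.exp (2 * b * x i) * ‖h x‖ ^ 2)
      = ∫⁻ ξ, ENNReal.ofReal (‖FL h (linePt i (Complex.I * b) ξ)‖ ^ 2) :=
        (lintegral_FL_linePt hb h).symm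
    _ ≤ ∫⁻ ξ : E n, ENNReal.ofReal (κ ^ 2) * ENNReal.ofReal (‖FL f (linePt i (Complex.I * b')
          (WithLp.toLp 2 fun j => Real.exp (-(c j * t)) * ξ j))‖ ^ 2) := by
        refine lintegral_mono fun ξ => ?_
        have hz : linePt i (Complex.I * b) ξ ∈ tube n β := linePt_mem_tube (by simpa using hb) ξ
        rw [← ENNReal.ofReal_mul (by positivity), hfh _ hz, norm_mul, mul_pow, hpt]
        refine ENNReal.ofReal_le_ofReal ?_
        gcongr
        refine (norm_ouGauss_le hc ht hz).trans (mul_le_of_le_one_left (by positivity) ?_)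
        rw [Real.exp_le_one_iff, neg_nonpos]
        exact Finset.sum_nonneg fun j _ => mul_nonneg (ouVar_nonneg hc ht j) (sq_nonneg _)
    _ = ENNReal.ofReal (κ ^ 2) * (ENNReal.ofReal (Real.exp (t * ∑ i, c i)) *
          ∫⁻ ξ, ENNReal.ofReal (‖FL f (linePt i (Complex.I * b') ξ)‖ ^ 2)) := by
        rw [lintegral_const_mul' _ _ ENNReal.ofReal_ne_top, ← hdiag, ← mul_assoc (ENNReal.ofReal
          (Real.exp (t * ∑ i, c i))), ← ENNReal.ofReal_mul hE.le, mul_inv_cancel₀ hE.ne',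
          ENNReal.ofReal_one, one_mul]
    _ ≤ ENNReal.ofReal (κ ^ 2) * (ENNReal.ofReal (Real.exp (t * ∑ i, c i)) *
          ENNReal.ofReal (2 * ‖f‖ ^ 2)) := by
        rw [lintegral_FL_linePt hb'']
        gcongr
        exact lintegral_exp_sq_le hb''.le i f
    _ = ENNReal.ofReal K := by
        rw [← ENNReal.ofReal_mul hE.le, ← ENNReal.ofReal_mul (by positivity)]

/-- The transition Gaussian times the rescaled transform of μ₀ is again the transform of μ₀
(stationarity). Only the monomial of degree k feels the scaling. -/
lemma FL_muL_scaleC [NeZero n] (hc : ∀ i, 0 < c i) (hβ : 0 ≤ β) (k : Fin n → ℕ) (t : ℝ)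
    (z : Fin n → ℂ) : ouGauss c t z * FL (muL (β := β) hc hβ k) (scaleC c t z) =
      Complex.exp (t * eigval c k) * FL (muL (β := β) hc hβ k) z := by
  rw [FL_muL, FL_muL, ouGauss]
  have h1 : ∏ i, (Complex.I * scaleC c t z i) ^ k i =
      Complex.exp (t * eigval c k) * ∏ i, (Complex.I * z i) ^ k i := by
    have : (t : ℂ) * eigval c k = ∑ i, (k i : ℂ) * ((-(c i * t) : ℝ) : ℂ) := by
      rw [eigval]
      push_cast
      rw [mul_neg, Finset.mul_sum, ← Finset.sum_neg_distrib]
      exact Finset.sum_congr rfl fun i _ => by ring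
    rw [this, Complex.exp_sum, ← Finset.prod_mul_distrib]
    refine Finset.prod_congr rfl fun i _ => ?_
    rw [Complex.exp_nat_mul, ← mul_pow, scaleC, Complex.ofReal_exp]
    ring
  have h2 : Complex.exp (-∑ i, (ouVar c t i : ℂ) * z i ^ 2) *
      Complex.exp (-∑ i, scaleC c t z i ^ 2 / (2 * c i)) =
      Complex.exp (-∑ i, z i ^ 2 / (2 * c i)) := by
    rw [← Complex.exp_add, ← neg_add, ← Finset.sum_add_distrib]
    congr 2
    refine Finset.sum_congr rfl fun i _ => ?_
    have hci : (c i : ℂ) ≠ 0 := by exact_mod_cast (hc i).ne'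
    simp only [ouVar, scaleC]
    push_cast
    field_simp
    ring
  rw [h1, ← h2]
  ring

/-- The image of a μ_k is an explicit multiple of it, so on their span nothing but the norm bound is
needed before extending by density. The functionals range over all tube points, which gives the
formula on the tube and not only on ℝⁿ. -/
lemma exists_ou [NeZero n] (hc : ∀ i, 0 < c i) (hβ : 0 < β) {t : ℝ} (ht : 0 ≤ t) :
    ∃ A : WL2 n β →L[ℂ] WL2 n β,
      (∀ f, ∀ z ∈ tube n β, FL (A f) z = ouGauss c t z * FL f (scaleC c t z)) ∧
      ‖A‖ ≤ Real.sqrt (n * (Real.exp (∑ i, β ^ 2 / (8 * c i)) ^ 2 *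
        (Real.exp (t * ∑ i, c i) * 2))) := by
  obtain ⟨A, hA, hn⟩ := exists_clm_of_dense (ι := tube n β) (dense_span_muL hc hβ)
    (a := fun z => ouGauss c t z • FLc β (scaleC c t z) (scaleC_mem_tube hc ht z.2))
    (b := fun z => FLc β z z.2)
    (fun f g h => ext_FL hβ fun ξ => by simpa using h ⟨_, toComplex_mem_tube hβ ξ⟩)
    (K := Real.sqrt (n * (Real.exp (∑ i, β ^ 2 / (8 * c i)) ^ 2 *
      (Real.exp (t * ∑ i, c i) * 2)))) (by positivity) (fun f hf => by
      have : ∃ h : WL2 n β, ∀ z ∈ tube n β, FL h z = ouGauss c t z * FL f (scaleC c t z) := by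
        induction hf using Submodule.span_induction with
        | mem f hf =>
          obtain ⟨k, rfl⟩ := hf
          exact ⟨Complex.exp (t * eigval c k) • muL hc hβ.le k, fun z hz => by
            rw [FL_smul _ _ hz, FL_muL_scaleC]⟩
        | zero =>
          exact ⟨0, fun z hz => by
            rw [FL_zero hz, FL_zero (scaleC_mem_tube hc ht hz), mul_zero]⟩
        | add f g _ _ hf hg =>
          obtain ⟨h, hh⟩ := hf
          obtain ⟨h', hh'⟩ := hg
          exact ⟨h + h', fun z hz => by
            rw [FL_add _ _ hz, FL_add _ _ (scaleC_mem_tube hc ht hz), hh z hz, hh' z hz, mul_add]⟩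
        | smul a f _ hf =>
          obtain ⟨h, hh⟩ := hf
          exact ⟨a • h, fun z hz => by
            rw [FL_smul _ _ hz, FL_smul _ _ (scaleC_mem_tube hc ht hz), hh z hz]
            ring⟩
      obtain ⟨h, hh⟩ := this
      exact ⟨h, fun z => by simpa using hh z z.2, norm_le_of_FL_eq hc hβ ht hh⟩)
  exact ⟨A, fun f z hz => by simpa using hA f ⟨z, hz⟩, hn⟩

/-- The semigroup generated by the Fokker-Planck operator on `L²(ω)` (for `t ≥ 0`). -/
def ou [NeZero n] (hc : ∀ i, 0 < c i) (hβ : 0 < β) (t : ℝ) : WL2 n β →L[ℂ] WL2 n β :=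
  if ht : 0 ≤ t then (exists_ou hc hβ ht).choose else 0

lemma FL_ou [NeZero n] (hc : ∀ i, 0 < c i) (hβ : 0 < β) {t : ℝ} (ht : 0 ≤ t) (f : WL2 n β)
    {z : Fin n → ℂ} (hz : z ∈ tube n β) :
    FL (ou hc hβ t f) z = ouGauss c t z * FL f (scaleC c t z) := by
  rw [ou, dif_pos ht]
  exact (exists_ou hc hβ ht).choose_spec.1 f z hz

lemma norm_ou_le [NeZero n] (hc : ∀ i, 0 < c i) (hβ : 0 < β) {t : ℝ} (ht : 0 ≤ t) :
    ‖ou (β := β) hc hβ t‖ ≤ Real.sqrt (n * (Real.exp (∑ i, β ^ 2 / (8 * c i)) ^ 2 *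
        (Real.exp (t * ∑ i, c i) * 2))) := by
  rw [ou, dif_pos ht]
  exact (exists_ou hc hβ ht).choose_spec.2

lemma ext_FL_tube [NeZero n] (hβ : 0 < β) {f g : WL2 n β}
    (h : ∀ z ∈ tube n β, FL f z = FL g z) : f = g :=
  ext_FL hβ fun ξ => h _ (toComplex_mem_tube hβ ξ)

lemma ou_zero [NeZero n] (hc : ∀ i, 0 < c i) (hβ : 0 < β) (f : WL2 n β) : ou hc hβ 0 f = f :=
  ext_FL_tube hβ fun z hz => by rw [FL_ou hc hβ le_rfl f hz, ouGauss_zero, scaleC_zero, one_mul]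

lemma ou_add [NeZero n] (hc : ∀ i, 0 < c i) (hβ : 0 < β) {s t : ℝ} (hs : 0 ≤ s) (ht : 0 ≤ t)
    (f : WL2 n β) : ou hc hβ (s + t) f = ou hc hβ s (ou hc hβ t f) :=
  ext_FL_tube hβ fun z hz => by
    rw [FL_ou hc hβ (add_nonneg hs ht) f hz, FL_ou hc hβ hs _ hz,
      FL_ou hc hβ ht f (scaleC_mem_tube hc hs hz), scaleC_scaleC, ← mul_assoc, ouGauss_mul hc]

lemma ou_muL [NeZero n] (hc : ∀ i, 0 < c i) (hβ : 0 < β) {t : ℝ} (ht : 0 ≤ t) (k : Fin n → ℕ) :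
    ou hc hβ t (muL hc hβ.le k) = Complex.exp (t * eigval c k) • muL hc hβ.le k :=
  ext_FL_tube hβ fun z hz => by rw [FL_ou hc hβ ht _ hz, FL_muL_scaleC, FL_smul _ _ hz]

/-- The semigroup is bounded on bounded time intervals. -/
lemma exists_norm_ou_le [NeZero n] (hc : ∀ i, 0 < c i) (hβ : 0 < β) (r : ℝ) :
    ∃ K : ℝ, 0 < K ∧ ∀ t : ℝ, 0 ≤ t → t ≤ r → ‖ou (β := β) hc hβ t‖ ≤ K := by
  refine ⟨Real.sqrt (n * (Real.exp (∑ i, β ^ 2 / (8 * c i)) ^ 2 *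
        (Real.exp (r * ∑ i, c i) * 2))) + 1, by positivity, fun t ht htr => ?_⟩
  refine (norm_ou_le hc hβ ht).trans (le_add_of_le_of_nonneg ?_ zero_le_one)
  have : 0 ≤ ∑ i, c i := Finset.sum_nonneg fun i _ => (hc i).le
  gcongr

/-- Orbits of the μ_k are scalar exponentials; density and the local bound on the norms do the rest.
-/
lemma continuousOn_ou [NeZero n] (hc : ∀ i, 0 < c i) (hβ : 0 < β) (f : WL2 n β) :
    ContinuousOn (fun t => ou hc hβ t f) (Set.Ici 0) := by
  have hspan : ∀ g ∈ Submodule.span ℂ (Set.range (muL (β := β) hc hβ.le)),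
      ContinuousOn (fun t => ou hc hβ t g) (Set.Ici 0) := by
    intro g hg
    induction hg using Submodule.span_induction with
    | mem f hf =>
      obtain ⟨k, rfl⟩ := hf
      refine ContinuousOn.congr (f := fun t : ℝ => Complex.exp (t * eigval c k) • muL hc hβ.le k)
        (by fun_prop) fun t ht => ou_muL hc hβ ht k
    | zero => simpa using continuousOn_const
    | add f g _ _ hf hg => simpa only [map_add] using hf.fun_add hg
    | smul a f _ hf => simpa only [map_smul] using hf.fun_const_smul a
  intro t ht
  obtain ⟨K, hK, hb⟩ := exists_norm_ou_le (β := β) hc hβ (t + 1)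
  have hf : f ∈ closure (Submodule.span ℂ (Set.range (muL (β := β) hc hβ.le)) : Set _) := by
    rw [← Submodule.topologicalClosure_coe, dense_span_muL hc hβ]
    trivial
  rw [Metric.continuousWithinAt_iff']
  intro ε hε
  obtain ⟨g, hg, hfg⟩ := Metric.mem_closure_iff.1 hf (ε / (3 * K)) (by positivity)
  have hgc := Metric.continuousWithinAt_iff'.1 (hspan g hg t ht) (ε / 3) (by positivity)
  have hloc : ∀ᶠ s in 𝓝[Set.Ici 0] t, s < t + 1 :=
    eventually_nhdsWithin_of_eventually_nhds (eventually_lt_nhds (by linarith))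
  filter_upwards [hgc, hloc, self_mem_nhdsWithin] with s hs hst hs0
  rw [dist_eq_norm] at hfg
  rw [lt_div_iff₀ (by positivity)] at hfg
  have h1 : ∀ r : ℝ, 0 ≤ r → r ≤ t + 1 → dist (ou hc hβ r f) (ou hc hβ r g) < ε / 3 := by
    intro r hr0 hr
    rw [dist_eq_norm, ← map_sub]
    have := (ou hc hβ r).le_of_opNorm_le (hb r hr0 hr) (f - g)
    linarith
  have h2 := h1 s hs0 hst.le
  have h3 := h1 t ht (by linarith)
  rw [dist_comm] at h3
  linarith [dist_triangle4 (ou hc hβ s f) (ou hc hβ s g) (ou hc hβ t g) (ou hc hβ t f)]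

end Semigroup

/-! ### Moments and the order of vanishing of the Fourier transform -/

section Moments

variable {n : ℕ} {β : ℝ} {c : Fin n → ℝ}

lemma exists_pow_le_exp {δ : ℝ} (hδ : 0 < δ) (k : ℕ) :
    ∃ C : ℝ, 0 < C ∧ ∀ s : ℝ, 0 ≤ s → s ^ k ≤ C * Real.exp (δ * s) := by
  refine ⟨k.factorial / δ ^ k, by positivity, fun s hs => ?_⟩
  have h := Real.pow_div_factorial_le_exp (δ * s) (by positivity) k
  rw [div_le_iff₀ (by positivity), mul_pow] at h
  rw [div_mul_eq_mul_div, le_div_iff₀ (by positivity)]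
  linarith

lemma norm_sum_mul_le (x : E n) (z : Fin n → ℂ) :
    ‖∑ i, (x i : ℂ) * z i‖ ≤ (∑ i, ‖z i‖) * supn x := by
  rw [Finset.sum_mul]
  refine (norm_sum_le _ _).trans (Finset.sum_le_sum fun i _ => ?_)
  rw [norm_mul, Complex.norm_real, Real.norm_eq_abs, mul_comm]
  exact mul_le_mul_of_nonneg_left (abs_le_supn x i) (norm_nonneg _)

lemma norm_monom_le (l : Fin n → ℕ) (x : E n) : ‖monom l x‖ ≤ supn x ^ ∑ i, l i := by
  rw [monom, Complex.norm_real, Real.norm_eq_abs, Finset.abs_prod, ← Finset.prod_pow_eq_pow_sum]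
  refine Finset.prod_le_prod (fun i _ => abs_nonneg _) fun i _ => ?_
  rw [abs_pow]
  exact pow_le_pow_left₀ (abs_nonneg _) (abs_le_supn x i) _

lemma continuous_monom (l : Fin n → ℕ) : Continuous (monom (n := n) l) := by
  unfold monom
  fun_prop

lemma exists_norm_monom_le {δ : ℝ} (hδ : 0 < δ) (l : Fin n → ℕ) :
    ∃ C : ℝ, ∀ x : E n, ‖monom l x‖ ≤ C * Real.exp (δ * supn x) := by
  obtain ⟨C, _, hC⟩ := exists_pow_le_exp hδ (∑ i, l i)
  exact ⟨C, fun x => (norm_monom_le l x).trans (hC _ (supn_nonneg x))⟩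

lemma integrable_mul_monom [NeZero n] (hβ : 0 < β) (f : WL2 n β) (l : Fin n → ℕ) :
    Integrable fun x => f x * monom l x := by
  obtain ⟨C, hC⟩ := exists_norm_monom_le (n := n) (δ := β / 4) (by positivity) l
  exact integrable_mul_of_le (by linarith) f (continuous_monom l).aestronglyMeasurable hC

/-- The moments, as bounded functionals. -/
lemma exists_moment_functional [NeZero n] (hβ : 0 < β) (l : Fin n → ℕ) :
    ∃ L : WL2 n β →L[ℂ] ℂ, ∀ f : WL2 n β, L f = ∫ x, f x * monom l x := by
  obtain ⟨C, hC⟩ := exists_norm_monom_le (n := n) (δ := β / 4) (by positivity) l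
  obtain ⟨K, _, h⟩ := exists_functional (n := n) (β := β) (r := β / 4) (by linarith)
  obtain ⟨L, hL, _⟩ := h _ C (continuous_monom l).aestronglyMeasurable hC
  exact ⟨L, hL⟩

/-- The moment of multi-index `l`. -/
def moment [NeZero n] (hβ : 0 < β) (l : Fin n → ℕ) : WL2 n β →L[ℂ] ℂ :=
  (exists_moment_functional hβ l).choose

lemma moment_apply [NeZero n] (hβ : 0 < β) (l : Fin n → ℕ) (f : WL2 n β) :
    moment hβ l f = ∫ x, f x * monom l x :=
  (exists_moment_functional hβ l).choose_spec f

lemma mem_momentSpace_iff [NeZero n] (hβ : 0 < β) {k : ℕ} {f : WL2 n β} :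
    f ∈ momentSpace n β k ↔ ∀ l : Fin n → ℕ, ∑ i, l i < k → moment hβ l f = 0 := by
  simp only [moment_apply]
  exact ⟨fun h l hl => (h l hl).2, fun h l hl => ⟨integrable_mul_monom hβ f l, h l hl⟩⟩

lemma isClosed_momentSpace [NeZero n] (hβ : 0 < β) (k : ℕ) :
    IsClosed (momentSpace n β k : Set (WL2 n β)) := by
  have : (momentSpace n β k : Set (WL2 n β)) =
      ⋂ (l : Fin n → ℕ) (_ : ∑ i, l i < k), {f | moment hβ l f = 0} := by
    ext f
    simp only [SetLike.mem_coe, mem_momentSpace_iff hβ, Set.mem_iInter, Set.mem_ofPred_eq]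
  rw [this]
  exact isClosed_iInter fun l => isClosed_iInter fun _ =>
    isClosed_eq (moment hβ l).continuous continuous_const

lemma momentSpace_anti [NeZero n] {j k : ℕ} (hjk : j ≤ k) :
    momentSpace n β k ≤ momentSpace n β j := fun _ h l hl => h l (hl.trans_le hjk)

lemma sum_mul_pow_eq (x : E n) (z : Fin n → ℂ) (j : ℕ) :
    (∑ i, (x i : ℂ) * z i) ^ j = ∑ l ∈ Finset.piAntidiag Finset.univ j,
      (Nat.multinomial Finset.univ l * ∏ i, z i ^ l i) * monom l x := by
  rw [Finset.sum_pow_eq_sum_piAntidiag]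
  refine Finset.sum_congr rfl fun l _ => ?_
  simp only [mul_pow, Finset.prod_mul_distrib, monom]
  push_cast
  ring

lemma integrable_mul_sum_pow [NeZero n] (hβ : 0 < β) (f : WL2 n β) (z : Fin n → ℂ) (j : ℕ) :
    Integrable fun x => f x * (∑ i, (x i : ℂ) * z i) ^ j := by
  simp only [sum_mul_pow_eq, Finset.mul_sum]
  refine integrable_finsetSum _ fun l _ => ?_
  refine ((integrable_mul_monom hβ f l).const_mul
    (Nat.multinomial Finset.univ l * ∏ i, z i ^ l i)).congr (Eventually.of_forall fun x => ?_)
  simp only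
  ring

lemma integral_mul_sum_pow [NeZero n] (hβ : 0 < β) (f : WL2 n β) (z : Fin n → ℂ) (j : ℕ) :
    ∫ x, f x * (∑ i, (x i : ℂ) * z i) ^ j = ∑ l ∈ Finset.piAntidiag Finset.univ j,
      (Nat.multinomial Finset.univ l * ∏ i, z i ^ l i) * moment hβ l f := by
  simp only [sum_mul_pow_eq, Finset.mul_sum, moment_apply]
  rw [integral_finsetSum]
  · refine Finset.sum_congr rfl fun l _ => ?_
    rw [← integral_const_mul]
    congr 1
    funext x
    ring
  · intro l _
    refine ((integrable_mul_monom hβ f l).const_mul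
      (Nat.multinomial Finset.univ l * ∏ i, z i ^ l i)).congr (Eventually.of_forall fun x => ?_)
    simp only
    ring

/-- Taylor expansion of the Fourier-Laplace transform at the origin. -/
lemma exists_norm_FL_sub_taylor_le [NeZero n] (hβ : 0 < β) (k : ℕ) :
    ∃ K : ℝ, 0 < K ∧ ∀ (f : WL2 n β) (z : Fin n → ℂ), ∑ i, ‖z i‖ ≤ β / 8 →
      ‖FL f z - ∑ j ∈ Finset.range k, (-Complex.I) ^ j / j.factorial *
        ∫ x, f x * (∑ i, (x i : ℂ) * z i) ^ j‖ ≤ K * (∑ i, ‖z i‖) ^ k * ‖f‖ := by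
  -- The remainder of the exponential series grows at most like |x|_∞^k exp((β/8)|x|_∞). A second
  -- β/8 absorbs the power, and the total β/4 is below the critical rate β/2.
  obtain ⟨K, hK, h⟩ := exists_functional (n := n) (β := β) (r := β / 4) (by linarith)
  obtain ⟨C, hC0, hC⟩ := exists_pow_le_exp (δ := β / 8) (by positivity) k
  refine ⟨C * K, by positivity, fun f z hz => ?_⟩
  set S := ∑ i, ‖z i‖ with hS
  have hS0 : 0 ≤ S := Finset.sum_nonneg fun i _ => norm_nonneg _
  obtain ⟨L, hL, hn⟩ := h (fun x => expKer z x - ∑ j ∈ Finset.range k,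
      (-Complex.I * ∑ i, (x i : ℂ) * z i) ^ j / j.factorial) (S ^ k * C)
    (Continuous.aestronglyMeasurable (by
      have := continuous_expKer z
      fun_prop)) (fun x => by
      refine (Complex.norm_exp_sub_sum_le_norm_mul_exp _ k).trans ?_
      have h1 : ‖-Complex.I * ∑ i, (x i : ℂ) * z i‖ ≤ S * supn x := by
        rw [norm_mul, norm_neg, Complex.norm_I, one_mul]
        exact norm_sum_mul_le x z
      have h2 : S * supn x ≤ β / 8 * supn x := mul_le_mul_of_nonneg_right hz (supn_nonneg x)
      calc _ ≤ (S * supn x) ^ k * Real.exp (β / 8 * supn x) :=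
            mul_le_mul (pow_le_pow_left₀ (norm_nonneg _) h1 _) (Real.exp_le_exp.2 (h1.trans h2))
              (Real.exp_pos _).le (pow_nonneg (mul_nonneg hS0 (supn_nonneg x)) _)
        _ ≤ (S ^ k * (C * Real.exp (β / 8 * supn x))) * Real.exp (β / 8 * supn x) := by
            rw [mul_pow]
            refine mul_le_mul_of_nonneg_right ?_ (Real.exp_pos _).le
            exact mul_le_mul_of_nonneg_left (hC _ (supn_nonneg x)) (pow_nonneg hS0 _)
        _ = S ^ k * C * Real.exp (β / 4 * supn x) := by
            rw [mul_assoc, mul_assoc, ← Real.exp_add, mul_assoc]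
            ring_nf)
  have hz' : z ∈ tube n β := by
    have : ∑ i, |(z i).im| ≤ S := Finset.sum_le_sum fun i _ => Complex.abs_im_le_norm _
    change ∑ i, |(z i).im| < β / 2
    linarith
  have hLf : L f = FL f z - ∑ j ∈ Finset.range k, (-Complex.I) ^ j / j.factorial *
        ∫ x, f x * (∑ i, (x i : ℂ) * z i) ^ j := by
    have he : ∀ x, f x * (expKer z x - ∑ j ∈ Finset.range k,
        (-Complex.I * ∑ i, (x i : ℂ) * z i) ^ j / j.factorial) = f x * expKer z x -
          ∑ j ∈ Finset.range k, (-Complex.I) ^ j / j.factorial *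
            (f x * (∑ i, (x i : ℂ) * z i) ^ j) := fun x => by
      rw [mul_sub, Finset.mul_sum]
      congr 1
      refine Finset.sum_congr rfl fun j _ => ?_
      rw [mul_pow]
      ring
    have hi : ∀ j ∈ Finset.range k, Integrable fun x => (-Complex.I) ^ j / j.factorial *
        (f x * (∑ i, (x i : ℂ) * z i) ^ j) := fun j _ =>
      (integrable_mul_sum_pow hβ f z j).const_mul _
    rw [hL, FL]
    simp only [he]
    rw [integral_sub (integrable_mul_expKer hz' f) (integrable_finsetSum _ hi),
      integral_finsetSum _ hi]
    simp only [integral_const_mul]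
  rw [← hLf]
  refine (L.le_of_opNorm_le hn f).trans (le_of_eq ?_)
  ring

/-- Near 0 the Taylor polynomial of order k - 1 vanishes. Away from 0 the transform is bounded on
|Im z|₁ ≤ r, and a constant is dominated by a multiple of (∑ ‖zᵢ‖)^k once that sum exceeds β/8. -/
lemma exists_norm_FL_le_of_mem_momentSpace [NeZero n] (hβ : 0 < β) (k : ℕ) {r : ℝ}
    (hr : r < β / 2) : ∃ K : ℝ, 0 < K ∧ ∀ f ∈ momentSpace n β k, ∀ z : Fin n → ℂ,
      ∑ i, |(z i).im| ≤ r → ‖FL f z‖ ≤ K * (∑ i, ‖z i‖) ^ k * ‖f‖ := by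
  obtain ⟨K₁, hK₁, h₁⟩ := exists_norm_FL_sub_taylor_le (n := n) hβ k
  obtain ⟨K₂, hK₂, h₂⟩ := exists_FL_functional (n := n) hr
  refine ⟨K₁ + K₂ / (β / 8) ^ k, by positivity, fun f hf z hz => ?_⟩
  set S := ∑ i, ‖z i‖ with hS
  have hS0 : 0 ≤ S := Finset.sum_nonneg fun i _ => norm_nonneg _
  rcases le_total S (β / 8) with hSβ | hSβ
  · have h := h₁ f z hSβ
    rw [Finset.sum_eq_zero, sub_zero] at h
    · refine h.trans ?_
      gcongr
      exact le_add_of_nonneg_right (by positivity)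
    · intro j hj
      rw [integral_mul_sum_pow hβ, Finset.sum_eq_zero, mul_zero]
      intro l hl
      rw [Finset.mem_piAntidiag] at hl
      rw [(mem_momentSpace_iff hβ).1 hf l (hl.1.trans_lt (Finset.mem_range.1 hj)), mul_zero]
  · obtain ⟨L, hL, hn⟩ := h₂ z hz
    have h := L.le_of_opNorm_le hn f
    rw [hL] at h
    refine h.trans (mul_le_mul_of_nonneg_right ?_ (norm_nonneg f))
    calc K₂ = K₂ / (β / 8) ^ k * (β / 8) ^ k := by field_simp
      _ ≤ (K₁ + K₂ / (β / 8) ^ k) * S ^ k := by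
        gcongr
        exact le_add_of_nonneg_left hK₁.le

lemma eq_zero_of_sum_monom (s : Finset (Fin n → ℕ)) (b : (Fin n → ℕ) → ℂ)
    (h : ∀ ξ : E n, ∑ l ∈ s, b l * monom l ξ = 0) : ∀ l ∈ s, b l = 0 := by
  classical
  set p : MvPolynomial (Fin n) ℂ := ∑ l ∈ s, MvPolynomial.monomial (Finsupp.equivFunOnFinite.symm l) (b l)
    with hp
  have hp0 : p = 0 := by
    refine MvPolynomial.funext_set (fun _ => Set.range ((↑) : ℝ → ℂ))
      (fun _ => Set.infinite_range_of_injective Complex.ofReal_injective) fun x hx => ?_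
    choose ξ hξ using fun i => hx i (Set.mem_univ i)
    have := h (WithLp.toLp 2 ξ)
    rw [map_zero, hp, map_sum, ← this]
    refine Finset.sum_congr rfl fun l _ => ?_
    rw [MvPolynomial.eval_monomial, Finsupp.prod_fintype _ _ (by simp), monom]
    push_cast
    simp [hξ]
  intro l hl
  have hcoef := congrArg (MvPolynomial.coeff (Finsupp.equivFunOnFinite.symm l)) hp0
  rw [hp, MvPolynomial.coeff_sum, Finset.sum_eq_single l] at hcoef
  · simpa using hcoef
  · intro m _ hm
    rw [MvPolynomial.coeff_monomial, if_neg]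
    exact fun h => hm (Finsupp.equivFunOnFinite.symm.injective h)
  · exact fun h => absurd hl h

lemma eq_zero_of_pow_mul_isBigO {g : ℝ → ℂ} (hg : ContinuousAt g 0) {j : ℕ}
    (h : (fun s : ℝ => (s : ℂ) ^ j * g s) =O[𝓝 0] fun s : ℝ => s ^ (j + 1)) : g 0 = 0 := by
  have h1 : g =O[𝓝[≠] 0] fun s : ℝ => s := by
    have h2 := (h.mono (nhdsWithin_le_nhds (s := {0}ᶜ))).norm_left
    obtain ⟨C, hC⟩ := h2.bound
    refine Asymptotics.IsBigO.of_bound C ?_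
    filter_upwards [hC, self_mem_nhdsWithin] with s hs hs0
    have hs0 : s ≠ 0 := hs0
    rw [norm_norm, norm_mul, norm_pow, Complex.norm_real, norm_pow, pow_succ,
      mul_left_comm] at hs
    exact le_of_mul_le_mul_left hs (pow_pos (norm_pos_iff.2 hs0) _)
  have h3 : Tendsto g (𝓝[≠] 0) (𝓝 0) :=
    h1.trans_tendsto (tendsto_nhdsWithin_of_tendsto_nhds tendsto_id)
  exact tendsto_nhds_unique (hg.tendsto.mono_left nhdsWithin_le_nhds) h3

/-- The space `𝓗_k` consists of the functions whose Fourier transform vanishes to order `k` at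
the origin, along real rays. -/
lemma mem_momentSpace_of_isBigO [NeZero n] (hβ : 0 < β) {k : ℕ} {f : WL2 n β}
    (h : ∀ ξ : E n, (fun s : ℝ => FL f (toComplex (s • ξ))) =O[𝓝 0] fun s : ℝ => s ^ k) :
    f ∈ momentSpace n β k := by
  induction k with
  | zero => exact fun l hl => absurd hl (Nat.not_lt_zero _)
  | succ k ih =>
    have hk : f ∈ momentSpace n β k := ih fun ξ => (h ξ).trans
      (Asymptotics.IsBigO.of_bound 1 (by
        filter_upwards [Metric.ball_mem_nhds (0 : ℝ) one_pos] with s hs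
        rw [one_mul, pow_succ, norm_mul]
        exact mul_le_of_le_one_right (norm_nonneg _) (by simpa using (mem_ball_zero_iff.1 hs).le)))
    obtain ⟨K, hK, hT⟩ := exists_norm_FL_sub_taylor_le (n := n) hβ (k + 1)
    -- By induction the moments of order below k vanish, so along the ray sξ the transform is its
    -- order-k term plus O(s^{k+1}). That term must therefore vanish; as a polynomial in ξ its
    -- coefficients are the moments of order k.
    have hzero : ∀ ξ : E n, ∫ x, f x * (∑ i, (x i : ℂ) * toComplex ξ i) ^ k = 0 := by
      intro ξ
      have hzs : ∀ (s : ℝ) i, toComplex (s • ξ) i = s * toComplex ξ i := fun s i => by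
        simp [toComplex]
      have hsmul : ∀ (s : ℝ) j, ∫ x, f x * (∑ i, (x i : ℂ) * toComplex (s • ξ) i) ^ j =
          (s : ℂ) ^ j * ∫ x, f x * (∑ i, (x i : ℂ) * toComplex ξ i) ^ j := fun s j => by
        rw [← integral_const_mul]
        congr 1
        funext x
        simp only [hzs, mul_left_comm _ (s : ℂ), ← Finset.mul_sum]
        ring
      have hO : (fun s : ℝ => (s : ℂ) ^ k * ((-Complex.I) ^ k / k.factorial *
          ∫ x, f x * (∑ i, (x i : ℂ) * toComplex ξ i) ^ k)) =O[𝓝 0]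
            fun s : ℝ => s ^ (k + 1) := by
        set S := ∑ i, ‖toComplex ξ i‖ with hS
        have hS0 : 0 ≤ S := Finset.sum_nonneg fun i _ => norm_nonneg _
        have hSs : ∀ s : ℝ, ∑ i, ‖toComplex (s • ξ) i‖ = |s| * S := fun s => by
          simp only [hzs, norm_mul, Complex.norm_real, Real.norm_eq_abs, hS, Finset.mul_sum]
        have h1 : (fun s : ℝ => FL f (toComplex (s • ξ)) -
            (s : ℂ) ^ k * ((-Complex.I) ^ k / k.factorial *
              ∫ x, f x * (∑ i, (x i : ℂ) * toComplex ξ i) ^ k)) =O[𝓝 0]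
                fun s : ℝ => s ^ (k + 1) := by
          refine Asymptotics.IsBigO.of_bound (K * S ^ (k + 1) * ‖f‖) ?_
          have hsmall : ∀ᶠ s : ℝ in 𝓝 0, |s| * S < β / 8 := by
            have : ContinuousAt (fun s : ℝ => |s| * S) 0 := by fun_prop
            exact this.eventually_lt continuousAt_const (by simpa using by positivity)
          filter_upwards [hsmall] with s hs
          have h2 := hT f (toComplex (s • ξ)) (by rw [hSs]; exact hs.le)
          rw [hSs, Finset.sum_range_succ, Finset.sum_eq_zero, zero_add, hsmul, mul_pow] at h2
          · rw [norm_pow, Real.norm_eq_abs]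
            refine le_trans (le_of_eq ?_) (h2.trans (le_of_eq ?_))
            · congr 2
              ring
            · ring
          · intro j hj
            rw [integral_mul_sum_pow hβ, Finset.sum_eq_zero, mul_zero]
            intro l hl
            rw [Finset.mem_piAntidiag] at hl
            rw [(mem_momentSpace_iff hβ).1 hk l (hl.1.trans_lt (Finset.mem_range.1 hj)), mul_zero]
        simpa using (h ξ).sub h1
      have := eq_zero_of_pow_mul_isBigO (g := fun _ => (-Complex.I) ^ k / k.factorial *
          ∫ x, f x * (∑ i, (x i : ℂ) * toComplex ξ i) ^ k) continuousAt_const hO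
      refine (mul_eq_zero.1 this).resolve_left ?_
      exact div_ne_zero (pow_ne_zero _ (neg_ne_zero.2 Complex.I_ne_zero))
        (Nat.cast_ne_zero.2 (Nat.factorial_ne_zero k))
    have hmom := eq_zero_of_sum_monom (Finset.piAntidiag Finset.univ k)
      (fun l => Nat.multinomial Finset.univ l * moment hβ l f) fun ξ => by
        have := hzero ξ
        rw [integral_mul_sum_pow hβ] at this
        rw [← this]
        refine Finset.sum_congr rfl fun l _ => ?_
        simp only [monom, toComplex]
        push_cast
        ring
    rw [mem_momentSpace_iff hβ]
    intro l hl
    rcases Nat.lt_succ_iff_lt_or_eq.1 hl with hl | hl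
    · exact (mem_momentSpace_iff hβ).1 hk l hl
    · have := hmom l (Finset.mem_piAntidiag.2 ⟨hl, fun i _ => Finset.mem_univ i⟩)
      exact (mul_eq_zero.1 this).resolve_left
        (Nat.cast_ne_zero.2 (Nat.multinomial_pos _ _).ne')

lemma isBigO_of_mem_momentSpace [NeZero n] (hβ : 0 < β) {k : ℕ} {f : WL2 n β}
    (h : f ∈ momentSpace n β k) (ξ : E n) :
    (fun s : ℝ => FL f (toComplex (s • ξ))) =O[𝓝 0] fun s : ℝ => s ^ k := by
  obtain ⟨K, hK, hb⟩ := exists_norm_FL_le_of_mem_momentSpace (n := n) hβ k (r := 0) (by positivity)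
  refine Asymptotics.IsBigO.of_bound (K * (∑ i, ‖toComplex ξ i‖) ^ k * ‖f‖)
    (Eventually.of_forall fun s => ?_)
  refine (hb f h _ (by simp [toComplex])).trans (le_of_eq ?_)
  have : ∑ i, ‖toComplex (s • ξ) i‖ = |s| * ∑ i, ‖toComplex ξ i‖ := by
    simp [toComplex, Finset.mul_sum]
  rw [this, norm_pow, Real.norm_eq_abs]
  ring

/-- A bounded operator acting on the Fourier side by a continuous multiplier preserves `𝓗_k`. -/
lemma mem_momentSpace_of_multiplier [NeZero n] (hβ : 0 < β) {k : ℕ} {f g : WL2 n β}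
    {m : (Fin n → ℂ) → ℂ} (hm : ContinuousAt m 0)
    (h : ∀ ξ : E n, FL g (toComplex ξ) = m (toComplex ξ) * FL f (toComplex ξ))
    (hf : f ∈ momentSpace n β k) : g ∈ momentSpace n β k := by
  refine mem_momentSpace_of_isBigO hβ fun ξ => ?_
  have hcont : ContinuousAt (fun s : ℝ => m (toComplex (s • ξ))) 0 := by
    have h0 : toComplex ((0 : ℝ) • ξ) = 0 := by
      funext i
      simp [toComplex]
    refine ContinuousAt.comp (g := m) (f := fun s : ℝ => toComplex (s • ξ)) (by rwa [h0]) ?_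
    unfold toComplex
    fun_prop
  have := (hcont.tendsto.isBigO_one ℝ).mul (isBigO_of_mem_momentSpace hβ hf ξ)
  simpa only [one_mul, h] using this

/-- The linear flow maps rays through 0 to rays through 0, and the Gaussian factor is continuous
there, so the order of vanishing is not lowered. -/
lemma ou_mem_momentSpace [NeZero n] (hc : ∀ i, 0 < c i) (hβ : 0 < β) {t : ℝ} (ht : 0 ≤ t) {k : ℕ}
    {f : WL2 n β} (hf : f ∈ momentSpace n β k) : ou hc hβ t f ∈ momentSpace n β k := by
  refine mem_momentSpace_of_isBigO hβ fun ξ => ?_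
  have hcont : ContinuousAt (fun s : ℝ => ouGauss c t (toComplex (s • ξ))) 0 := by
    unfold ouGauss toComplex
    fun_prop
  have := (hcont.tendsto.isBigO_one ℝ).mul (isBigO_of_mem_momentSpace hβ hf
    (WithLp.toLp 2 fun j => Real.exp (-(c j * t)) * ξ j))
  simp only [one_mul] at this
  refine this.congr_left fun s => ?_
  rw [FL_ou hc hβ ht f (toComplex_mem_tube hβ _)]
  congr 2
  funext i
  simp [scaleC, toComplex]
  ring

end Moments

/-! ### Splitting off finitely many eigenfunctions, and decay on the remainder -/

section Decay

variable {n : ℕ} {β : ℝ} {c : Fin n → ℝ}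

lemma FL_sum [NeZero n] {ι : Type*} (s : Finset ι) (f : ι → WL2 n β) {z : Fin n → ℂ}
    (hz : z ∈ tube n β) : FL (∑ l ∈ s, f l : WL2 n β) z = ∑ l ∈ s, FL (f l) z := by
  simp only [← FLc_apply hz, map_sum]

/-- The transform of the combination is a Gaussian times a polynomial of degree below k; vanishing
to order k at 0 forces this polynomial to be zero. The induction peels off one homogeneous degree at
a time. -/
lemma eq_zero_of_sum_muL_mem [NeZero n] (hc : ∀ i, 0 < c i) (hβ : 0 < β) {k : ℕ}
    (s : Finset (Fin n → ℕ)) (hs : ∀ l ∈ s, ∑ i, l i < k) (a : (Fin n → ℕ) → ℂ)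
    (h : ∑ l ∈ s, a l • muL (β := β) hc hβ.le l ∈ momentSpace n β k) : ∀ l ∈ s, a l = 0 := by
  suffices H : ∀ j ≤ k, ∀ l ∈ s, ∑ i, l i < j → a l = 0 from
    fun l hl => H k le_rfl l hl (hs l hl)
  intro j
  induction j with
  | zero => exact fun _ l _ hl => absurd hl (Nat.not_lt_zero _)
  | succ j ih =>
    intro hj l hl hlj
    rcases Nat.lt_succ_iff_lt_or_eq.1 hlj with hlt | heq
    · exact ih (by omega) l hl hlt
    have hzero := eq_zero_of_sum_monom s
      -- The power of 0 selects degree j: it is 0 above degree j and 1 in degree j. Below j the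
      -- truncated subtraction also gives 0 ^ 0 = 1, but there a l = 0 by induction.
      (fun l => a l * Complex.I ^ (∑ i, l i) * (0 : ℂ) ^ (∑ i, l i - j)) fun ξ => by
        set g : ℝ → ℂ := fun r =>
          Complex.exp (-∑ i, toComplex (r • ξ) i ^ 2 / (2 * c i)) *
          ∑ l ∈ s, a l * Complex.I ^ (∑ i, l i) * (r : ℂ) ^ (∑ i, l i - j) * monom l ξ with hg
        have hgc : ContinuousAt g 0 := by
          rw [hg]
          unfold toComplex
          fun_prop
        have hFL : ∀ r : ℝ, FL (∑ l ∈ s, a l • muL (β := β) hc hβ.le l : WL2 n β)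
            (toComplex (r • ξ)) = (r : ℂ) ^ j * g r := fun r => by
          have hz := toComplex_mem_tube hβ (r • ξ)
          rw [FL_sum _ _ hz, hg, mul_left_comm, Finset.mul_sum, Finset.mul_sum]
          refine Finset.sum_congr rfl fun l hl => ?_
          rw [FL_smul _ _ hz, FL_muL]
          by_cases hlj : ∑ i, l i < j
          · rw [ih (by omega) l hl hlj]
            ring
          · have hpow : (r : ℂ) ^ (∑ i, l i) = (r : ℂ) ^ j * (r : ℂ) ^ (∑ i, l i - j) := by
              rw [← pow_add, Nat.add_sub_cancel' (not_lt.1 hlj)]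
            have : ∏ i, (Complex.I * toComplex (r • ξ) i) ^ l i =
                Complex.I ^ (∑ i, l i) * (r : ℂ) ^ (∑ i, l i) * monom l ξ := by
              rw [← Finset.prod_pow_eq_pow_sum, ← Finset.prod_pow_eq_pow_sum, monom]
              push_cast
              rw [← Finset.prod_mul_distrib, ← Finset.prod_mul_distrib]
              refine Finset.prod_congr rfl fun i _ => ?_
              rw [← mul_pow, ← mul_pow]
              simp [toComplex]
              ring
            rw [this, hpow]
            ring
        have hO := isBigO_of_mem_momentSpace hβ (momentSpace_anti hj h) ξ
        simp only [hFL] at hO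
        have h0 := eq_zero_of_pow_mul_isBigO hgc hO
        rw [hg] at h0
        refine (mul_eq_zero.1 h0).resolve_left (Complex.exp_ne_zero _) |> fun h => ?_
        simpa using h
    have := hzero l hl
    rw [heq, Nat.sub_self, pow_zero, mul_one] at this
    exact (mul_eq_zero.1 this).resolve_right (pow_ne_zero _ Complex.I_ne_zero)

/-- The multi-indices of order less than `k`. -/
def lowDeg (n k : ℕ) : Finset (Fin n → ℕ) :=
  (Finset.range k).biUnion (Finset.piAntidiag Finset.univ)

lemma mem_lowDeg {k : ℕ} {l : Fin n → ℕ} : l ∈ lowDeg n k ↔ ∑ i, l i < k := by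
  simp [lowDeg]

/-- `L²(ω)` is the sum of `𝓗_k` and the span of the eigenfunctions of order less than `k`. -/
lemma exists_sub_sum_muL_mem [NeZero n] (hc : ∀ i, 0 < c i) (hβ : 0 < β) (k : ℕ) (f : WL2 n β) :
    ∃ a : (Fin n → ℕ) → ℂ,
      f - ∑ l ∈ lowDeg n k, a l • muL (β := β) hc hβ.le l ∈ momentSpace n β k := by
  -- The square system matching the moments of order below k. It is injective because the span of
  -- the low μ_l meets 𝓗_k only in 0, hence surjective by finite dimension.
  let Φ : (lowDeg n k → ℂ) →ₗ[ℂ] (lowDeg n k → ℂ) :=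
    LinearMap.pi fun m => (moment hβ m.1 : WL2 n β →ₗ[ℂ] ℂ) ∘ₗ
      ∑ l, (LinearMap.toSpanSingleton ℂ (WL2 n β) (muL hc hβ.le l.1)) ∘ₗ LinearMap.proj l
  have hΦ : ∀ b m, Φ b m = moment hβ m.1 (∑ l, b l • muL (β := β) hc hβ.le l.1) := fun b m => by
    simp [Φ]
  have hsum : ∀ b : lowDeg n k → ℂ, ∃ a : (Fin n → ℕ) → ℂ, (∀ l : lowDeg n k, a l = b l) ∧
      ∑ l ∈ lowDeg n k, a l • muL (β := β) hc hβ.le l = ∑ l, b l • muL hc hβ.le l.1 := fun b => by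
    classical
    refine ⟨fun l => if h : l ∈ lowDeg n k then b ⟨l, h⟩ else 0, fun l => by simp, ?_⟩
    rw [← Finset.sum_coe_sort]
    exact Finset.sum_congr rfl fun l _ => by simp
  have hinj : Function.Injective Φ := by
    rw [injective_iff_map_eq_zero]
    intro b hb
    obtain ⟨a, hab, ha⟩ := hsum b
    funext l
    rw [← hab, Pi.zero_apply]
    refine eq_zero_of_sum_muL_mem hc hβ (k := k) (lowDeg n k) (fun l hl => mem_lowDeg.1 hl) a ?_
      l.1 l.2
    rw [ha, mem_momentSpace_iff hβ]
    intro m hm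
    rw [← hΦ b ⟨m, mem_lowDeg.2 hm⟩, hb, Pi.zero_apply]
  obtain ⟨b, hb⟩ := LinearMap.injective_iff_surjective.1 hinj fun m => moment hβ m.1 f
  obtain ⟨a, hab, ha⟩ := hsum b
  refine ⟨a, ?_⟩
  rw [ha, mem_momentSpace_iff hβ]
  intro m hm
  rw [map_sub, ← hΦ b ⟨m, mem_lowDeg.2 hm⟩, hb, sub_self]

/-- A pointwise bound on the tube, square integrable in Re z, bounds the L² norms on all shifted
spaces at once. The shifts are purely imaginary, so they leave the bound unchanged. -/
lemma exists_norm_le_of_FL_decay [NeZero n] (hβ : 0 < β) : ∃ J : ℝ, 0 < J ∧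
    ∀ (h : WL2 n β) (A : ℝ), (∀ z ∈ tube n β, ‖FL h z‖ ≤ A * Real.exp (-∑ j, |(z j).re|)) →
      ‖h‖ ≤ A * J := by
  have hI := integrable_exp_neg_norm (n := n) two_pos
  have hI0 : 0 ≤ ∫ ξ : E n, Real.exp (-2 * ‖ξ‖) := integral_nonneg fun ξ => (Real.exp_pos _).le
  refine ⟨Real.sqrt (n * ∫ ξ : E n, Real.exp (-2 * ‖ξ‖)) + 1, by positivity, fun h A hA => ?_⟩
  have hA0 : 0 ≤ A := nonneg_of_mul_nonneg_left
    ((norm_nonneg _).trans (hA 0 (by simp [tube, hβ]))) (Real.exp_pos _)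
  have hmain := norm_le_of_lintegral_le hβ (h := h) (K := A ^ 2 * ∫ ξ : E n, Real.exp (-2 * ‖ξ‖))
    (by positivity) fun i b hb => ?_
  · refine hmain.trans ?_
    rw [mul_left_comm, Real.sqrt_mul (sq_nonneg A), Real.sqrt_sq hA0]
    exact mul_le_mul_of_nonneg_left (le_add_of_nonneg_right zero_le_one) hA0
  rw [← lintegral_FL_linePt hb, ← integral_const_mul,
    ofReal_integral_eq_lintegral_ofReal (hI.const_mul _)
      (Eventually.of_forall fun ξ => by positivity)]
  refine lintegral_mono fun ξ => ENNReal.ofReal_le_ofReal ?_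
  have hz : linePt i (Complex.I * b) ξ ∈ tube n β := linePt_mem_tube (by simpa using hb) ξ
  have h1 : ‖FL h (linePt i (Complex.I * b) ξ)‖ ≤ A * Real.exp (-‖ξ‖) := by
    refine (hA _ hz).trans (mul_le_mul_of_nonneg_left (Real.exp_le_exp.2 ?_) hA0)
    have := sum_abs_re_linePt i (Complex.I * b) ξ
    simp only [Complex.I_mul_re, Complex.ofReal_im, neg_zero, abs_zero, sub_zero] at this
    linarith
  refine (pow_le_pow_left₀ (norm_nonneg _) h1 2).trans (le_of_eq ?_)
  rw [mul_pow, ← Real.exp_nat_mul]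
  push_cast
  ring_nf

/-- The Fokker-Planck semigroup decays exponentially on `𝓗_k`. -/
lemma exists_norm_ou_le_of_mem [NeZero n] (hc : ∀ i, 0 < c i) (hβ : 0 < β) {c₀ : ℝ} (hc₀ : 0 < c₀)
    (hle : ∀ i, c₀ ≤ c i) (k : ℕ) : ∃ C : ℝ, 0 < C ∧ ∀ t : ℝ, 0 ≤ t →
      ∀ f ∈ momentSpace n β k, ‖ou hc hβ t f‖ ≤ C * Real.exp (-(t * k * c₀)) * ‖f‖ := by
  obtain ⟨J, hJ, hJb⟩ := exists_norm_le_of_FL_decay (n := n) hβ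
  obtain ⟨C₁, hC₁, h₁⟩ := exists_norm_ou_le (β := β) hc hβ 1
  -- From time 1 on, the flow maps the tube into a strictly smaller one, where the vanishing
  -- estimate for 𝓗_k holds with a uniform constant.
  have hr : Real.exp (-c₀) * (β / 2) < β / 2 :=
    mul_lt_of_lt_one_left (by positivity) (Real.exp_lt_one_iff.2 (by linarith))
  obtain ⟨K, hK, hKb⟩ := exists_norm_FL_le_of_mem_momentSpace (n := n) hβ k hr
  obtain ⟨C₂, hC₂, hpow⟩ := exists_pow_le_exp one_pos k
  obtain ⟨i₀, _, hi₀⟩ := Finset.exists_min_image Finset.univ (ouVar c 1) Finset.univ_nonempty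
  -- The least variance at time 1. Variances increase with t, so v > 0 bounds them from below for
  -- all t ≥ 1.
  set v := ouVar c 1 i₀ with hv
  have hv0 : 0 < v := by
    have := hc i₀
    have h2 : Real.exp (-(c i₀ * 1)) < 1 := Real.exp_lt_one_iff.2 (by linarith)
    have h3 := Real.exp_pos (-(c i₀ * 1))
    refine div_pos ?_ (by linarith)
    nlinarith
  have hvt : ∀ t : ℝ, 1 ≤ t → ∀ i, v ≤ ouVar c t i := fun t ht i => by
    refine (hi₀ i (Finset.mem_univ i)).trans ?_
    have := hc i
    unfold ouVar
    gcongr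
  set κ := Real.exp (∑ i, β ^ 2 / (8 * c i)) with hκ
  set D := κ * K * (C₂ * Real.exp (n * (β / 2)) * Real.exp (n * (1 / v))) with hD
  have hD0 : 0 < D := by positivity
  refine ⟨D * J + C₁ * Real.exp (k * c₀), by positivity, fun t ht f hf => ?_⟩
  -- Before time 1 the Gaussian has no uniform strength; the local bound C₁ is used instead, and the
  -- factor exp(k c₀) makes up for exp(-t k c₀).
  rcases le_total t 1 with ht1 | ht1
  · refine ((ou hc hβ t).le_of_opNorm_le (h₁ t ht ht1) f).trans ?_
    gcongr
    have : 1 ≤ Real.exp (k * c₀) * Real.exp (-(t * k * c₀)) := by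
      rw [← Real.exp_add, Real.one_le_exp_iff]
      have : 0 ≤ (1 - t) * (k * c₀) := mul_nonneg (by linarith) (by positivity)
      linarith
    have h5 : 0 ≤ D * J * Real.exp (-(t * k * c₀)) := by positivity
    nlinarith
  · have hmain := hJb (ou hc hβ t f) (D * Real.exp (-(t * k * c₀)) * ‖f‖) fun z hz => ?_
    · refine hmain.trans ?_
      have h5 : 0 ≤ C₁ * Real.exp (k * c₀) * Real.exp (-(t * k * c₀)) * ‖f‖ := by positivity
      linarith
    have hexp : ∀ i, Real.exp (-(c i * t)) ≤ Real.exp (-(c₀ * t)) := fun i =>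
      Real.exp_le_exp.2 (neg_le_neg (mul_le_mul_of_nonneg_right (hle i) ht))
    have him : ∑ i, |(scaleC c t z i).im| ≤ Real.exp (-c₀) * (β / 2) := by
      have : ∑ i, |(scaleC c t z i).im| ≤ Real.exp (-c₀) * ∑ i, |(z i).im| := by
        rw [Finset.mul_sum]
        refine Finset.sum_le_sum fun i _ => ?_
        rw [scaleC, Complex.im_ofReal_mul, abs_mul, abs_of_pos (Real.exp_pos _)]
        refine mul_le_mul_of_nonneg_right ((hexp i).trans (Real.exp_le_exp.2 ?_)) (abs_nonneg _)
        nlinarith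
      refine this.trans (mul_le_mul_of_nonneg_left (le_of_lt hz) (Real.exp_pos _).le)
    have hnorm : ∑ i, ‖scaleC c t z i‖ ≤ Real.exp (-(c₀ * t)) * ∑ i, ‖z i‖ := by
      rw [Finset.mul_sum]
      refine Finset.sum_le_sum fun i _ => ?_
      rw [scaleC, norm_mul, Complex.norm_real, Real.norm_of_nonneg (Real.exp_pos _).le]
      exact mul_le_mul_of_nonneg_right (hexp i) (norm_nonneg _)
    set R := ∑ j, |(z j).re| with hR
    have hS : ∑ i, ‖z i‖ ≤ R + n * (β / 2) := by
      have : ∀ i ∈ Finset.univ, ‖z i‖ ≤ |(z i).re| + β / 2 := fun i _ =>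
        (Complex.norm_le_abs_re_add_abs_im _).trans
          (add_le_add_right (abs_im_le_of_mem_tube hz i) _)
      refine (Finset.sum_le_sum this).trans (le_of_eq ?_)
      rw [Finset.sum_add_distrib]
      simp [hR]
    have hS0 : 0 ≤ ∑ i, ‖z i‖ := Finset.sum_nonneg fun i _ => norm_nonneg _
    -- From v x² ≥ 2|x| - 1/v. One factor exp(-R) pays for the growth of (∑ ‖zᵢ‖)^k, and the other
    -- is the decay required by `exists_norm_le_of_FL_decay`.
    have hgauss : Real.exp (-∑ i, ouVar c t i * (z i).re ^ 2) ≤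
        Real.exp (-(2 * R)) * Real.exp (n * (1 / v)) := by
      rw [← Real.exp_add, Real.exp_le_exp]
      have : ∀ i ∈ Finset.univ, 2 * |(z i).re| - 1 / v ≤ ouVar c t i * (z i).re ^ 2 := fun i _ => by
        have h6 : v * (z i).re ^ 2 ≤ ouVar c t i * (z i).re ^ 2 :=
          mul_le_mul_of_nonneg_right (hvt t ht1 i) (sq_nonneg _)
        refine le_trans ?_ h6
        rw [← sq_abs, sub_le_iff_le_add, ← sub_nonneg]
        have : v * |(z i).re| ^ 2 + 1 / v - 2 * |(z i).re| = (v * |(z i).re| - 1) ^ 2 / v := by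
          field_simp
          ring
        rw [this]
        positivity
      have := Finset.sum_le_sum this
      rw [Finset.sum_sub_distrib, ← Finset.mul_sum] at this
      simp only [Finset.sum_const, Finset.card_univ, Fintype.card_fin, nsmul_eq_mul] at this
      linarith
    rw [FL_ou hc hβ ht f hz, norm_mul]
    calc ‖ouGauss c t z‖ * ‖FL f (scaleC c t z)‖
        ≤ (Real.exp (-(2 * R)) * Real.exp (n * (1 / v)) * κ) *
          (K * (Real.exp (-(c₀ * t)) * ∑ i, ‖z i‖) ^ k * ‖f‖) := by
          refine mul_le_mul ((norm_ouGauss_le hc ht hz).trans ?_) ((hKb f hf _ him).trans ?_)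
            (norm_nonneg _) (by positivity)
          · exact mul_le_mul_of_nonneg_right hgauss (Real.exp_pos _).le
          · gcongr
      _ = (κ * K * Real.exp (n * (1 / v))) * Real.exp (-(c₀ * t)) ^ k * ‖f‖ *
          (Real.exp (-(2 * R)) * (∑ i, ‖z i‖) ^ k) := by ring
      _ ≤ (κ * K * Real.exp (n * (1 / v))) * Real.exp (-(c₀ * t)) ^ k * ‖f‖ *
          (Real.exp (-(2 * R)) * (C₂ * Real.exp (R + n * (β / 2)))) := by
          refine mul_le_mul_of_nonneg_left ?_ (by positivity)
          refine mul_le_mul_of_nonneg_left ?_ (Real.exp_pos _).le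
          refine (hpow _ hS0).trans (mul_le_mul_of_nonneg_left (Real.exp_le_exp.2 ?_) hC₂.le)
          linarith
      _ = D * Real.exp (-(t * k * c₀)) * ‖f‖ * Real.exp (-R) := by
          have h7 : Real.exp (-(c₀ * t)) ^ k = Real.exp (-(t * k * c₀)) := by
            rw [← Real.exp_nat_mul]
            ring_nf
          have h8 : Real.exp (-(2 * R)) * Real.exp R = Real.exp (-R) := by
            rw [← Real.exp_add]
            ring_nf
          rw [Real.exp_add, h7, hD, ← h8]
          ring

end Decay

/-! ### Generators of strongly continuous semigroups -/

section Generator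

variable {X : Type*} [NormedAddCommGroup X] [NormedSpace ℂ X]

/-- A strongly continuous, locally bounded semigroup, indexed by the real numbers `t ≥ 0`. -/
structure IsRealSemigroup (T : ℝ → X →L[ℂ] X) : Prop where
  zero : ∀ x, T 0 x = x
  add : ∀ s t, 0 ≤ s → 0 ≤ t → ∀ x, T (s + t) x = T s (T t x)
  cont : ∀ x, ContinuousOn (fun t => T t x) (Set.Ici 0)
  bdd : ∀ r, ∃ K, 0 < K ∧ ∀ t, 0 ≤ t → t ≤ r → ‖T t‖ ≤ K

/-- The graph of the infinitesimal generator. -/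
def genGraph (T : ℝ → X →L[ℂ] X) : Submodule ℂ (X × X) where
  carrier := {p | HasDerivWithinAt (fun t => T t p.1) p.2 (Set.Ici 0) 0}
  zero_mem' := by
    simpa using hasDerivWithinAt_const (0 : ℝ) (Set.Ici 0) (0 : X)
  add_mem' := fun {p q} hp hq => by
    simpa using HasDerivWithinAt.fun_add hp hq
  smul_mem' := fun a p hp => by
    simpa using HasDerivWithinAt.fun_const_smul a hp

lemma mem_genGraph {T : ℝ → X →L[ℂ] X} {x y : X} :
    (x, y) ∈ genGraph T ↔ HasDerivWithinAt (fun t => T t x) y (Set.Ici 0) 0 := Iff.rfl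

variable {T : ℝ → X →L[ℂ] X}

lemma IsRealSemigroup.hasDerivWithinAt (hT : IsRealSemigroup T) {x y : X}
    (h : (x, y) ∈ genGraph T) {t : ℝ} (ht : 0 ≤ t) :
    HasDerivWithinAt (fun s => T s x) (T t y) (Set.Ici t) t := by
  have h1 : HasDerivWithinAt (fun r => T t (T r x)) (T t y) (Set.Ici 0) 0 :=
    ((T t).restrictScalars ℝ).hasFDerivAt.comp_hasDerivWithinAt (0 : ℝ) (mem_genGraph.1 h)
  have h2 : HasDerivWithinAt (fun s : ℝ => s - t) 1 (Set.Ici t) t :=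
    ((hasDerivAt_id t).sub_const t).hasDerivWithinAt
  have h3 := HasDerivWithinAt.scomp_of_eq (h := fun s : ℝ => s - t) t h1 h2
    (fun s hs => sub_nonneg.2 (Set.mem_Ici.1 hs)) (by simp)
  rw [one_smul] at h3
  refine h3.congr_of_mem (fun s hs => ?_) Set.self_mem_Ici
  have hs : t ≤ s := hs
  simp only [Function.comp]
  rw [← hT.add t (s - t) ht (by linarith), add_sub_cancel]

lemma IsRealSemigroup.intervalIntegrable (hT : IsRealSemigroup T) (y : X) {t : ℝ} (ht : 0 ≤ t) :
    IntervalIntegrable (fun s => T s y) volume 0 t :=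
  ((hT.cont y).mono fun s hs => by
    rw [Set.uIcc_of_le ht] at hs
    exact hs.1).intervalIntegrable

/-- The integrated form of the generator equation. Each of its identities is a closed condition on
(x, y), so closedness of the generator follows at once. -/
lemma IsRealSemigroup.mem_genGraph_iff [CompleteSpace X] (hT : IsRealSemigroup T) {x y : X} :
    (x, y) ∈ genGraph T ↔ ∀ t, 0 ≤ t → T t x - x = ∫ s in (0 : ℝ)..t, T s y := by
  constructor
  · intro h t ht
    rw [intervalIntegral.integral_eq_sub_of_hasDeriv_right_of_le ht
      ((hT.cont x).mono fun s hs => hs.1)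
      (fun s hs => (hT.hasDerivWithinAt h hs.1.le).mono Set.Ioi_subset_Ici_self)
      (hT.intervalIntegrable y ht), hT.zero]
  · intro h
    have h1 : HasDerivWithinAt (fun t => ∫ s in (0 : ℝ)..t, T s y) (T 0 y) (Set.Ici 0) 0 :=
      intervalIntegral.integral_hasDerivWithinAt_right (by simp)
        ((hT.cont y).stronglyMeasurableAtFilter_nhdsWithin measurableSet_Ici 0 |>.filter_mono
          (nhdsWithin_mono _ Set.Ioi_subset_Ici_self))
        (((hT.cont y) 0 Set.self_mem_Ici).mono Set.Ioi_subset_Ici_self)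
    rw [hT.zero] at h1
    refine (h1.const_add x).congr_of_mem (fun t ht => ?_) Set.self_mem_Ici
    rw [← h t ht, add_sub_cancel]

lemma IsRealSemigroup.isClosed_genGraph [CompleteSpace X] (hT : IsRealSemigroup T) :
    IsClosed (genGraph T : Set (X × X)) := by
  have hJ : ∀ t : ℝ, 0 ≤ t → Continuous fun y => ∫ s in (0 : ℝ)..t, T s y := by
    intro t ht
    obtain ⟨K, hK0, hK⟩ := hT.bdd t
    refine (LipschitzWith.of_dist_le_mul (K := Real.toNNReal (K * t)) fun y y' => ?_).continuous
    rw [dist_eq_norm, dist_eq_norm, ← intervalIntegral.integral_sub (hT.intervalIntegrable y ht)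
      (hT.intervalIntegrable y' ht)]
    simp only [← map_sub]
    refine (intervalIntegral.norm_integral_le_of_norm_le_const (C := K * ‖y - y'‖)
      fun s hs => ?_).trans (le_of_eq ?_)
    · rw [Set.uIoc_of_le ht] at hs
      exact (T s).le_of_opNorm_le (hK s hs.1.le hs.2) _
    · rw [sub_zero, abs_of_nonneg ht]
      rw [Real.coe_toNNReal _ (by positivity)]
      ring
  have : (genGraph T : Set (X × X)) =
      ⋂ (t : ℝ) (_ : 0 ≤ t), {p | T t p.1 - p.1 = ∫ s in (0 : ℝ)..t, T s p.2} := by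
    ext ⟨x, y⟩
    simp only [SetLike.mem_coe, hT.mem_genGraph_iff, Set.mem_iInter, Set.mem_ofPred_eq]
  rw [this]
  refine isClosed_iInter fun t => isClosed_iInter fun ht => isClosed_eq ?_ ?_
  · exact ((T t).continuous.comp continuous_fst).sub continuous_fst
  · exact (hJ t ht).comp continuous_snd

/-- The curve e^{-sz} T(s)x has vanishing right derivative, hence is constant. -/
lemma IsRealSemigroup.apply_of_eigenvector (hT : IsRealSemigroup T) {x : X} {z : ℂ}
    (h : (x, z • x) ∈ genGraph T) {t : ℝ} (ht : 0 ≤ t) : T t x = Complex.exp (t * z) • x := by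
  have he : ∀ s : ℝ, HasDerivAt (fun s : ℝ => Complex.exp (-(s * z)))
      (Complex.exp (-(s * z)) * -z) s := fun s => by
    have := ((hasDerivAt_id s).ofReal_comp.mul_const z).neg.cexp
    simpa using this
  have hconst := constant_of_has_deriv_right_zero
    (f := fun s : ℝ => Complex.exp (-(s * z)) • T s x) (a := 0) (b := t)
    (ContinuousOn.smul (by fun_prop) ((hT.cont x).mono fun s hs => hs.1))
    (fun s hs => by
      have h1 := (he s).hasDerivWithinAt (s := Set.Ici s) |>.fun_smul
        (hT.hasDerivWithinAt h hs.1)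
      refine h1.congr_deriv ?_
      rw [map_smul, smul_smul, ← add_smul]
      simp) t ⟨ht, le_rfl⟩
  simp only [Complex.ofReal_zero, zero_mul, neg_zero, Complex.exp_zero, one_smul, hT.zero]
    at hconst
  nth_rw 2 [← hconst]
  rw [smul_smul, ← Complex.exp_add, add_neg_cancel, Complex.exp_zero, one_smul]

lemma IsRealSemigroup.mem_genGraph_of_eigenvector {x : X} {z : ℂ}
    (h : ∀ t : ℝ, 0 ≤ t → T t x = Complex.exp (t * z) • x) : (x, z • x) ∈ genGraph T := by
  have he : HasDerivAt (fun s : ℝ => Complex.exp (s * z)) (Complex.exp ((0 : ℝ) * z) * z) 0 := by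
    have := ((hasDerivAt_id (0 : ℝ)).ofReal_comp.mul_const z).cexp
    simpa using this
  have h1 := (he.smul_const x).hasDerivWithinAt (s := Set.Ici 0)
  simp only [Complex.ofReal_zero, zero_mul, Complex.exp_zero, one_mul] at h1
  exact h1.congr_of_mem (fun t ht => h t ht) Set.self_mem_Ici

/-- The Laplace transform of a decaying orbit solves the resolvent equation. -/
lemma IsRealSemigroup.exists_resolvent [CompleteSpace X] (hT : IsRealSemigroup T) {y : X} {z : ℂ} {C w : ℝ}
    (hC : ∀ t, 0 ≤ t → ‖T t y‖ ≤ C * Real.exp (-(w * t))) (hz : -w < z.re) :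
    ∃ x, (x, z • x - y) ∈ genGraph T := by
  set g : ℝ → X := fun s => Complex.exp (-(s * z)) • T s y with hg
  have hgc : ContinuousOn g (Set.Ici 0) := ContinuousOn.smul (by fun_prop) (hT.cont y)
  have hgi : IntegrableOn g (Set.Ioi 0) := by
    refine Integrable.mono' (g := fun s => C * Real.exp (-(w + z.re) * s)) ?_
      ((hgc.mono Set.Ioi_subset_Ici_self).aestronglyMeasurable measurableSet_Ioi) ?_
    · exact (exp_neg_integrableOn_Ioi 0 (by linarith)).const_mul C
    · filter_upwards [ae_restrict_mem measurableSet_Ioi] with s hs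
      rw [hg, norm_smul, Complex.norm_exp]
      refine (mul_le_mul_of_nonneg_left (hC s (le_of_lt hs)) (Real.exp_pos _).le).trans
        (le_of_eq ?_)
      rw [mul_left_comm, ← Real.exp_add]
      congr 2
      rw [Complex.neg_re, Complex.re_ofReal_mul]
      ring
  set x := ∫ s in Set.Ioi (0 : ℝ), g s with hx
  refine ⟨x, ?_⟩
  -- Applying T(t) to the Laplace integral shifts its variable by t. The right-hand side can be
  -- differentiated at t = 0 with no prior knowledge that x lies in the domain.
  have hTx : ∀ t, 0 ≤ t → T t x = Complex.exp (t * z) • (x - ∫ s in (0 : ℝ)..t, g s) := by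
    intro t ht
    have h1 : x - ∫ s in (0 : ℝ)..t, g s = ∫ s in Set.Ioi t, g s := by
      rw [hx, sub_eq_iff_eq_add', intervalIntegral.integral_of_le ht,
        ← setIntegral_union (Set.Ioc_disjoint_Ioi le_rfl) measurableSet_Ioi
        (hgi.mono_set Set.Ioc_subset_Ioi_self) (hgi.mono_set (Set.Ioi_subset_Ioi ht)),
        Set.Ioc_union_Ioi_eq_Ioi ht]
    have h2 : ∫ s in Set.Ioi t, g s = ∫ s in Set.Ioi (0 : ℝ), g (s + t) := by
      have := (measurePreserving_add_right volume t).setIntegral_preimage_emb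
        (measurableEmbedding_addRight t) g (Set.Ioi t)
      rw [← this]
      simp
    rw [h1, h2, ← integral_smul, hx, ← ContinuousLinearMap.integral_comp_comm _ hgi]
    refine setIntegral_congr_fun measurableSet_Ioi fun s hs => ?_
    have hs : 0 < s := hs
    simp only [hg, map_smul]
    rw [add_comm s t, hT.add t s ht hs.le, smul_smul, ← Complex.exp_add]
    congr 2
    push_cast
    ring
  have h1 : HasDerivWithinAt (fun t => ∫ s in (0 : ℝ)..t, g s) (g 0) (Set.Ici 0) 0 :=
    intervalIntegral.integral_hasDerivWithinAt_right (by simp)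
      (hgc.stronglyMeasurableAtFilter_nhdsWithin measurableSet_Ici 0 |>.filter_mono
        (nhdsWithin_mono _ Set.Ioi_subset_Ici_self)) ((hgc 0 Set.self_mem_Ici).mono Set.Ioi_subset_Ici_self)
  have he : HasDerivAt (fun s : ℝ => Complex.exp (s * z)) (Complex.exp ((0 : ℝ) * z) * z) 0 := by
    have := ((hasDerivAt_id (0 : ℝ)).ofReal_comp.mul_const z).cexp
    simpa using this
  have h2 := he.hasDerivWithinAt (s := Set.Ici 0) |>.fun_smul (h1.const_sub x)
  have h3 := h2.congr_of_mem (f₁ := fun t => T t x) (fun t ht => hTx t ht) Set.self_mem_Ici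
  refine h3.congr_deriv ?_
  simp [hg, hT.zero]
  abel

end Generator

/-! ### Resolvents and eigenvectors in terms of the graph -/

section UnboundedOperators

variable {X : Type*} [NormedAddCommGroup X] [NormedSpace ℂ X]

/-- The graph form of the two-sided inverse. It does away with domain memberships and passes
directly through closures, similarities and restrictions. -/
lemma mem_resolventSet_iff {A : X →ₗ.[ℂ] X} {z : ℂ} :
    z ∈ resolventSet A ↔ ∃ R : X →L[ℂ] X, ∀ x y, R y = x ↔ (x, z • x - y) ∈ A.graph := by
  constructor
  · rintro ⟨R, h1, h2⟩
    refine ⟨R, fun x y => ⟨?_, fun h => ?_⟩⟩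
    · rintro rfl
      obtain ⟨hd, h⟩ := h2 y
      refine (LinearPMap.mem_graph_iff A).2 ⟨⟨R y, hd⟩, rfl, ?_⟩
      change A ⟨R y, hd⟩ = z • R y - y
      exact eq_sub_of_add_eq' (eq_sub_iff_add_eq.1 h.symm)
    · obtain ⟨u, hu, hv⟩ := (LinearPMap.mem_graph_iff A).1 h
      have := h1 u
      rw [hv, hu] at this
      simpa using this
  · rintro ⟨R, h⟩
    refine ⟨R, fun x => ?_, fun y => ?_⟩
    · rw [h]
      simp
    · obtain ⟨u, hu, hv⟩ := (LinearPMap.mem_graph_iff A).1 ((h (R y) y).1 rfl)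
      have hu : (u : X) = R y := hu
      have hd : R y ∈ A.domain := hu ▸ u.2
      refine ⟨hd, ?_⟩
      have : u = ⟨R y, hd⟩ := Subtype.ext hu
      rw [← this, hv, sub_sub_cancel]

lemma mem_eigenspace_iff {A : X →ₗ.[ℂ] X} {z : ℂ} {x : X} :
    x ∈ eigenspace A z ↔ (x, z • x) ∈ A.graph := Iff.rfl

lemma mem_spectrum_of_eigenvector {A : X →ₗ.[ℂ] X} {z : ℂ} {x : X} (hx : x ≠ 0)
    (h : (x, z • x) ∈ A.graph) : z ∈ spectrum A := by
  intro hz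
  obtain ⟨R, hR⟩ := mem_resolventSet_iff.1 hz
  refine hx ?_
  rw [← (hR x 0).2 (by simpa using h), map_zero]

/-- A closed, bijective `z - A` has a bounded inverse. -/
lemma mem_resolventSet_of_bijective [CompleteSpace X] {A : X →ₗ.[ℂ] X} {z : ℂ}
    (hA : IsClosed (A.graph : Set (X × X))) (hs : ∀ y, ∃ x, (x, z • x - y) ∈ A.graph)
    (hi : ∀ x, (x, z • x) ∈ A.graph → x = 0) : z ∈ resolventSet A := by
  choose R hR using hs
  have huniq : ∀ x y, R y = x ↔ (x, z • x - y) ∈ A.graph := by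
    refine fun x y => ⟨fun h => h ▸ hR y, fun h => ?_⟩
    rw [← sub_eq_zero]
    refine hi _ ?_
    have := A.graph.sub_mem (hR y) h
    rw [Prod.mk_sub_mk] at this
    rw [smul_sub]
    convert this using 2
    abel
  let L : X →ₗ[ℂ] X :=
    { toFun := R
      map_add' := fun y y' => by
        rw [huniq]
        have := A.graph.add_mem (hR y) (hR y')
        rw [Prod.mk_add_mk] at this
        rw [smul_add]
        convert this using 2
        abel
      map_smul' := fun a y => by
        rw [huniq]
        have := A.graph.smul_mem a (hR y)
        rw [Prod.smul_mk] at this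
        rw [RingHom.id_apply, smul_comm z a, ← smul_sub]
        exact this }
  -- The graph of the inverse is a continuous preimage of that of A, so boundedness comes from the
  -- closed graph theorem.
  have hL : IsClosed (L.graph : Set (X × X)) := by
    have : (L.graph : Set (X × X)) = (fun p : X × X => (p.2, z • p.2 - p.1)) ⁻¹' A.graph := by
      ext ⟨y, x⟩
      simp only [SetLike.mem_coe, LinearMap.mem_graph_iff, Set.mem_preimage]
      exact eq_comm.trans (huniq x y)
    rw [this]
    exact hA.preimage (by fun_prop)
  exact mem_resolventSet_iff.2 ⟨ContinuousLinearMap.ofIsClosedGraph hL, huniq⟩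

end UnboundedOperators

/-! ### Spectral properties of the generator of the Fokker-Planck semigroup -/

section Spectral

variable {n : ℕ} {β : ℝ} {c : Fin n → ℝ}

lemma isRealSemigroup_ou [NeZero n] (hc : ∀ i, 0 < c i) (hβ : 0 < β) :
    IsRealSemigroup (ou (β := β) hc hβ) where
  zero := ou_zero hc hβ
  add := fun _ _ hs ht => ou_add hc hβ hs ht
  cont := continuousOn_ou hc hβ
  bdd := exists_norm_ou_le hc hβ

lemma muL_mem_genGraph [NeZero n] (hc : ∀ i, 0 < c i) (hβ : 0 < β) (k : Fin n → ℕ) :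
    (muL hc hβ.le k, eigval c k • muL hc hβ.le k) ∈ genGraph (ou (β := β) hc hβ) :=
  IsRealSemigroup.mem_genGraph_of_eigenvector fun _ ht => ou_muL hc hβ ht k

lemma muL_ne_zero [NeZero n] (hc : ∀ i, 0 < c i) (hβ : 0 < β) (k : Fin n → ℕ) :
    muL (β := β) hc hβ.le k ≠ 0 := fun h => by
  have := eq_zero_of_sum_muL_mem hc hβ (k := ∑ i, k i + 1) {k} (by simp) (fun _ => 1)
    (by simp [h]) k (by simp)
  exact one_ne_zero this

lemma exists_lower_bound [NeZero n] (hc : ∀ i, 0 < c i) : ∃ c₀, 0 < c₀ ∧ ∀ i, c₀ ≤ c i := by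
  obtain ⟨i, _, hi⟩ := Finset.exists_min_image Finset.univ c Finset.univ_nonempty
  exact ⟨c i, hc i, fun j => hi j (Finset.mem_univ j)⟩

/-- With k so large that Re z > -k c₀, the 𝓗_k component of y is handled by the Laplace transform of
its decaying orbit, and each of the finitely many remaining μ_l by division by z - λ_l, where λ_l is
its eigenvalue. -/
lemma exists_mem_genGraph_ou [NeZero n] (hc : ∀ i, 0 < c i) (hβ : 0 < β) {z : ℂ}
    (hz : z ∉ Set.range (eigval c)) (y : WL2 n β) :
    ∃ x, (x, z • x - y) ∈ genGraph (ou hc hβ) := by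
  obtain ⟨c₀, hc₀, hle⟩ := exists_lower_bound hc
  obtain ⟨k, hk⟩ := exists_nat_gt (-z.re / c₀)
  rw [div_lt_iff₀ hc₀] at hk
  obtain ⟨a, ha⟩ := exists_sub_sum_muL_mem hc hβ k y
  obtain ⟨C, _, hC⟩ := exists_norm_ou_le_of_mem hc hβ hc₀ hle k
  set g := y - ∑ l ∈ lowDeg n k, a l • muL (β := β) hc hβ.le l with hg
  obtain ⟨x, hx⟩ := (isRealSemigroup_ou hc hβ).exists_resolvent (y := g) (z := z)
    (C := C * ‖g‖) (w := k * c₀) (fun t ht => by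
      refine (hC t ht g ha).trans (le_of_eq ?_)
      rw [mul_right_comm]
      congr 2
      ring) (by linarith)
  refine ⟨x + ∑ l ∈ lowDeg n k, (a l / (z - eigval c l)) • muL (β := β) hc hβ.le l, ?_⟩
  have hsum := (genGraph (ou hc hβ)).sum_mem (t := lowDeg n k)
    (f := fun l => (a l / (z - eigval c l)) •
      (muL (β := β) hc hβ.le l, eigval c l • muL (β := β) hc hβ.le l))
    fun l _ => (genGraph (ou hc hβ)).smul_mem _ (muL_mem_genGraph hc hβ l)
  have htot := (genGraph (ou hc hβ)).add_mem hx hsum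
  convert htot using 1
  refine Prod.ext ?_ ?_
  · simp [Prod.fst_sum]
  · have hy : y = g + ∑ l ∈ lowDeg n k, a l • muL (β := β) hc hβ.le l := by rw [hg, sub_add_cancel]
    have hl : ∀ l, (a l / (z - eigval c l)) • eigval c l • muL (β := β) hc hβ.le l =
        z • (a l / (z - eigval c l)) • muL (β := β) hc hβ.le l - a l • muL (β := β) hc hβ.le l := by
      intro l
      have : z - eigval c l ≠ 0 := sub_ne_zero.2 fun h => hz ⟨l, h.symm⟩
      rw [smul_smul, smul_smul, ← sub_smul]
      congr 1
      field_simp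
      ring
    simp only [Prod.snd_add, Prod.snd_sum, Prod.smul_snd, hl]
    rw [Finset.sum_sub_distrib, ← Finset.smul_sum, smul_add]
    nth_rw 1 [hy]
    abel

lemma eq_of_forall_exp_eq {z w : ℂ} (h : ∀ t : ℝ, 0 ≤ t → Complex.exp (t * z) = Complex.exp (t * w)) :
    z = w := by
  have hd : ∀ u : ℂ, HasDerivWithinAt (fun t : ℝ => Complex.exp (t * u)) u (Set.Ici 0) 0 := fun u => by
    have := ((hasDerivAt_id (0 : ℝ)).ofReal_comp.mul_const u).cexp
    simpa using this.hasDerivWithinAt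
  exact (uniqueDiffOn_Ici 0 0 Set.self_mem_Ici).eq_deriv _ (hd z)
    ((hd w).congr_of_mem (fun t ht => h t ht) Set.self_mem_Ici)

/-- Write the eigenvector as g in 𝓗_k plus a combination of low μ_l. Then T(t)g - e^{tz}g lies both
in 𝓗_k and in the span of the low μ_l, so it is 0. This leaves only coefficients with eigenvalue z,
and it makes g decay more slowly than 𝓗_k permits unless g = 0. -/
lemma mem_span_of_mem_genGraph_ou [NeZero n] (hc : ∀ i, 0 < c i) (hβ : 0 < β) {z : ℂ}
    {x : WL2 n β} (hx : (x, z • x) ∈ genGraph (ou hc hβ)) :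
    x ∈ Submodule.span ℂ (muL (β := β) hc hβ.le '' {k | eigval c k = z}) := by
  obtain ⟨c₀, hc₀, hle⟩ := exists_lower_bound hc
  obtain ⟨k, hk⟩ := exists_nat_gt (-z.re / c₀)
  rw [div_lt_iff₀ hc₀] at hk
  obtain ⟨a, ha⟩ := exists_sub_sum_muL_mem hc hβ k x
  obtain ⟨C, hC0, hC⟩ := exists_norm_ou_le_of_mem hc hβ hc₀ hle k
  set g := x - ∑ l ∈ lowDeg n k, a l • muL (β := β) hc hβ.le l with hg
  have hTg : ∀ t : ℝ, 0 ≤ t → ou hc hβ t g - Complex.exp (t * z) • g =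
      ∑ l ∈ lowDeg n k, (a l * (Complex.exp (t * z) - Complex.exp (t * eigval c l))) •
        muL (β := β) hc hβ.le l := by
    intro t ht
    rw [hg, map_sub, (isRealSemigroup_ou hc hβ).apply_of_eigenvector hx ht, smul_sub,
      sub_sub_sub_cancel_left, map_sum, Finset.smul_sum, ← Finset.sum_sub_distrib]
    refine Finset.sum_congr rfl fun l _ => ?_
    rw [map_smul, ou_muL hc hβ ht, smul_smul, smul_smul, ← sub_smul]
    congr 1
    ring
  have hcoef : ∀ t : ℝ, 0 ≤ t → ∀ l ∈ lowDeg n k,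
      a l * (Complex.exp (t * z) - Complex.exp (t * eigval c l)) = 0 := fun t ht => by
    refine eq_zero_of_sum_muL_mem hc hβ (k := k) _ (fun l hl => mem_lowDeg.1 hl)
      (fun l => a l * (Complex.exp (t * z) - Complex.exp (t * eigval c l))) ?_
    rw [← hTg t ht]
    exact Submodule.sub_mem _ (ou_mem_momentSpace hc hβ ht ha) (Submodule.smul_mem _ _ ha)
  have hg0 : g = 0 := by
    have hbound : ∀ t : ℝ, 0 ≤ t → ‖g‖ ≤ C * Real.exp (-(k * c₀ + z.re) * t) * ‖g‖ := by
      intro t ht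
      have h1 : ou hc hβ t g = Complex.exp (t * z) • g := by
        rw [← sub_eq_zero, hTg t ht]
        exact Finset.sum_eq_zero fun l hl => by rw [hcoef t ht l hl, zero_smul]
      have h2 := hC t ht g ha
      rw [h1, norm_smul, Complex.norm_exp, Complex.re_ofReal_mul] at h2
      calc ‖g‖ = Real.exp (-(t * z.re)) * (Real.exp (t * z.re) * ‖g‖) := by
            rw [← mul_assoc, ← Real.exp_add, neg_add_cancel, Real.exp_zero, one_mul]
        _ ≤ Real.exp (-(t * z.re)) * (C * Real.exp (-(t * k * c₀)) * ‖g‖) :=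
            mul_le_mul_of_nonneg_left h2 (Real.exp_pos _).le
        _ = C * (Real.exp (-(t * z.re)) * Real.exp (-(t * k * c₀))) * ‖g‖ := by ring
        _ = _ := by
            rw [← Real.exp_add]
            ring_nf
    have hlim : Tendsto (fun t : ℝ => C * Real.exp (-(k * c₀ + z.re) * t) * ‖g‖) atTop (𝓝 0) := by
      have h3 : Tendsto (fun t : ℝ => -(k * c₀ + z.re) * t) atTop atBot :=
        tendsto_id.const_mul_atTop_of_neg (by linarith)
      simpa using ((Real.tendsto_exp_atBot.comp h3).const_mul C).mul_const ‖g‖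
    have := ge_of_tendsto hlim (Filter.eventually_atTop.2 ⟨0, fun t ht => hbound t ht⟩)
    exact norm_le_zero_iff.1 this
  have hxs : x = ∑ l ∈ lowDeg n k, a l • muL (β := β) hc hβ.le l := by
    rw [hg, sub_eq_zero] at hg0
    exact hg0
  rw [hxs]
  refine Submodule.sum_mem _ fun l hl => ?_
  by_cases hal : a l = 0
  · rw [hal, zero_smul]
    exact Submodule.zero_mem _
  · refine Submodule.smul_mem _ _ (Submodule.subset_span ⟨l, ?_, rfl⟩)
    refine (eq_of_forall_exp_eq fun t ht => ?_).symm
    exact sub_eq_zero.1 ((mul_eq_zero.1 (hcoef t ht l hl)).resolve_left hal)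

/-- The difference quotients stay in the closed, invariant subspace 𝓗_k, hence so does their limit.
-/
lemma mem_momentSpace_of_mem_genGraph [NeZero n] (hc : ∀ i, 0 < c i) (hβ : 0 < β) {k : ℕ}
    {x y : WL2 n β} (h : (x, y) ∈ genGraph (ou hc hβ)) (hx : x ∈ momentSpace n β k) :
    y ∈ momentSpace n β k := by
  have h1 : HasDerivWithinAt (fun t => ou hc hβ t x) y (Set.Ioi 0) 0 :=
    (mem_genGraph.1 h).mono Set.Ioi_subset_Ici_self
  rw [hasDerivWithinAt_iff_tendsto_slope' (by simp)] at h1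
  refine (isClosed_momentSpace hβ k).mem_of_tendsto h1 ?_
  filter_upwards [self_mem_nhdsWithin] with t ht
  rw [slope_def_module]
  have : ((t - 0)⁻¹ • (ou hc hβ t x - ou hc hβ 0 x)) =
      (((t - 0)⁻¹ : ℝ) : ℂ) • (ou hc hβ t x - ou hc hβ 0 x) := (Complex.coe_smul _ _).symm
  rw [this]
  exact Submodule.smul_mem _ _ (Submodule.sub_mem _
    (ou_mem_momentSpace hc hβ (le_of_lt ht) hx) (by rwa [ou_zero]))

/-- A differential characterization of the generator on the Fourier side. -/
lemma mem_genGraph_of_hasDerivWithinAt_FL [NeZero n] (hc : ∀ i, 0 < c i) (hβ : 0 < β)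
    {x y : WL2 n β}
    (h : ∀ (ξ : E n) (t : ℝ), 0 ≤ t → HasDerivWithinAt
      (fun s => FL (ou hc hβ s x) (toComplex ξ)) (FL (ou hc hβ t y) (toComplex ξ)) (Set.Ici t) t) :
    (x, y) ∈ genGraph (ou hc hβ) := by
  have hT := isRealSemigroup_ou (β := β) hc hβ
  rw [hT.mem_genGraph_iff]
  intro t ht
  refine ext_FL hβ fun ξ => ?_
  have hξ := toComplex_mem_tube hβ ξ
  rw [← FLc_apply hξ, ← FLc_apply hξ, map_sub]
  refine Eq.trans ?_ ((FLc β _ hξ).intervalIntegral_comp_comm (hT.intervalIntegrable y ht))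
  simp only [FLc_apply]
  have hcont : ∀ u : WL2 n β, ContinuousOn (fun s => FL (ou hc hβ s u) (toComplex ξ)) (Set.Ici 0) :=
    fun u => by
      simp only [← FLc_apply hξ]
      exact (FLc β _ hξ).continuous.comp_continuousOn (hT.cont u)
  rw [intervalIntegral.integral_eq_sub_of_hasDeriv_right_of_le ht
    ((hcont x).mono fun s hs => hs.1)
    (fun s hs => (h ξ s hs.1.le).mono Set.Ioi_subset_Ici_self)
    (((hcont y).mono fun s hs => by
      rw [Set.uIcc_of_le ht] at hs
      exact hs.1).intervalIntegrable), hT.zero]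

end Spectral

/-! ### The Fokker-Planck operator on test functions -/

section TestFunctions

variable {n : ℕ} {β : ℝ} {c : Fin n → ℝ}

lemma contDiff_coordC (i : Fin n) : ContDiff ℝ ∞ (fun x : E n => (x i : ℂ)) :=
  Complex.ofRealCLM.contDiff.comp (contDiff_coord i)

lemma hasCompactSupport_pderiv {u : E n → ℂ} (hu : HasCompactSupport u) (i : Fin n) :
    HasCompactSupport (pderiv i u) := hu.fderiv_apply (𝕜 := ℝ) _

lemma integrable_mul_of_compactSupport {u v : E n → ℂ} (hu : Continuous u)
    (hs : HasCompactSupport u) (hv : Continuous v) : Integrable fun x => u x * v x :=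
  (hu.mul hv).integrable_of_hasCompactSupport hs.mul_right

lemma integral_pderiv_mul {u v : E n → ℂ} (hu : ContDiff ℝ ∞ u) (hs : HasCompactSupport u)
    (hv : ContDiff ℝ ∞ v) (i : Fin n) :
    ∫ x, pderiv i u x * v x = -∫ x, u x * pderiv i v x := by
  have h := integral_mul_fderiv_eq_neg_fderiv_mul_of_integrable (μ := volume)
    (f := u) (g := v) (v := EuclideanSpace.single i (1 : ℝ))
    (integrable_mul_of_compactSupport (contDiff_pderiv i hu).continuous
      (hasCompactSupport_pderiv hs i) hv.continuous)
    (integrable_mul_of_compactSupport hu.continuous hs (contDiff_pderiv i hv).continuous)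
    (integrable_mul_of_compactSupport hu.continuous hs hv.continuous)
    (fun x _ => hu.differentiable (by simp) x) (fun x _ => hv.differentiable (by simp) x)
  exact (neg_eq_iff_eq_neg.2 h).symm

lemma pderiv_const_mul (i : Fin n) (a : ℂ) {u : E n → ℂ} (hu : ContDiff ℝ ∞ u) :
    pderiv i (fun x => a * u x) = fun x => a * pderiv i u x := pderiv_smul i a hu

/-- The Fourier-Laplace transform of `L φ` for a test function `φ`. -/
lemma FL_fpExpr {φ : E n → ℂ} (hφ : ContDiff ℝ ∞ φ) (hs : HasCompactSupport φ)
    (z : Fin n → ℂ) : FL (fpExpr c φ) z = -(∑ i, z i ^ 2) * FL φ z +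
      Complex.I * ∑ i, c i * z i * ∫ x, φ x * (x i * expKer z x) := by
  have hE := contDiff_expKer z
  have hpE : ∀ i, pderiv i (expKer z) = fun x => (-Complex.I * z i) * expKer z x :=
    fun i => funext fun x => pderiv_expKer z i x
  have hint : ∀ {u v : E n → ℂ}, ContDiff ℝ ∞ u → HasCompactSupport u → ContDiff ℝ ∞ v →
      Integrable fun x => u x * v x := fun hu hs hv =>
    integrable_mul_of_compactSupport hu.continuous hs hv.continuous
  have h1 : ∀ i, ∫ x, pderiv i (pderiv i φ) x * expKer z x = -z i ^ 2 * FL φ z := fun i => by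
    rw [integral_pderiv_mul (contDiff_pderiv i hφ) (hasCompactSupport_pderiv hs i) hE, hpE,
      integral_pderiv_mul hφ hs (contDiff_const.mul hE), pderiv_const_mul i _ hE, hpE, neg_neg, FL,
      ← integral_const_mul]
    congr 1
    funext x
    ring_nf
    rw [Complex.I_sq]
    ring
  have h2 : ∀ i, ∫ x, (c i * x i : ℂ) * pderiv i φ x * expKer z x =
      -(c i * FL φ z) + Complex.I * (c i * z i * ∫ x, φ x * (x i * expKer z x)) := fun i => by
    have hxE := (contDiff_coordC i).mul hE
    have e1 : ∀ x : E n, (c i * x i : ℂ) * pderiv i φ x * expKer z x =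
        c i * (pderiv i φ x * (x i * expKer z x)) := fun x => by ring
    have e2 : ∀ x : E n, φ x * pderiv i (fun x => x i * expKer z x) x =
        φ x * expKer z x + (-Complex.I * z i) * (φ x * (x i * expKer z x)) := fun x => by
      rw [pderiv_mul (contDiff_coordC i) hE, pderiv_coord, hpE, if_pos rfl]
      ring
    simp only [e1]
    rw [integral_const_mul, integral_pderiv_mul hφ hs hxE]
    simp only [e2]
    rw [integral_add (hint hφ hs hE) ((hint hφ hs hxE).const_mul _), integral_const_mul, FL]
    ring
  have hi1 : ∀ i ∈ Finset.univ, Integrable fun x => pderiv i (pderiv i φ) x * expKer z x :=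
    fun i _ => hint (contDiff_pderiv i (contDiff_pderiv i hφ))
      (hasCompactSupport_pderiv (hasCompactSupport_pderiv hs i) i) hE
  have hi2 : ∀ i ∈ Finset.univ, Integrable fun x => (c i * x i : ℂ) * pderiv i φ x * expKer z x :=
    fun i _ => by
      refine (hint (contDiff_pderiv i hφ) (hasCompactSupport_pderiv hs i)
        ((contDiff_const (c := (c i : ℂ))).mul ((contDiff_coordC i).mul hE))).congr
          (Eventually.of_forall fun x => ?_)
      simp only
      ring
  have e : ∀ x, fpExpr c φ x * expKer z x =
      (∑ i, pderiv i (pderiv i φ) x * expKer z x +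
        ∑ i, (c i * x i : ℂ) * pderiv i φ x * expKer z x) +
          (∑ i, (c i : ℂ)) * (φ x * expKer z x) := fun x => by
    rw [fpExpr, add_mul, add_mul, Finset.sum_mul, Finset.sum_mul]
    push_cast
    ring
  rw [FL]
  simp only [e]
  have hi12 : Integrable fun x => ∑ i, pderiv i (pderiv i φ) x * expKer z x +
      ∑ i, (c i * x i : ℂ) * pderiv i φ x * expKer z x :=
    (integrable_finsetSum _ hi1).add (integrable_finsetSum _ hi2)
  rw [integral_add hi12 ((hint hφ hs hE).const_mul _), integral_add (integrable_finsetSum _ hi1)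
      (integrable_finsetSum _ hi2), integral_finsetSum _ hi1, integral_finsetSum _ hi2,
      integral_const_mul]
  simp only [h1, h2]
  rw [Finset.sum_add_distrib, Finset.sum_neg_distrib, ← Finset.sum_mul, ← Finset.sum_mul,
    Finset.sum_neg_distrib, ← Finset.mul_sum, FL]
  ring

lemma hasDerivAt_scaleC (t : ℝ) (z : Fin n → ℂ) (i : Fin n) :
    HasDerivAt (fun s => scaleC c s z i) (-(c i * scaleC c t z i)) t := by
  have h := (((hasDerivAt_id t).const_mul (c i)).fun_neg.exp.ofReal_comp).mul_const (z i)
  refine h.congr_deriv ?_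
  simp only [scaleC, id]
  push_cast
  ring

lemma hasDerivAt_ouGauss (hc : ∀ i, 0 < c i) (t : ℝ) (z : Fin n → ℂ) :
    HasDerivAt (fun s => ouGauss c s z) (-(∑ i, scaleC c t z i ^ 2) * ouGauss c t z) t := by
  have h1 : ∀ i, HasDerivAt (fun s => (ouVar c s i : ℂ) * z i ^ 2) (scaleC c t z i ^ 2) t :=
    fun i => by
      have h := ((((hasDerivAt_id t).const_mul (c i)).fun_neg.exp.fun_pow 2).const_sub 1).div_const
        (2 * c i)
      refine (h.ofReal_comp.mul_const (z i ^ 2)).congr_deriv ?_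
      have : (c i : ℂ) ≠ 0 := by exact_mod_cast (hc i).ne'
      simp only [scaleC, id]
      push_cast
      field_simp
  refine (HasDerivAt.fun_sum fun i (_ : i ∈ Finset.univ) => h1 i).fun_neg.cexp.congr_deriv ?_
  rw [ouGauss]
  ring

lemma hasDerivAt_FL_scaleC {φ : E n → ℂ} (hφ : ContDiff ℝ ∞ φ) (hs : HasCompactSupport φ)
    (ξ : E n) (t : ℝ) : HasDerivAt (fun s => FL φ (scaleC c s (toComplex ξ)))
      (Complex.I * ∑ i, c i * scaleC c t (toComplex ξ) i *
        ∫ x, φ x * (x i * expKer (scaleC c t (toComplex ξ)) x)) t := by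
  set F' : ℝ → E n → ℂ := fun s x => φ x * (expKer (scaleC c s (toComplex ξ)) x *
    (Complex.I * ∑ i, c i * scaleC c s (toComplex ξ) i * x i)) with hF'
  set bound : E n → ℝ := fun x => ‖φ x‖ * ∑ i, ‖(c i : ℂ)‖ *
    (Real.exp (|c i| * (|t| + 1)) * |ξ i|) * ‖(x i : ℂ)‖ with hbound
  -- The flow preserves ℝⁿ, where the kernel is unimodular; domination then only concerns the linear
  -- factor, on the support of φ.
  have hreal : ∀ s x, ‖expKer (scaleC c s (toComplex ξ)) x‖ = 1 := fun s x => by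
    rw [norm_expKer]
    simp only [scaleC, toComplex, ← Complex.ofReal_mul, Complex.ofReal_im]
    simp
  have hmain := (hasDerivAt_integral_of_dominated_loc_of_deriv_le (μ := volume)
    (F := fun s x => φ x * expKer (scaleC c s (toComplex ξ)) x) (F' := F') (x₀ := t)
    (s := Metric.ball t 1) (bound := bound) (Metric.ball_mem_nhds t one_pos)
    (Eventually.of_forall fun s => (hφ.continuous.mul (continuous_expKer _)).aestronglyMeasurable)
    (integrable_mul_of_compactSupport hφ.continuous hs (continuous_expKer _))
    (Continuous.aestronglyMeasurable (by
      have := continuous_expKer (scaleC c t (toComplex ξ))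
      have := hφ.continuous
      fun_prop))
    (Eventually.of_forall fun x s hst => ?_) ?_ (Eventually.of_forall fun x s _ => ?_)).2
  · refine hmain.congr_deriv ?_
    rw [Finset.mul_sum]
    have e : ∀ x, F' t x = ∑ i, Complex.I * (c i * scaleC c t (toComplex ξ) i *
        (φ x * (x i * expKer (scaleC c t (toComplex ξ)) x))) := fun x => by
      simp only [hF', Finset.mul_sum]
      exact Finset.sum_congr rfl fun i _ => by ring
    simp only [e]
    rw [integral_finsetSum]
    · exact Finset.sum_congr rfl fun i _ => by rw [integral_const_mul, integral_const_mul]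
    · intro i _
      exact ((integrable_mul_of_compactSupport hφ.continuous hs
        ((contDiff_coordC i).continuous.mul (continuous_expKer _))).const_mul _).const_mul _
  · rw [hF', norm_mul, norm_mul, hreal, one_mul, norm_mul, Complex.norm_I, one_mul]
    refine mul_le_mul_of_nonneg_left ((norm_sum_le _ _).trans (Finset.sum_le_sum fun i _ => ?_))
      (norm_nonneg _)
    rw [norm_mul, norm_mul]
    refine mul_le_mul_of_nonneg_right (mul_le_mul_of_nonneg_left ?_ (norm_nonneg _))
      (norm_nonneg _)
    rw [scaleC, norm_mul, toComplex, Complex.norm_real, Complex.norm_real,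
      Real.norm_of_nonneg (Real.exp_pos _).le, Real.norm_eq_abs]
    refine mul_le_mul_of_nonneg_right (Real.exp_le_exp.2 ?_) (abs_nonneg _)
    have h1 : |s| ≤ |t| + 1 := by
      have := Metric.mem_ball.1 hst
      rw [Real.dist_eq] at this
      linarith [abs_sub_abs_le_abs_sub s t]
    calc -(c i * s) ≤ |c i * s| := neg_le_abs _
      _ = |c i| * |s| := abs_mul _ _
      _ ≤ |c i| * (|t| + 1) := mul_le_mul_of_nonneg_left h1 (abs_nonneg _)
  · refine Continuous.integrable_of_hasCompactSupport ?_ hs.norm.mul_right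
    have := hφ.continuous
    fun_prop
  · have h1 := (HasDerivAt.fun_sum fun i (_ : i ∈ Finset.univ) =>
      (hasDerivAt_scaleC (c := c) s (toComplex ξ) i).const_mul (x i : ℂ)).const_mul (-Complex.I)
    refine (h1.cexp.const_mul (φ x)).congr_deriv ?_
    simp only [hF', expKer]
    congr 2
    rw [neg_mul, ← mul_neg, ← Finset.sum_neg_distrib]
    congr 1
    exact Finset.sum_congr rfl fun i _ => by ring

/-- In Fourier variables L becomes -|z|² - ∑ cᵢ zᵢ ∂ᵢ, and `ou` is the solution of the resulting
transport equation by characteristics. Differentiating the explicit formula in t reproduces `ou`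
applied to Lφ. -/
lemma testGraph_le_genGraph [NeZero n] (hc : ∀ i, 0 < c i) (hβ : 0 < β) :
    testGraph c β ≤ genGraph (ou hc hβ) := by
  rintro ⟨f, g⟩ ⟨φ, hφ, hs, hf, hg⟩
  refine mem_genGraph_of_hasDerivWithinAt_FL hc hβ fun ξ t ht => ?_
  have hξ := toComplex_mem_tube hβ ξ
  have hFf : ∀ z, FL f z = FL φ z := FL_congr (ae_volume_of_ae_weight hf)
  have hFg : ∀ z, FL g z = FL (fpExpr c φ) z := FL_congr (ae_volume_of_ae_weight hg)
  have h1 := (hasDerivAt_ouGauss hc t (toComplex ξ)).fun_mul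
    (hasDerivAt_FL_scaleC (c := c) hφ hs ξ t)
  have h2 := h1.hasDerivWithinAt (s := Set.Ici t)
  refine (h2.congr_of_mem (fun s hs => ?_) Set.self_mem_Ici).congr_deriv ?_
  · rw [FL_ou hc hβ (ht.trans hs) f hξ, hFf]
  · rw [FL_ou hc hβ ht g hξ, hFg, FL_fpExpr hφ hs]
    ring

lemma mem_genGraph_unique {X : Type*} [NormedAddCommGroup X] [NormedSpace ℂ X]
    {T : ℝ → X →L[ℂ] X} {x y y' : X} (h : (x, y) ∈ genGraph T) (h' : (x, y') ∈ genGraph T) :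
    y = y' :=
  (uniqueDiffOn_Ici 0 0 Set.self_mem_Ici).eq_deriv _ (mem_genGraph.1 h) (mem_genGraph.1 h')

end TestFunctions

/-! ### Cutoffs, and the closure of the operator on test functions -/

section Cutoff

variable {n : ℕ} {β : ℝ} {c : Fin n → ℝ}

lemma pderiv_comp_smul (i : Fin n) (g : E n → ℂ) (r : ℝ) :
    pderiv i (fun x => g (r • x)) = fun x => r * pderiv i g (r • x) := by
  funext x
  simp only [pderiv]
  rw [fderiv_comp_smul]
  simp

lemma pderiv_eq_zero_of_eqOn {g : E n → ℂ} {U : Set (E n)} (hU : IsOpen U) {a : ℂ}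
    (h : ∀ x ∈ U, g x = a) (i : Fin n) : ∀ x ∈ U, pderiv i g x = 0 := fun x hx => by
  have : g =ᶠ[𝓝 x] fun _ => a := Filter.eventually_of_mem (hU.mem_nhds hx) h
  rw [pderiv, this.fderiv_eq]
  simp

/-- A fixed bump dilated by m + 1. Every derivative gains a factor at most 1, so one bound B serves
all m. -/
lemma exists_cutoff (n : ℕ) : ∃ B : ℝ, 0 ≤ B ∧ ∀ m : ℕ, ∃ χ : E n → ℂ, ContDiff ℝ ∞ χ ∧
    HasCompactSupport χ ∧ (∀ x, ‖χ x‖ ≤ B) ∧ (∀ i x, ‖pderiv i χ x‖ ≤ B) ∧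
    (∀ i x, ‖pderiv i (pderiv i χ) x‖ ≤ B) ∧
    ∀ x, ‖x‖ < m + 1 → χ x = 1 ∧ ∀ i, pderiv i χ x = 0 ∧ pderiv i (pderiv i χ) x = 0 := by
  let b : ContDiffBump (0 : E n) := ⟨1, 2, one_pos, one_lt_two⟩
  set g : E n → ℂ := fun x => (b x : ℂ) with hg
  have hgs : ContDiff ℝ ∞ g := Complex.ofRealCLM.contDiff.comp b.contDiff
  have hgc : HasCompactSupport g := b.hasCompactSupport.comp_left (g := ((↑) : ℝ → ℂ)) (by simp)
  have hone : ∀ x ∈ Metric.ball (0 : E n) 1, g x = 1 := fun x hx => by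
    rw [hg]
    simp only [b.one_of_mem_closedBall (Metric.ball_subset_closedBall hx), Complex.ofReal_one]
  have hd1 := fun i => pderiv_eq_zero_of_eqOn Metric.isOpen_ball hone i
  have hd2 := fun i => pderiv_eq_zero_of_eqOn Metric.isOpen_ball (hd1 i) i
  obtain ⟨B₀, hB₀⟩ := hgc.exists_bound_of_continuous hgs.continuous
  choose B₁ hB₁ using fun i => (hasCompactSupport_pderiv hgc i).exists_bound_of_continuous
    (contDiff_pderiv i hgs).continuous
  choose B₂ hB₂ using fun i => (hasCompactSupport_pderiv (hasCompactSupport_pderiv hgc i)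
    i).exists_bound_of_continuous (contDiff_pderiv i (contDiff_pderiv i hgs)).continuous
  have h0 : 0 ≤ B₀ := (norm_nonneg _).trans (hB₀ 0)
  have h1 : ∀ i, 0 ≤ B₁ i := fun i => (norm_nonneg _).trans (hB₁ i 0)
  have h2 : ∀ i, 0 ≤ B₂ i := fun i => (norm_nonneg _).trans (hB₂ i 0)
  have hs1 : 0 ≤ ∑ i, B₁ i := Finset.sum_nonneg fun i _ => h1 i
  have hs2 : 0 ≤ ∑ i, B₂ i := Finset.sum_nonneg fun i _ => h2 i
  refine ⟨B₀ + ∑ i, B₁ i + ∑ i, B₂ i, by positivity, fun m => ?_⟩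
  set r : ℝ := ((m : ℝ) + 1)⁻¹ with hr
  have hr0 : 0 < r := by positivity
  have hr1 : r ≤ 1 := inv_le_one_of_one_le₀ (by linarith [m.cast_nonneg (α := ℝ)])
  have hrn : ‖(r : ℂ)‖ ≤ 1 := by rwa [Complex.norm_real, Real.norm_of_nonneg hr0.le]
  have hp1 : ∀ i, pderiv i (fun x => g (r • x)) = fun x => r * pderiv i g (r • x) :=
    fun i => pderiv_comp_smul i g r
  have hsm : ∀ u : E n → ℂ, ContDiff ℝ ∞ u → ContDiff ℝ ∞ fun x => u (r • x) := fun u hu =>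
    hu.comp (contDiff_const_smul r)
  have hp2 : ∀ i, pderiv i (pderiv i (fun x => g (r • x))) =
      fun x => r * (r * pderiv i (pderiv i g) (r • x)) := fun i => by
    rw [hp1, pderiv_const_mul i _ (hsm _ (contDiff_pderiv i hgs)), pderiv_comp_smul]
  refine ⟨fun x => g (r • x), hsm g hgs, hgc.comp_homeomorph (Homeomorph.smulOfNeZero r hr0.ne'),
    fun x => (hB₀ _).trans (by linarith), fun i x => ?_, fun i x => ?_, fun x hx => ?_⟩
  · rw [hp1, norm_mul]
    refine (mul_le_of_le_one_left (norm_nonneg _) hrn).trans ((hB₁ i _).trans ?_)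
    linarith [Finset.single_le_sum (fun i _ => h1 i) (Finset.mem_univ i)]
  · rw [hp2, norm_mul, norm_mul]
    refine (mul_le_of_le_one_left (by positivity) hrn).trans
      ((mul_le_of_le_one_left (norm_nonneg _) hrn).trans ((hB₂ i _).trans ?_))
    linarith [Finset.single_le_sum (fun i _ => h2 i) (Finset.mem_univ i)]
  · have hmem : r • x ∈ Metric.ball (0 : E n) 1 := by
      rw [mem_ball_zero_iff, norm_smul, Real.norm_of_nonneg hr0.le, hr,
        inv_mul_lt_iff₀ (by positivity), mul_one]
      exact hx
    refine ⟨hone _ hmem, fun i => ⟨?_, ?_⟩⟩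
    · simp only [hp1, hd1 i _ hmem, mul_zero]
    · simp only [hp2, hd2 i _ hmem, mul_zero]

/-- The rate β suffices: squared it beats the weight, of size exp(β|x|_∞), and leaves an integrable
exp(-β|x|_∞). -/
lemma tendsto_WL2_of_dominated [NeZero n] (hβ : 0 < β) {u : ℕ → WL2 n β} {v : WL2 n β}
    {U : ℕ → E n → ℂ} {V : E n → ℂ} (hu : ∀ m, u m =ᵐ[weightMeasure n β] U m)
    (hv : v =ᵐ[weightMeasure n β] V) {D : ℝ} (hb : ∀ m x, ‖U m x‖ ≤ D * Real.exp (-β * supn x))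
    (hlim : ∀ x, ∀ᶠ m in atTop, U m x = V x) : Tendsto u atTop (𝓝 v) := by
  have hsq : ∀ m, ‖u m - v‖ ^ 2 = ∫ x, weight β x * ‖(u m - v : WL2 n β) x‖ ^ 2 := fun m =>
    norm_sq_eq _
  have hae : ∀ m, (u m - v : WL2 n β) =ᵐ[volume] fun x => U m x - V x := fun m =>
    ae_volume_of_ae_weight ((Lp.coeFn_sub _ _).trans ((hu m).sub hv))
  have hVb : ∀ x, ‖V x‖ ≤ D * Real.exp (-β * supn x) := fun x => by
    obtain ⟨m, hm⟩ := (hlim x).exists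
    exact hm ▸ hb m x
  have hlim2 : Tendsto (fun m => ∫ x, weight β x * ‖(u m - v : WL2 n β) x‖ ^ 2) atTop
      (𝓝 (∫ _ : E n, (0 : ℝ))) := by
    refine tendsto_integral_of_dominated_convergence
      (fun x => n * (2 * D) ^ 2 * Real.exp (-β * supn x))
      (fun m => continuous_weight.aestronglyMeasurable.mul
        ((aestronglyMeasurable_volume (u m - v)).norm.pow 2))
      ((integrable_exp_neg_supn hβ).const_mul _) (fun m => ?_) ?_
    · filter_upwards [hae m] with x hx
      rw [hx, Real.norm_of_nonneg (mul_nonneg (weight_pos x).le (sq_nonneg _))]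
      have h1 : ‖U m x - V x‖ ≤ 2 * D * Real.exp (-β * supn x) :=
        (norm_sub_le _ _).trans (by linarith [hb m x, hVb x])
      calc weight β x * ‖U m x - V x‖ ^ 2
          ≤ (n * Real.exp (β * supn x)) * (2 * D * Real.exp (-β * supn x)) ^ 2 :=
            mul_le_mul (weight_le_exp hβ.le x) (pow_le_pow_left₀ (norm_nonneg _) h1 2)
              (sq_nonneg _) (by positivity)
        _ = n * (2 * D) ^ 2 * (Real.exp (β * supn x) * Real.exp (-β * supn x)) *
              Real.exp (-β * supn x) := by ring
        _ = n * (2 * D) ^ 2 * Real.exp (-β * supn x) := by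
            rw [← Real.exp_add, neg_mul, add_neg_cancel, Real.exp_zero, mul_one]
    · filter_upwards [ae_all_iff.2 hae] with x hx
      refine tendsto_const_nhds.congr' ?_
      filter_upwards [hlim x] with m hm
      rw [hx, hm, sub_self, norm_zero]
      simp
  rw [integral_zero] at hlim2
  simp only [← hsq] at hlim2
  rw [tendsto_iff_norm_sub_tendsto_zero]
  have := (Real.continuous_sqrt.tendsto 0).comp hlim2
  simpa [Function.comp_def, Real.sqrt_sq (norm_nonneg _)] using this

/-- The action of `L` on polynomials times `μ₀`. -/
def fpPoly (c : Fin n → ℝ) (p : MvPolynomial (Fin n) ℂ) : MvPolynomial (Fin n) ℂ :=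
  ∑ i, gaussDeriv c i (gaussDeriv c i p) +
    ∑ i, MvPolynomial.C (c i : ℂ) * MvPolynomial.X i * gaussDeriv c i p +
    MvPolynomial.C (∑ i, (c i : ℂ)) * p

lemma fpExpr_polyGauss (p : MvPolynomial (Fin n) ℂ) :
    fpExpr c (polyGauss c p) = polyGauss c (fpPoly c p) := by
  funext x
  simp only [fpExpr, pderiv_polyGauss]
  simp only [polyGauss, fpPoly, map_add, map_sum, map_mul, MvPolynomial.eval_C,
    MvPolynomial.eval_X, add_mul, Finset.sum_mul, toComplex]
  push_cast
  simp only [Finset.sum_mul, mul_assoc]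

lemma fpExpr_mul {χ p : E n → ℂ} (hχ : ContDiff ℝ ∞ χ) (hp : ContDiff ℝ ∞ p) (x : E n) :
    fpExpr c (fun x => χ x * p x) x = χ x * fpExpr c p x +
      ∑ i, (pderiv i (pderiv i χ) x * p x + 2 * pderiv i χ x * pderiv i p x +
        c i * x i * (pderiv i χ x * p x)) := by
  have h1 : ∀ i, pderiv i (fun x => χ x * p x) =
      (fun x => pderiv i χ x * p x) + fun x => χ x * pderiv i p x := fun i =>
    funext fun x => pderiv_mul hχ hp i x
  have h2 : ∀ i, pderiv i (pderiv i (fun x => χ x * p x)) x = pderiv i (pderiv i χ) x * p x +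
      2 * pderiv i χ x * pderiv i p x + χ x * pderiv i (pderiv i p) x := fun i => by
    rw [h1, pderiv_add i ((contDiff_pderiv i hχ).mul hp) (hχ.mul (contDiff_pderiv i hp)),
      Pi.add_apply, pderiv_mul (contDiff_pderiv i hχ) hp, pderiv_mul hχ (contDiff_pderiv i hp)]
    ring
  simp only [fpExpr, h2]
  simp only [h1, Pi.add_apply, mul_add, Finset.mul_sum, Finset.sum_add_distrib]
  push_cast
  have h3 : ∀ i, (c i : ℂ) * x i * (χ x * pderiv i p x) = χ x * (c i * x i * pderiv i p x) :=
    fun i => by ring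
  simp only [h3]
  ring

/-- Approximation by χ_m p μ₀. The terms of L(χ_m p μ₀) containing derivatives of χ_m are uniformly
dominated and vanish eventually at every point. -/
lemma polyGaussL_mem_closure [NeZero n] (hc : ∀ i, 0 < c i) (hβ : 0 < β)
    (p : MvPolynomial (Fin n) ℂ) :
    (polyGaussL hc hβ.le p, polyGaussL hc hβ.le (fpPoly c p)) ∈
      (testGraph c β).topologicalClosure := by
  obtain ⟨B, hB, hχ⟩ := exists_cutoff n
  choose χ hχs hχc hχ0 hχ1 hχ2 hχone using hχ
  set g := polyGauss c p with hg
  have hgs : ContDiff ℝ ∞ g := contDiff_polyGauss p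
  -- The rate β is what dominated convergence needs; the extra 1 absorbs the factor xᵢ of the drift.
  obtain ⟨C₀, hC₀, h0⟩ := exists_norm_polyGauss_le hc p (β + 1)
  choose C₁ hC₁ h1 using fun i => exists_norm_polyGauss_le hc (gaussDeriv c i p) (β + 1)
  obtain ⟨C₂, hC₂, h2⟩ := exists_norm_polyGauss_le hc (fpPoly c p) (β + 1)
  have hexp : ∀ x : E n, Real.exp (-(β + 1) * supn x) ≤ Real.exp (-β * supn x) := fun x =>
    Real.exp_le_exp.2 (by nlinarith [supn_nonneg x])
  have hexp2 : ∀ x : E n, supn x * Real.exp (-(β + 1) * supn x) ≤ Real.exp (-β * supn x) :=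
    fun x => by
      have h3 : supn x ≤ Real.exp (supn x) := by linarith [Real.add_one_le_exp (supn x)]
      refine (mul_le_mul_of_nonneg_right h3 (Real.exp_pos _).le).trans (le_of_eq ?_)
      rw [← Real.exp_add]
      ring_nf
  have hUb : ∀ m x, ‖χ m x * g x‖ ≤ (B * C₀) * Real.exp (-β * supn x) := fun m x => by
    rw [norm_mul, mul_assoc]
    exact mul_le_mul (hχ0 m x) ((h0 x).trans (mul_le_mul_of_nonneg_left (hexp x) hC₀))
      (norm_nonneg _) hB
  have hVb : ∀ m x, ‖fpExpr c (fun x => χ m x * g x) x‖ ≤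
      (B * C₂ + ∑ i, (B * C₀ + 2 * B * C₁ i + |c i| * (B * C₀))) * Real.exp (-β * supn x) :=
    fun m x => by
      rw [fpExpr_mul (hχs m) hgs, hg, fpExpr_polyGauss, add_mul, Finset.sum_mul]
      have e0 : 0 ≤ Real.exp (-β * supn x) := (Real.exp_pos _).le
      have hp0 : ‖polyGauss c p x‖ ≤ C₀ * Real.exp (-β * supn x) :=
        (h0 x).trans (mul_le_mul_of_nonneg_left (hexp x) hC₀)
      refine (norm_add_le _ _).trans (add_le_add ?_ ((norm_sum_le _ _).trans
        (Finset.sum_le_sum fun i _ => ?_)))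
      · rw [norm_mul, mul_assoc]
        exact mul_le_mul (hχ0 m x) ((h2 x).trans (mul_le_mul_of_nonneg_left (hexp x) hC₂))
          (norm_nonneg _) hB
      · rw [pderiv_polyGauss, add_mul, add_mul]
        refine norm_add₃_le.trans (add_le_add (add_le_add ?_ ?_) ?_)
        · rw [norm_mul, mul_assoc]
          exact mul_le_mul (hχ2 m i x) hp0 (norm_nonneg _) hB
        · rw [norm_mul, norm_mul, Complex.norm_two, mul_assoc, mul_assoc, mul_assoc]
          refine mul_le_mul_of_nonneg_left ?_ zero_le_two
          exact mul_le_mul (hχ1 m i x)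
            ((h1 i x).trans (mul_le_mul_of_nonneg_left (hexp x) (hC₁ i))) (norm_nonneg _) hB
        · rw [norm_mul, norm_mul, norm_mul, Complex.norm_real, Complex.norm_real,
            Real.norm_eq_abs, Real.norm_eq_abs]
          calc |c i| * |x i| * (‖pderiv i (χ m) x‖ * ‖polyGauss c p x‖)
              ≤ |c i| * supn x * (B * (C₀ * Real.exp (-(β + 1) * supn x))) := by
                refine mul_le_mul (mul_le_mul_of_nonneg_left (abs_le_supn x i) (abs_nonneg _))
                  (mul_le_mul (hχ1 m i x) (h0 x) (norm_nonneg _) hB) (by positivity)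
                  (mul_nonneg (abs_nonneg _) (supn_nonneg x))
            _ = |c i| * (B * C₀) * (supn x * Real.exp (-(β + 1) * supn x)) := by ring
            _ ≤ |c i| * (B * C₀) * Real.exp (-β * supn x) :=
                mul_le_mul_of_nonneg_left (hexp2 x) (by positivity)
  have hcont : ∀ m, ContDiff ℝ ∞ fun x => χ m x * g x := fun m => (hχs m).mul hgs
  have hfpc : ∀ {φ : E n → ℂ}, ContDiff ℝ ∞ φ → Continuous (fpExpr c φ) := fun {φ} hφ => by
    have k1 := fun i => (contDiff_pderiv i (contDiff_pderiv i hφ)).continuous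
    have k2 := fun i => (contDiff_pderiv i hφ).continuous
    have k3 := hφ.continuous
    unfold fpExpr
    fun_prop
  have hmem : ∀ {φ : E n → ℂ}, Continuous φ → HasCompactSupport φ →
      MemLp φ 2 (weightMeasure n β) := fun {φ} hφ hs => by
    refine memLp_of_integrable hφ.aestronglyMeasurable ?_
    refine Continuous.integrable_of_hasCompactSupport (continuous_weight.mul (hφ.norm.pow 2)) ?_
    exact (hs.norm.comp_left (g := fun a : ℝ => a ^ 2) (by simp)).mul_left
  have hfps : ∀ m, HasCompactSupport (fpExpr c fun x => χ m x * g x) := fun m => by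
    have hs : HasCompactSupport fun x => χ m x * g x := (hχc m).mul_right
    refine hs.mono' fun x hx => ?_
    by_contra hxs
    refine hx ?_
    have e1 : ∀ i, pderiv i (fun x => χ m x * g x) x = 0 := fun i =>
      image_eq_zero_of_notMem_tsupport fun h =>
        hxs (tsupport_fderiv_apply_subset ℝ _ h)
    have e2 : ∀ i, pderiv i (pderiv i fun x => χ m x * g x) x = 0 := fun i =>
      image_eq_zero_of_notMem_tsupport fun h =>
        hxs (tsupport_fderiv_apply_subset ℝ _ (tsupport_fderiv_apply_subset ℝ _ h))
    have e3 : χ m x * g x = 0 :=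
      image_eq_zero_of_notMem_tsupport (f := fun x => χ m x * g x) hxs
    simp [fpExpr, e1, e2, e3]
  set u : ℕ → WL2 n β := fun m => (hmem (hcont m).continuous (hχc m).mul_right).toLp
    with hu
  set v : ℕ → WL2 n β := fun m => (hmem (hfpc (hcont m)) (hfps m)).toLp with hv
  have huae : ∀ m, u m =ᵐ[weightMeasure n β] fun x => χ m x * g x := fun m => MemLp.coeFn_toLp _
  have hvae : ∀ m, v m =ᵐ[weightMeasure n β] fpExpr c fun x => χ m x * g x := fun m =>
    MemLp.coeFn_toLp _
  have hball : ∀ x : E n, ∀ᶠ m : ℕ in atTop, ‖x‖ < m + 1 := fun x => by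
    filter_upwards [(tendsto_natCast_atTop_atTop (R := ℝ)).eventually_gt_atTop ‖x‖] with m hm
    linarith
  have hulim : Tendsto u atTop (𝓝 (polyGaussL hc hβ.le p)) := by
    refine tendsto_WL2_of_dominated hβ huae (coeFn_polyGaussL hc hβ.le p) hUb fun x => ?_
    filter_upwards [hball x] with m hm
    rw [(hχone m x hm).1, one_mul]
  have hvlim : Tendsto v atTop (𝓝 (polyGaussL hc hβ.le (fpPoly c p))) := by
    refine tendsto_WL2_of_dominated hβ hvae (coeFn_polyGaussL hc hβ.le (fpPoly c p)) hVb
      fun x => ?_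
    filter_upwards [hball x] with m hm
    rw [fpExpr_mul (hχs m) hgs, (hχone m x hm).1, one_mul, hg, fpExpr_polyGauss,
      Finset.sum_eq_zero, add_zero]
    intro i _
    rw [((hχone m x hm).2 i).1, ((hχone m x hm).2 i).2]
    ring
  refine mem_closure_of_tendsto (hulim.prodMk_nhds hvlim) (Eventually.of_forall fun m => ?_)
  exact ⟨_, hcont m, (hχc m).mul_right, huae m, hvae m⟩

/-- The value of L on μ_k need not be computed: the closure lies in the graph of the generator,
which is single-valued and sends μ_k to its multiple by the eigenvalue. -/
lemma muL_mem_closure [NeZero n] (hc : ∀ i, 0 < c i) (hβ : 0 < β) (k : Fin n → ℕ) :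
    (muL hc hβ.le k, eigval c k • muL hc hβ.le k) ∈ (testGraph c β).topologicalClosure := by
  have h1 := polyGaussL_mem_closure hc hβ (hermitePoly c k)
  have h2 : (testGraph c β).topologicalClosure ≤ genGraph (ou hc hβ) :=
    Submodule.topologicalClosure_minimal _ (testGraph_le_genGraph hc hβ)
      (isRealSemigroup_ou hc hβ).isClosed_genGraph
  have h3 := mem_genGraph_unique (h2 h1) (muL_mem_genGraph hc hβ k)
  rw [← h3]
  exact h1

/-- The closure of `L` on test functions is the generator of the Fokker-Planck semigroup. -/
theorem topologicalClosure_testGraph [NeZero n] (hc : ∀ i, 0 < c i) (hβ : 0 < β) :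
    (testGraph c β).topologicalClosure = genGraph (ou hc hβ) := by
  have hle : (testGraph c β).topologicalClosure ≤ genGraph (ou hc hβ) :=
    Submodule.topologicalClosure_minimal _ (testGraph_le_genGraph hc hβ)
      (isRealSemigroup_ou hc hβ).isClosed_genGraph
  have hgraph : (genGraph (ou hc hβ)).toLinearPMap.graph = genGraph (ou (β := β) hc hβ) :=
    Submodule.toLinearPMap_graph_eq _ fun p hp h0 => by
      obtain ⟨x, y⟩ := p
      obtain rfl : x = 0 := h0
      exact mem_genGraph_unique hp (genGraph (ou hc hβ)).zero_mem
  -- All eigenvalues are at most 0, so 1 is a convenient resolvent point.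
  have h1 : (1 : ℂ) ∉ Set.range (eigval c) := by
    rintro ⟨k, hk⟩
    have := congrArg Complex.re hk
    rw [eigval, Complex.ofReal_re, Complex.one_re] at this
    have h2 : 0 ≤ ∑ i, c i * k i := Finset.sum_nonneg fun i _ => mul_nonneg (hc i).le (by simp)
    linarith
  have hres := mem_resolventSet_of_bijective (A := (genGraph (ou (β := β) hc hβ)).toLinearPMap)
    (z := 1) (by rw [hgraph]; exact (isRealSemigroup_ou hc hβ).isClosed_genGraph)
    (fun y => by rw [hgraph]; exact exists_mem_genGraph_ou hc hβ h1 y) (fun x hx => by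
      rw [hgraph] at hx
      have := mem_span_of_mem_genGraph_ou hc hβ hx
      rwa [show {k | eigval c k = 1} = ∅ from Set.eq_empty_of_forall_notMem fun k hk => h1 ⟨k, hk⟩,
        Set.image_empty, Submodule.span_empty, Submodule.mem_bot] at this)
  obtain ⟨R, hR⟩ := mem_resolventSet_iff.1 hres
  rw [hgraph] at hR
  refine le_antisymm hle ?_
  rintro ⟨x, y⟩ hxy
  -- The core argument: the resolvent R maps the span of the μ_k to itself, so the graph points over
  -- it lie in the closure. By density and continuity the same holds for all R w, and these exhaust
  -- the domain of the generator.
  have hspan : ∀ w ∈ Submodule.span ℂ (Set.range (muL (β := β) hc hβ.le)),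
      (R w, R w - w) ∈ (testGraph c β).topologicalClosure := by
    intro w hw
    induction hw using Submodule.span_induction with
    | mem w hw =>
      obtain ⟨k, rfl⟩ := hw
      have hne : 1 - eigval c k ≠ 0 := sub_ne_zero.2 fun h => h1 ⟨k, h.symm⟩
      have h2 : (1 - eigval c k)⁻¹ • (muL (β := β) hc hβ.le k, eigval c k • muL hc hβ.le k) =
          ((1 - eigval c k)⁻¹ • muL (β := β) hc hβ.le k,
            (1 - eigval c k)⁻¹ • muL hc hβ.le k - muL hc hβ.le k) := by
        refine Prod.ext rfl ?_
        rw [Prod.smul_snd, smul_smul, eq_sub_iff_add_eq]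
        nth_rw 2 [← one_smul ℂ (muL (β := β) hc hβ.le k)]
        rw [← add_smul]
        congr 1
        field_simp
        ring
      have h3 := Submodule.smul_mem _ (1 - eigval c k)⁻¹ (muL_mem_closure (β := β) hc hβ k)
      rw [h2] at h3
      have h4 : R (muL hc hβ.le k) = (1 - eigval c k)⁻¹ • muL (β := β) hc hβ.le k := by
        rw [hR, one_smul]
        exact hle h3
      rw [h4]
      exact h3
    | zero =>
      rw [map_zero, sub_zero]
      exact Submodule.zero_mem _
    | add w w' _ _ hw hw' =>
      rw [map_add, add_sub_add_comm]
      exact Submodule.add_mem _ hw hw'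
    | smul a w _ hw =>
      rw [map_smul, ← smul_sub]
      exact Submodule.smul_mem _ a hw
  have hall : ∀ w, (R w, R w - w) ∈ (testGraph c β).topologicalClosure := by
    intro w
    have hcl : IsClosed {w | (R w, R w - w) ∈ (testGraph c β).topologicalClosure} :=
      (Submodule.isClosed_topologicalClosure _).preimage (by fun_prop)
    have hw : w ∈ closure (Submodule.span ℂ (Set.range (muL (β := β) hc hβ.le)) : Set _) := by
      rw [← Submodule.topologicalClosure_coe, dense_span_muL hc hβ]
      trivial
    exact closure_minimal (fun w hw => hspan w hw) hcl hw
  have hRx : R (x - y) = x := by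
    rw [hR, one_smul, sub_sub_cancel]
    exact hxy
  have := hall (x - y)
  rwa [hRx, sub_sub_cancel] at this

lemma graph_fpOp [NeZero n] (hc : ∀ i, 0 < c i) (hβ : 0 < β) :
    (fpOp c β).graph = genGraph (ou hc hβ) := by
  rw [fpOp, topologicalClosure_testGraph hc hβ]
  refine Submodule.toLinearPMap_graph_eq _ fun p hp h0 => ?_
  obtain ⟨x, y⟩ := p
  obtain rfl : x = 0 := h0
  exact mem_genGraph_unique hp (genGraph (ou hc hβ)).zero_mem

end Cutoff

/-! ### The similarity transform -/

section Similarity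

variable {n : ℕ} {β : ℝ} {c : Fin n → ℝ}

lemma scaleC_toComplex (t : ℝ) (ξ : E n) : scaleC c t (toComplex ξ) =
    toComplex (WithLp.toLp 2 fun j => Real.exp (-(c j * t)) * ξ j) := by
  funext j
  simp [scaleC, toComplex]

/-- Here F(0) = 0 enters: it makes s⁻¹ F(s^C ξ) integrable at s = 0. Near 0 the bound is
differentiability, and elsewhere it is boundedness. -/
lemma exists_norm_le_mul_norm (hβ : 0 < β) {F : (Fin n → ℂ) → ℂ}
    (hF : AnalyticOnNhd ℂ F (tube n β)) {M : ℝ} (hM : ∀ z ∈ tube n β, ‖F z‖ ≤ M) (h0 : F 0 = 0) :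
    ∃ K, 0 ≤ K ∧ ∀ z ∈ tube n β, ‖F z‖ ≤ K * ‖z‖ := by
  have hmem : (0 : Fin n → ℂ) ∈ tube n β := by simp [tube, hβ]
  have hM0 : 0 ≤ M := (norm_nonneg _).trans (hM 0 hmem)
  have hO := (hF 0 hmem).differentiableAt.isBigO_sub
  simp only [h0, sub_zero] at hO
  obtain ⟨C, hC0, hC⟩ := hO.exists_nonneg
  obtain ⟨δ, hδ, hball⟩ := Metric.eventually_nhds_iff.1 hC.bound
  refine ⟨C + M / δ, by positivity, fun z hz => ?_⟩
  rcases lt_or_ge ‖z‖ δ with hzδ | hzδ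
  · refine (hball (by simpa using hzδ)).trans ?_
    gcongr
    exact le_add_of_nonneg_right (by positivity)
  · calc ‖F z‖ ≤ M := hM z hz
      _ = M / δ * δ := by field_simp
      _ ≤ (C + M / δ) * ‖z‖ := by
        gcongr
        exact le_add_of_nonneg_left hC0

/-- The function `log ψ̂` satisfies the transport equation along the flow `e^{-tC}`. -/
lemma hasDerivAt_logSymbol (hc : ∀ i, 0 < c i) (hβ : 0 < β) {F : (Fin n → ℂ) → ℂ}
    (hF : AnalyticOnNhd ℂ F (tube n β)) {M : ℝ} (hM : ∀ z ∈ tube n β, ‖F z‖ ≤ M) (h0 : F 0 = 0)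
    (ξ : E n) (t : ℝ) : HasDerivAt (fun s => logSymbol c F (scaleC c s (toComplex ξ)))
      (-F (scaleC c t (toComplex ξ))) t := by
  obtain ⟨K, hK0, hK⟩ := exists_norm_le_mul_norm hβ hF hM h0
  set w : ℝ → Fin n → ℂ := fun r i => ((r ^ c i : ℝ) : ℂ) * toComplex ξ i with hw
  have hwt : ∀ r, w r ∈ tube n β := fun r => by
    have : w r = toComplex (WithLp.toLp 2 fun i => r ^ c i * ξ i) := by
      funext i
      simp [hw, toComplex]
    rw [this]
    exact toComplex_mem_tube hβ _
  set f : ℝ → ℂ := fun r => ((r⁻¹ : ℝ) : ℂ) * F (w r) with hf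
  have hwc : ContinuousOn w (Set.Ioi 0) := by
    rw [continuousOn_pi]
    intro i
    refine ContinuousOn.mul (Complex.continuous_ofReal.comp_continuousOn ?_) continuousOn_const
    exact continuousOn_id.rpow_const fun r hr => Or.inl (ne_of_gt hr)
  have hfc : ContinuousOn f (Set.Ioi 0) :=
    ContinuousOn.mul (Complex.continuous_ofReal.comp_continuousOn
      (continuousOn_inv₀.mono fun r hr => ne_of_gt hr))
      (hF.continuousOn.comp hwc fun r _ => hwt r)
  have hfb : ∀ r, 0 < r → ‖f r‖ ≤ K * ∑ i, |ξ i| * r ^ (c i - 1) := fun r hr => by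
    have h1 : ‖w r‖ ≤ ∑ i, |ξ i| * r ^ c i := by
      have hnn : ∀ i ∈ Finset.univ, 0 ≤ |ξ i| * r ^ c i := fun i _ => by positivity
      refine (pi_norm_le_iff_of_nonneg (Finset.sum_nonneg hnn)).2 fun i => ?_
      rw [hw, norm_mul, Complex.norm_real, toComplex, Complex.norm_real,
        Real.norm_of_nonneg (by positivity), mul_comm, Real.norm_eq_abs]
      exact Finset.single_le_sum hnn (Finset.mem_univ i)
    rw [hf, norm_mul, Complex.norm_real, Real.norm_of_nonneg (by positivity)]
    calc r⁻¹ * ‖F (w r)‖ ≤ r⁻¹ * (K * ∑ i, |ξ i| * r ^ c i) := by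
          gcongr
          exact (hK _ (hwt r)).trans (mul_le_mul_of_nonneg_left h1 hK0)
      _ = K * ∑ i, |ξ i| * r ^ (c i - 1) := by
          rw [mul_left_comm, Finset.mul_sum]
          congr 1
          refine Finset.sum_congr rfl fun i _ => ?_
          rw [Real.rpow_sub_one hr.ne']
          field_simp
  -- The majorants r^{cᵢ - 1} are integrable at 0 since cᵢ > 0; thus the integral in `logSymbol` is
  -- a genuine one at real points.
  have hfi : ∀ b : ℝ, 0 < b → IntervalIntegrable f volume 0 b := fun b hb => by
    have hg : IntervalIntegrable (fun r : ℝ => K * ∑ i, |ξ i| * r ^ (c i - 1)) volume 0 b := by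
      refine IntervalIntegrable.const_mul ?_ K
      have := IntervalIntegrable.sum (μ := volume) (a := 0) (b := b) Finset.univ
        (f := fun i (r : ℝ) => |ξ i| * r ^ (c i - 1)) fun i _ =>
          (intervalIntegral.intervalIntegrable_rpow' (by linarith [hc i])).const_mul _
      simpa only [Finset.sum_fn] using this
    rw [intervalIntegrable_iff_integrableOn_Ioc_of_le hb.le] at hg ⊢
    refine Integrable.mono' hg ((hfc.mono fun r hr => hr.1).aestronglyMeasurable
      measurableSet_Ioc) ?_
    filter_upwards [ae_restrict_mem measurableSet_Ioc] with r hr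
    exact hfb r hr.1
  -- The measure dr/r is scale invariant, so the flow by time s only moves the upper limit from 1 to
  -- e^{-s}. The fundamental theorem of calculus finishes.
  have hlog : ∀ s : ℝ, logSymbol c F (scaleC c s (toComplex ξ)) =
      ∫ r in (0 : ℝ)..Real.exp (-s), f r := fun s => by
    have h1 := intervalIntegral.smul_integral_comp_mul_left (a := 0) (b := 1) f (Real.exp (-s))
    rw [mul_zero, mul_one] at h1
    rw [← h1, logSymbol, ← intervalIntegral.integral_smul]
    refine intervalIntegral.integral_congr fun r hr => ?_
    rw [Set.uIcc_of_le zero_le_one] at hr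
    have h2 : w (Real.exp (-s) * r) = fun i => ((r ^ c i : ℝ) : ℂ) *
        scaleC c s (toComplex ξ) i := by
      funext i
      simp only [hw, scaleC]
      rw [Real.mul_rpow (Real.exp_pos _).le hr.1, ← Real.exp_mul]
      push_cast
      ring_nf
    simp only [hf, h2]
    rw [mul_inv, Complex.real_smul]
    push_cast
    rw [← mul_assoc, ← mul_assoc, mul_inv_cancel₀ (Complex.exp_ne_zero _), one_mul]
  simp only [hlog]
  have hFTC := intervalIntegral.integral_hasDerivAt_right (hfi _ (Real.exp_pos (-t)))
    (hfc.stronglyMeasurableAtFilter isOpen_Ioi _ (Real.exp_pos (-t)))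
    (hfc.continuousAt (Ioi_mem_nhds (Real.exp_pos (-t))))
  have h3 := hFTC.scomp t (hasDerivAt_neg t).exp
  refine h3.congr_deriv ?_
  have h4 : w (Real.exp (-t)) = scaleC c t (toComplex ξ) := by
    funext i
    simp only [hw, scaleC]
    rw [← Real.exp_mul]
    ring_nf
  simp only [hf, h4, Complex.real_smul]
  have := Real.exp_ne_zero (-t)
  rw [← mul_assoc, ← Complex.ofReal_mul]
  field_simp
  simp

/-- A multiplier `e^ℓ` conjugates the generator into its perturbation by the derivative of `ℓ`
along the flow. -/
lemma mem_genGraph_of_multiplier [NeZero n] (hc : ∀ i, 0 < c i) (hβ : 0 < β)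
    {ℓ F : (Fin n → ℂ) → ℂ}
    (hℓ : ∀ (ξ : E n) (t : ℝ), HasDerivAt (fun s => ℓ (scaleC c s (toComplex ξ)))
      (-F (scaleC c t (toComplex ξ))) t) {A B : WL2 n β →L[ℂ] WL2 n β}
    (hA : ∀ f (ξ : E n), FL (A f) (toComplex ξ) = Complex.exp (ℓ (toComplex ξ)) *
      FL f (toComplex ξ))
    (hB : ∀ f (ξ : E n), FL (B f) (toComplex ξ) = F (toComplex ξ) * FL f (toComplex ξ))
    {f g : WL2 n β} (h : (f, g) ∈ genGraph (ou hc hβ)) :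
    (A f, A g - B (A f)) ∈ genGraph (ou hc hβ) := by
  have hT := isRealSemigroup_ou (β := β) hc hβ
  refine mem_genGraph_of_hasDerivWithinAt_FL hc hβ fun ξ t ht => ?_
  have hξ := toComplex_mem_tube hβ ξ
  -- Commuting the multiplier past the semigroup moves its symbol along the flow. The product rule
  -- then produces the -F term, which is the contribution of B.
  have hAT : ∀ s, 0 ≤ s → ∀ u, FL (ou hc hβ s (A u)) (toComplex ξ) =
      Complex.exp (ℓ (scaleC c s (toComplex ξ))) * FL (ou hc hβ s u) (toComplex ξ) :=
    fun s hs u => by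
      rw [FL_ou hc hβ hs _ hξ, FL_ou hc hβ hs _ hξ, scaleC_toComplex, hA]
      ring
  have hBT : ∀ u, FL (ou hc hβ t (B u)) (toComplex ξ) =
      F (scaleC c t (toComplex ξ)) * FL (ou hc hβ t u) (toComplex ξ) := fun u => by
    rw [FL_ou hc hβ ht _ hξ, FL_ou hc hβ ht _ hξ, scaleC_toComplex, hB]
    ring
  have h1 : HasDerivWithinAt (fun s => FL (ou hc hβ s f) (toComplex ξ))
      (FL (ou hc hβ t g) (toComplex ξ)) (Set.Ici t) t := by
    have := ((FLc β _ hξ).restrictScalars ℝ).hasFDerivAt.comp_hasDerivWithinAt t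
      (hT.hasDerivWithinAt h ht)
    simpa [Function.comp_def] using this
  have h2 := (hℓ ξ t).cexp.hasDerivWithinAt (s := Set.Ici t) |>.fun_mul h1
  refine (h2.congr_of_mem (fun s hs => hAT s (ht.trans hs) f) Set.self_mem_Ici).congr_deriv ?_
  have h3 : FL (ou hc hβ t (A g - B (A f))) (toComplex ξ) =
      FL (ou hc hβ t (A g)) (toComplex ξ) - FL (ou hc hβ t (B (A f))) (toComplex ξ) := by
    rw [← FLc_apply hξ, map_sub, map_sub, FLc_apply, FLc_apply]
  rw [h3, hBT, hAT t ht, hAT t ht]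
  ring

lemma mem_graph_perturbedOp_iff {Θ : WL2 n β →L[ℂ] WL2 n β} {x y : WL2 n β} :
    (x, y) ∈ (perturbedOp c β Θ).graph ↔ (x, y - Θ x) ∈ (fpOp c β).graph := by
  simp only [LinearPMap.mem_graph_iff, perturbedOp]
  constructor
  · rintro ⟨u, hu, hv⟩
    refine ⟨⟨u.1, u.2⟩, hu, ?_⟩
    have hu : (u : WL2 n β) = x := hu
    rw [LinearPMap.vadd_apply] at hv
    have hv : Θ (u : WL2 n β) + fpOp c β u = y := hv
    rw [← hv, ← hu, add_sub_cancel_left]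
    rfl
  · rintro ⟨u, hu, hv⟩
    refine ⟨⟨u.1, u.2⟩, hu, ?_⟩
    have hu : (u : WL2 n β) = x := hu
    have hv : fpOp c β u = y - Θ x := hv
    rw [LinearPMap.vadd_apply]
    change Θ (u : WL2 n β) + fpOp c β u = y
    rw [hv, hu, add_sub_cancel]

end Similarity

/-! ### Convolution with tempered distributions -/

section Convolution

variable {n : ℕ} {β : ℝ}

/-- The inverse of `schwartzFourier`. -/
def schwartzFourierInv (n : ℕ) : 𝓢(E n, ℂ) →L[ℂ] 𝓢(E n, ℂ) :=
  ((FourierTransform.fourierCLE ℂ 𝓢(E n, ℂ)).symm : 𝓢(E n, ℂ) →L[ℂ] 𝓢(E n, ℂ)).comp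
    (SchwartzMap.compCLMOfContinuousLinearEquiv ℂ (dilation n).symm)

lemma schwartzFourier_schwartzFourierInv (φ : 𝓢(E n, ℂ)) :
    schwartzFourier n (schwartzFourierInv n φ) = φ := by
  ext x
  have h : schwartzFourier n (schwartzFourierInv n φ) x =
      (𝓕 (𝓕⁻ (SchwartzMap.compCLMOfContinuousLinearEquiv ℂ (dilation n).symm φ)) : 𝓢(E n, ℂ))
        (dilation n x) := rfl
  rw [h, FourierTransform.fourier_fourierInv_eq,
    SchwartzMap.compCLMOfContinuousLinearEquiv_apply]
  simp

lemma schwartzFourierInv_schwartzFourier (φ : 𝓢(E n, ℂ)) :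
    schwartzFourierInv n (schwartzFourier n φ) = φ := by
  have h : schwartzFourierInv n (schwartzFourier n φ) =
      𝓕⁻ (SchwartzMap.compCLMOfContinuousLinearEquiv ℂ (dilation n).symm
        (SchwartzMap.compCLMOfContinuousLinearEquiv ℂ (dilation n) (𝓕 φ))) := rfl
  have h2 : SchwartzMap.compCLMOfContinuousLinearEquiv ℂ (dilation n).symm
      (SchwartzMap.compCLMOfContinuousLinearEquiv ℂ (dilation n) (𝓕 φ)) = 𝓕 φ := by
    ext x
    simp [SchwartzMap.compCLMOfContinuousLinearEquiv_apply]
  rw [h, h2, FourierTransform.fourierInv_fourier_eq]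

/-- A bounded measurable function is the Fourier transform of a tempered distribution. -/
lemma exists_hasFourier {m : E n → ℂ} (hm : AEStronglyMeasurable m) {M : ℝ}
    (hM : ∀ ξ, ‖m ξ‖ ≤ M) : ∃ ψ : 𝓢'(E n, ℂ), HasFourier ψ m := by
  have hmem : MemLp m ⊤ (volume : Measure (E n)) :=
    memLp_top_of_bound hm M (Eventually.of_forall hM)
  refine ⟨PointwiseConvergenceCLM.precomp ℂ (schwartzFourierInv n)
    (Lp.toTemperedDistribution hmem.toLp), fun φ => ?_⟩
  rw [PointwiseConvergenceCLM.precomp_apply]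
  change Lp.toTemperedDistribution hmem.toLp (schwartzFourierInv n (schwartzFourier n φ)) = _
  rw [schwartzFourierInv_schwartzFourier, Lp.toTemperedDistribution_apply]
  refine integral_congr_ae ?_
  filter_upwards [hmem.coeFn_toLp] with ξ hξ
  rw [hξ, smul_eq_mul, mul_comm]

lemma integrable_norm_pow_mul [NeZero n] (hβ : 0 < β) (f : WL2 n β) (k : ℕ) :
    Integrable fun x => ‖x‖ ^ k * ‖f x‖ := by
  obtain ⟨C, hC0, hC⟩ := exists_pow_le_exp (δ := β / 4) (by positivity) k
  have h := (integrable_mul_of_le (r := β / 4) (by linarith) f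
    (e := fun x => ((‖x‖ ^ k : ℝ) : ℂ)) (by fun_prop) (C := n ^ k * C) fun x => by
      rw [Complex.norm_real, Real.norm_of_nonneg (by positivity), mul_assoc]
      refine (pow_le_pow_left₀ (norm_nonneg _) (norm_le_supn x) k).trans ?_
      rw [mul_pow]
      exact mul_le_mul_of_nonneg_left (hC _ (supn_nonneg x)) (by positivity)).norm
  refine h.congr (Eventually.of_forall fun x => ?_)
  simp only [norm_mul, Complex.norm_real]
  rw [Real.norm_of_nonneg (by positivity), mul_comm]

/-- All moments of |f| are finite, so every derivative of the transform is bounded. Multiplication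
by it therefore preserves Schwartz functions. -/
lemma hasTemperateGrowth_fourier [NeZero n] (hβ : 0 < β) (f : WL2 n β) :
    Function.HasTemperateGrowth (𝓕 (f : E n → ℂ)) := by
  have hi : ∀ k : ℕ, (k : ℕ∞) ≤ ⊤ → Integrable fun x => ‖x‖ ^ k * ‖f x‖ := fun k _ =>
    integrable_norm_pow_mul hβ f k
  refine ⟨Real.contDiff_fourier hi, fun k => ⟨0, ∫ x : E n, (2 * Real.pi *
    ‖innerSL ℝ (E := E n)‖) ^ k * (‖x‖ ^ k * ‖f x‖), fun ξ => ?_⟩⟩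
  rw [Real.iteratedFDeriv_fourier hi (aestronglyMeasurable_volume f) le_top, pow_zero, mul_one]
  refine (VectorFourier.norm_fourierIntegral_le_integral_norm _ _ _ _ _).trans ?_
  refine integral_mono_of_nonneg (Eventually.of_forall fun x => norm_nonneg _)
    ((hi k le_top).const_mul _) (Eventually.of_forall fun x => ?_)
  simp only
  rw [← mul_assoc]
  exact VectorFourier.norm_fourierPowSMulRight_le _ _ _ _

lemma fourier_eq_FL (f : E n → ℂ) (ξ : E n) :
    𝓕 f ((2 * Real.pi)⁻¹ • ξ) = FL f (toComplex ξ) := by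
  rw [Real.fourier_eq', FL]
  refine integral_congr_ae (Eventually.of_forall fun x => ?_)
  simp only [smul_eq_mul, expKer]
  rw [mul_comm]
  congr 2
  rw [inner_smul_right, PiLp.inner_apply]
  have : ∑ i, inner ℝ (x i) (ξ i) = ∑ i, x i * ξ i :=
    Finset.sum_congr rfl fun i _ => by simp [mul_comm]
  rw [this]
  have hpi : (Real.pi : ℂ) ≠ 0 := by exact_mod_cast Real.pi_ne_zero
  simp only [toComplex]
  push_cast
  field_simp

lemma expKer_toComplex (x ξ : E n) :
    expKer (toComplex ξ) x = Complex.exp (-Complex.I * ((∑ i, x i * ξ i : ℝ) : ℂ)) := by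
  simp [expKer, toComplex]

lemma expKer_symm (x ξ : E n) : expKer (toComplex ξ) x = expKer (toComplex x) ξ := by
  simp only [expKer_toComplex, mul_comm]

lemma schwartzFourier_eq_FL (φ : 𝓢(E n, ℂ)) (ξ : E n) :
    schwartzFourier n φ ξ = FL φ (toComplex ξ) := by
  simp only [schwartzFourier_apply, FL, expKer_toComplex]

lemma norm_expKer_toComplex (x ξ : E n) : ‖expKer (toComplex ξ) x‖ = 1 := by
  rw [norm_expKer]
  simp [toComplex]

/-- Fubini's theorem, since the kernel is unimodular on real points and symmetric in the two
variables. -/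
lemma integral_mul_FL {f g : E n → ℂ} (hf : Integrable f) (hg : Integrable g) :
    ∫ x, f x * FL g (toComplex x) = ∫ ξ, g ξ * FL f (toComplex ξ) := by
  have hint : Integrable (Function.uncurry fun x ξ : E n => f x * (g ξ * expKer (toComplex x) ξ))
      (volume.prod volume) := by
    have h := (hf.mul_prod hg).bdd_mul (c := 1) (f := fun p : E n × E n => expKer (toComplex p.1) p.2)
      (Continuous.aestronglyMeasurable (by
        unfold expKer toComplex
        fun_prop)) (Eventually.of_forall fun p => (norm_expKer_toComplex _ _).le)
    refine h.congr (Eventually.of_forall fun p => ?_)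
    simp only [Function.uncurry]
    ring
  simp only [FL, ← integral_const_mul]
  rw [integral_integral_swap hint]
  refine integral_congr_ae (Eventually.of_forall fun ξ => integral_congr_ae
    (Eventually.of_forall fun x => ?_))
  simp only
  rw [expKer_symm]
  ring

/-- A Fourier multiplier is convolution with the tempered distribution whose Fourier transform is
the multiplier. -/
lemma isConvolution_of_FL_eq [NeZero n] (hβ : 0 < β) {T : 𝓢'(E n, ℂ)} {m : E n → ℂ}
    (hT : HasFourier T m) {f h : WL2 n β}
    (hh : ∀ ξ : E n, FL h (toComplex ξ) = m ξ * FL f (toComplex ξ)) : IsConvolution T f h := by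
  intro φ
  have hint : ∀ u : WL2 n β, Integrable u := fun u => by
    have := integrable_norm_pow_mul hβ u 0
    simp only [pow_zero, one_mul] at this
    exact (integrable_norm_iff (aestronglyMeasurable_volume u)).1 this
  set η := schwartzFourierInv n φ with hη
  have hη1 : Integrable (η : E n → ℂ) (volume : Measure (E n)) := η.integrable
  have hφ : schwartzFourier n η = φ := schwartzFourier_schwartzFourierInv φ
  -- With η the inverse transform of φ, the product χ = η f̂ is Schwartz and its transform is the
  -- function g in the definition of convolution. The dilations pass between the two normalisations
  -- of the transform.
  set χ : 𝓢(E n, ℂ) := SchwartzMap.compCLMOfContinuousLinearEquiv ℂ (dilation n)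
    (SchwartzMap.smulLeftCLM ℂ (𝓕 (f : E n → ℂ))
      (SchwartzMap.compCLMOfContinuousLinearEquiv ℂ (dilation n).symm η)) with hχ
  have hχa : ∀ ξ, χ ξ = η ξ * FL f (toComplex ξ) := fun ξ => by
    rw [hχ, SchwartzMap.compCLMOfContinuousLinearEquiv_apply, Function.comp_apply,
      SchwartzMap.smulLeftCLM_apply_apply (hasTemperateGrowth_fourier hβ f),
      SchwartzMap.compCLMOfContinuousLinearEquiv_apply, Function.comp_apply,
      ContinuousLinearEquiv.symm_apply_apply, smul_eq_mul, mul_comm, ← fourier_eq_FL]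
    rfl
  refine ⟨schwartzFourier n χ, fun x => ?_, ?_⟩
  · have h1 : ∀ y, φ (x + y) = FL (fun ξ => η ξ * expKer (toComplex x) ξ) (toComplex y) :=
      fun y => by
        rw [← hφ, schwartzFourier_eq_FL, FL, FL]
        refine integral_congr_ae (Eventually.of_forall fun ξ => ?_)
        simp only
        rw [mul_assoc]
        congr 1
        simp only [expKer]
        rw [← Complex.exp_add]
        congr 1
        rw [← mul_add, ← Finset.sum_add_distrib]
        congr 1
        refine Finset.sum_congr rfl fun i _ => ?_
        simp [toComplex]
        ring
    have hηi : Integrable fun ξ => η ξ * expKer (toComplex x) ξ := by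
      have := hη1.bdd_mul (c := 1) (continuous_expKer (toComplex x)).aestronglyMeasurable
        (Eventually.of_forall fun ξ => (norm_expKer_toComplex _ _).le)
      refine this.congr (Eventually.of_forall fun ξ => ?_)
      simp only
      ring
    simp only [h1]
    rw [integral_mul_FL (hint f) hηi, schwartzFourier_eq_FL, FL]
    refine integral_congr_ae (Eventually.of_forall fun ξ => ?_)
    simp only [hχa]
    ring
  · have h2 : ∀ x, φ x = FL η (toComplex x) := fun x => by rw [← schwartzFourier_eq_FL, hφ]
    rw [hT χ]
    simp only [h2]
    rw [integral_mul_FL (hint h) hη1]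
    refine integral_congr_ae (Eventually.of_forall fun ξ => ?_)
    simp only [hχa, hh]
    ring

end Convolution

/-! ### Similarity and restriction -/

section Similarity

variable {X : Type*} [NormedAddCommGroup X] [NormedSpace ℂ X]

lemma map_coe_nhdsGT_zero : Filter.map ((↑) : ℝ≥0 → ℝ) (𝓝[>] 0) = 𝓝[>] 0 := by
  rw [NNReal.isEmbedding_coe.map_nhdsWithin_eq]
  congr 1
  ext x
  simp only [Set.mem_image, Set.mem_Ioi]
  exact ⟨fun ⟨t, ht, h⟩ => h ▸ NNReal.coe_pos.2 ht, fun h => ⟨⟨x, h.le⟩, h, rfl⟩⟩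

lemma mem_genGraph_iff_tendsto {T : ℝ → X →L[ℂ] X} (h0 : ∀ x, T 0 x = x) {x y : X} :
    (x, y) ∈ genGraph T ↔ Tendsto (fun t : ℝ≥0 => (((t : ℝ)⁻¹ : ℝ) : ℂ) • (T t x - x))
      (𝓝[>] 0) (𝓝 y) := by
  have h : (fun t : ℝ≥0 => (((t : ℝ)⁻¹ : ℝ) : ℂ) • (T t x - x)) =
      (fun t : ℝ => slope (fun t => T t x) 0 t) ∘ ((↑) : ℝ≥0 → ℝ) := by
    funext t
    simp only [Function.comp, slope_def_module, sub_zero, h0, Complex.coe_smul]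
  rw [mem_genGraph, h, ← tendsto_map'_iff, map_coe_nhdsGT_zero, ← hasDerivWithinAt_Ioi_iff_Ici,
    hasDerivWithinAt_iff_tendsto_slope' (by simp)]

/-- The semigroup `Ψ T(t) Ψ⁻¹`. -/
def conjSemigroup (Ψ : X ≃L[ℂ] X) (T : ℝ → X →L[ℂ] X) (t : ℝ≥0) : X →L[ℂ] X :=
  (Ψ : X →L[ℂ] X).comp ((T t).comp (Ψ.symm : X →L[ℂ] X))

lemma conjSemigroup_apply (Ψ : X ≃L[ℂ] X) (T : ℝ → X →L[ℂ] X) (t : ℝ≥0) (x : X) :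
    conjSemigroup Ψ T t x = Ψ (T t (Ψ.symm x)) := rfl

lemma IsRealSemigroup.isC0Semigroup_conj {T : ℝ → X →L[ℂ] X} (hT : IsRealSemigroup T)
    (Ψ : X ≃L[ℂ] X) : IsC0Semigroup (conjSemigroup Ψ T) where
  zero := by
    ext x
    simp [conjSemigroup_apply, hT.zero]
  add s t := by
    ext x
    simp [conjSemigroup_apply, hT.add s t s.2 t.2]
  continuous x := by
    have h1 : ContinuousOn (fun t => T t (Ψ.symm x)) (Set.Ici 0) := hT.cont _
    have h2 : Continuous fun t : ℝ≥0 => T t (Ψ.symm x) :=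
      h1.comp_continuous NNReal.continuous_coe fun t => t.2
    have h3 : Tendsto (fun t : ℝ≥0 => Ψ (T t (Ψ.symm x))) (𝓝 0) _ :=
      (Ψ.continuous.comp h2).tendsto 0
    simpa [hT.zero, conjSemigroup_apply] using h3

lemma isGenerator_conj {A : X →ₗ.[ℂ] X} {T : ℝ → X →L[ℂ] X} (hT : IsRealSemigroup T)
    {Ψ : X ≃L[ℂ] X} (h : ∀ x y, (x, y) ∈ genGraph T ↔ (Ψ x, Ψ y) ∈ A.graph) :
    IsGenerator A (conjSemigroup Ψ T) := by
  intro x y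
  have h1 := h (Ψ.symm x) (Ψ.symm y)
  rw [Ψ.apply_symm_apply, Ψ.apply_symm_apply] at h1
  rw [← h1, mem_genGraph_iff_tendsto hT.zero]
  have h2 : (fun t : ℝ≥0 => (((t : ℝ)⁻¹ : ℝ) : ℂ) • (conjSemigroup Ψ T t x - x)) =
      Ψ ∘ fun t : ℝ≥0 => (((t : ℝ)⁻¹ : ℝ) : ℂ) • (T t (Ψ.symm x) - Ψ.symm x) := by
    funext t
    simp only [Function.comp, map_smul, map_sub, Ψ.apply_symm_apply, conjSemigroup_apply]
  have h3 : 𝓝 y = 𝓝 (Ψ (Ψ.symm y)) := by rw [Ψ.apply_symm_apply]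
  rw [h2, h3]
  exact Ψ.toHomeomorph.isInducing.tendsto_nhds_iff

lemma resolventSet_subset_of_similar {A B : X →ₗ.[ℂ] X} (Ψ : X ≃L[ℂ] X)
    (h : ∀ x y, (x, y) ∈ A.graph ↔ (Ψ x, Ψ y) ∈ B.graph) : resolventSet A ⊆ resolventSet B := by
  intro z hz
  obtain ⟨R, hR⟩ := mem_resolventSet_iff.1 hz
  refine mem_resolventSet_iff.2
    ⟨(Ψ : X →L[ℂ] X).comp (R.comp (Ψ.symm : X →L[ℂ] X)), fun x y => ?_⟩
  have h1 := h (Ψ.symm x) (z • Ψ.symm x - Ψ.symm y)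
  rw [map_sub, map_smul, Ψ.apply_symm_apply, Ψ.apply_symm_apply] at h1
  rw [← h1, ← hR]
  exact (Ψ.symm_apply_eq.trans eq_comm).symm.trans eq_comm

lemma spectrum_eq_of_similar {A B : X →ₗ.[ℂ] X} (Ψ : X ≃L[ℂ] X)
    (h : ∀ x y, (x, y) ∈ A.graph ↔ (Ψ x, Ψ y) ∈ B.graph) : spectrum B = spectrum A := by
  rw [spectrum, spectrum, Set.Subset.antisymm (resolventSet_subset_of_similar Ψ.symm fun x y => by
    rw [h, Ψ.apply_symm_apply, Ψ.apply_symm_apply]) (resolventSet_subset_of_similar Ψ h)]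

lemma eigenspace_eq_map_of_similar {A B : X →ₗ.[ℂ] X} (Ψ : X ≃L[ℂ] X)
    (h : ∀ x y, (x, y) ∈ A.graph ↔ (Ψ x, Ψ y) ∈ B.graph) (z : ℂ) :
    eigenspace B z = (eigenspace A z).map (Ψ : X →ₗ[ℂ] X) := by
  ext x
  rw [Submodule.mem_map]
  constructor
  · intro hx
    refine ⟨Ψ.symm x, ?_, Ψ.apply_symm_apply x⟩
    rw [mem_eigenspace_iff, h, map_smul, Ψ.apply_symm_apply]
    exact hx
  · rintro ⟨y, hy, rfl⟩
    rw [mem_eigenspace_iff, h, map_smul] at hy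
    exact hy

lemma mem_graph_part_iff {A : X →ₗ.[ℂ] X} {Y : Submodule ℂ X} {x y : Y} :
    (x, y) ∈ (part A Y).graph ↔ ((x : X), (y : X)) ∈ A.graph := by
  simp only [LinearPMap.mem_graph_iff]
  constructor
  · rintro ⟨u, rfl, rfl⟩
    exact ⟨⟨u.1, u.2.choose⟩, rfl, rfl⟩
  · rintro ⟨u, hu, hv⟩
    have hx : (x : X) ∈ A.domain := hu ▸ u.2
    have hux : u = ⟨x, hx⟩ := Subtype.ext hu
    rw [hux] at hv
    exact ⟨⟨x, hx, hv ▸ y.2⟩, rfl, Subtype.ext hv⟩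

/-- The restriction of a family of operators to an invariant subspace. -/
def restrictSemigroup (T : ℝ≥0 → X →L[ℂ] X) {Y : Submodule ℂ X} (h : ∀ t, ∀ x ∈ Y, T t x ∈ Y)
    (t : ℝ≥0) : Y →L[ℂ] Y :=
  ((T t).comp Y.subtypeL).codRestrict Y fun x => h t x x.2

lemma coe_restrictSemigroup (T : ℝ≥0 → X →L[ℂ] X) {Y : Submodule ℂ X}
    (h : ∀ t, ∀ x ∈ Y, T t x ∈ Y) (t : ℝ≥0) (x : Y) :
    (restrictSemigroup T h t x : X) = T t x := rfl

lemma IsC0Semigroup.restrict {T : ℝ≥0 → X →L[ℂ] X} (hT : IsC0Semigroup T) {Y : Submodule ℂ X}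
    (h : ∀ t, ∀ x ∈ Y, T t x ∈ Y) : IsC0Semigroup (restrictSemigroup T h) where
  zero := by
    ext x
    simp [coe_restrictSemigroup, hT.zero]
  add s t := by
    ext x
    simp [coe_restrictSemigroup, hT.add]
  continuous x := tendsto_subtype_rng.2 (hT.continuous x)

lemma IsGenerator.part {A : X →ₗ.[ℂ] X} {T : ℝ≥0 → X →L[ℂ] X} (hA : IsGenerator A T)
    {Y : Submodule ℂ X} (h : ∀ t, ∀ x ∈ Y, T t x ∈ Y) :
    IsGenerator (part A Y) (restrictSemigroup T h) := by
  intro x y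
  rw [mem_graph_part_iff, hA, tendsto_subtype_rng]
  rfl

end Similarity

/-! ### The perturbed Fokker-Planck operator -/

section Perturbed

variable {n : ℕ} {β : ℝ} {c : Fin n → ℝ}

lemma zero_mem_tube (hβ : 0 < β) : (0 : Fin n → ℂ) ∈ tube n β := by
  simpa [tube] using hβ

lemma spectrum_fpOp [NeZero n] (hc : ∀ i, 0 < c i) (hβ : 0 < β) :
    spectrum (fpOp c β) = Set.range (eigval c) := by
  refine Set.Subset.antisymm (fun z hz => ?_) ?_
  · by_contra hn
    refine hz (mem_resolventSet_of_bijective ?_ (fun y => ?_) fun x hx => ?_)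
    · rw [graph_fpOp hc hβ]
      exact (isRealSemigroup_ou hc hβ).isClosed_genGraph
    · rw [graph_fpOp hc hβ]
      exact exists_mem_genGraph_ou hc hβ hn y
    · rw [graph_fpOp hc hβ] at hx
      have h := mem_span_of_mem_genGraph_ou hc hβ hx
      have he : {k | eigval c k = z} = ∅ :=
        Set.eq_empty_of_forall_notMem fun k hk => hn ⟨k, hk⟩
      simpa [he] using h
  · rintro _ ⟨k, rfl⟩
    refine mem_spectrum_of_eigenvector (muL_ne_zero hc hβ k) ?_
    rw [graph_fpOp hc hβ]
    exact muL_mem_genGraph hc hβ k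

lemma eigenspace_fpOp [NeZero n] (hc : ∀ i, 0 < c i) (hβ : 0 < β) (z : ℂ) :
    eigenspace (fpOp c β) z =
      Submodule.span ℂ (muL (β := β) hc hβ.le '' {k | eigval c k = z}) := by
  refine le_antisymm (fun x hx => ?_) (Submodule.span_le.2 ?_)
  · rw [mem_eigenspace_iff, graph_fpOp hc hβ] at hx
    exact mem_span_of_mem_genGraph_ou hc hβ hx
  · rintro _ ⟨k, rfl, rfl⟩
    rw [SetLike.mem_coe, mem_eigenspace_iff, graph_fpOp hc hβ]
    exact muL_mem_genGraph hc hβ k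

/-- The Fourier multipliers with symbols `exp ℓ` and `exp (-ℓ)` are inverse to each other. -/
lemma exists_equiv_of_exp [NeZero n] (hβ : 0 < β) {ℓ : (Fin n → ℂ) → ℂ}
    (hℓ : AnalyticOnNhd ℂ ℓ (tube n β)) {M : ℝ} (hM : ∀ z ∈ tube n β, |(ℓ z).re| ≤ M) :
    ∃ Ψ : WL2 n β ≃L[ℂ] WL2 n β,
      (∀ f (ξ : E n), FL (Ψ f) (toComplex ξ) = Complex.exp (ℓ (toComplex ξ)) *
        FL f (toComplex ξ)) ∧
      ∀ f (ξ : E n), FL (Ψ.symm f) (toComplex ξ) = Complex.exp (-ℓ (toComplex ξ)) *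
        FL f (toComplex ξ) := by
  obtain ⟨A, hA⟩ := exists_multiplier hβ (m := fun z => Complex.exp (ℓ z)) hℓ.cexp
    (M := Real.exp M) fun z hz => by
      rw [Complex.norm_exp]
      exact Real.exp_le_exp.2 (abs_le.1 (hM z hz)).2
  obtain ⟨B, hB⟩ := exists_multiplier hβ (m := fun z => Complex.exp (-ℓ z)) hℓ.neg.cexp
    (M := Real.exp M) fun z hz => by
      rw [Complex.norm_exp, Complex.neg_re]
      exact Real.exp_le_exp.2 (neg_le.1 (abs_le.1 (hM z hz)).1)
  refine ⟨ContinuousLinearEquiv.equivOfInverse A B (fun f => ?_) fun f => ?_, hA, hB⟩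
  · refine ext_FL hβ fun ξ => ?_
    rw [hB, hA, ← mul_assoc, ← Complex.exp_add, neg_add_cancel, Complex.exp_zero, one_mul]
  · refine ext_FL hβ fun ξ => ?_
    rw [hA, hB, ← mul_assoc, ← Complex.exp_add, add_neg_cancel, Complex.exp_zero, one_mul]

/-- A pair of multipliers with symbols `exp ℓ` and `F`, where `F` is minus the derivative of `ℓ`
along the flow, conjugates the unperturbed operator into the perturbed one. -/
lemma mem_graph_perturbedOp_iff_of_multiplier [NeZero n] (hc : ∀ i, 0 < c i) (hβ : 0 < β)
    {ℓ F : (Fin n → ℂ) → ℂ}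
    (hℓ : ∀ (ξ : E n) (t : ℝ), HasDerivAt (fun s => ℓ (scaleC c s (toComplex ξ)))
      (-F (scaleC c t (toComplex ξ))) t)
    {Ψ : WL2 n β ≃L[ℂ] WL2 n β} {Θ : WL2 n β →L[ℂ] WL2 n β}
    (hΨ : ∀ f (ξ : E n), FL (Ψ f) (toComplex ξ) = Complex.exp (ℓ (toComplex ξ)) *
      FL f (toComplex ξ))
    (hΨ' : ∀ f (ξ : E n), FL (Ψ.symm f) (toComplex ξ) = Complex.exp (-ℓ (toComplex ξ)) *
      FL f (toComplex ξ))
    (hΘ : ∀ f (ξ : E n), FL (Θ f) (toComplex ξ) = F (toComplex ξ) * FL f (toComplex ξ))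
    (f g : WL2 n β) :
    (f, g) ∈ (fpOp c β).graph ↔ (Ψ f, Ψ g) ∈ (perturbedOp c β Θ).graph := by
  rw [mem_graph_perturbedOp_iff, graph_fpOp hc hβ]
  refine ⟨fun h => mem_genGraph_of_multiplier hc hβ hℓ (A := (Ψ : WL2 n β →L[ℂ] WL2 n β)) hΨ hΘ h,
    fun h => ?_⟩
  have hneg : ∀ u (ξ : E n), FL ((-Θ) u) (toComplex ξ) =
      -F (toComplex ξ) * FL u (toComplex ξ) := fun u ξ => by
    rw [neg_apply, ← FLc_apply (toComplex_mem_tube hβ ξ), map_neg,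
      FLc_apply, hΘ, neg_mul]
  -- The converse is the same transport identity for -ℓ, -F and Ψ⁻¹; the two perturbation terms then
  -- cancel because multipliers commute.
  have h1 := mem_genGraph_of_multiplier hc hβ (ℓ := fun z => -ℓ z) (F := fun z => -F z)
    (fun ξ t => (hℓ ξ t).fun_neg) (A := (Ψ.symm : WL2 n β →L[ℂ] WL2 n β)) hΨ' hneg h
  have h2 : Ψ.symm (Θ (Ψ f)) = Θ f := ext_FL hβ fun ξ => by
    rw [hΨ', hΘ, hΘ, hΨ, mul_left_comm, ← mul_assoc (Complex.exp _), ← Complex.exp_add,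
      neg_add_cancel, Complex.exp_zero, one_mul]
  have h3 : (Ψ.symm : WL2 n β →L[ℂ] WL2 n β) (Ψ g - Θ (Ψ f)) -
      (-Θ) ((Ψ.symm : WL2 n β →L[ℂ] WL2 n β) (Ψ f)) = g := by
    change Ψ.symm (Ψ g - Θ (Ψ f)) - (-Θ) (Ψ.symm (Ψ f)) = g
    rw [map_sub, h2, neg_apply, Ψ.symm_apply_apply, Ψ.symm_apply_apply]
    abel
  rw [h3] at h1
  simpa using h1

lemma mapsInto_perturbedOp [NeZero n] (hc : ∀ i, 0 < c i) (hβ : 0 < β)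
    {Θ : WL2 n β →L[ℂ] WL2 n β} {k : ℕ}
    (hΘ : ∀ f ∈ momentSpace n β k, Θ f ∈ momentSpace n β k) :
    MapsInto (perturbedOp c β Θ) (momentSpace n β k) := by
  intro x hx
  have h := (perturbedOp c β Θ).mem_graph x
  rw [mem_graph_perturbedOp_iff, graph_fpOp hc hβ] at h
  have h1 := mem_momentSpace_of_mem_genGraph hc hβ h hx
  simpa using (momentSpace n β k).add_mem h1 (hΘ _ hx)

end Perturbed

end FokkerPlanck

end

/-! ### The main theorem -/

theorem theorem4 {n : ℕ} [NeZero n] (c : Fin n → ℝ) (hc : ∀ i, 0 < c i) (hmono : Monotone c)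
    (β : ℝ) (hβ : 0 < β) (θ : 𝓢'(FokkerPlanck.E n, ℂ)) (F : (Fin n → ℂ) → ℂ)
    (hθ : FokkerPlanck.KernelCondition c β θ F) :
    -- `L` on test functions is closable, so that `fpOp c β` is its closure
    (FokkerPlanck.fpOp c β).graph = (FokkerPlanck.testGraph c β).topologicalClosure ∧
    -- the convolution operators `Θ = θ * ·` and `Ψ = ψ * ·`, and the functions `μ_k` in `L²(ω)`
    ∃ (Θ : FokkerPlanck.WL2 n β →L[ℂ] FokkerPlanck.WL2 n β)
      (ψ : 𝓢'(FokkerPlanck.E n, ℂ))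
      (Ψ : FokkerPlanck.WL2 n β ≃L[ℂ] FokkerPlanck.WL2 n β)
      (μ : (Fin n → ℕ) → FokkerPlanck.WL2 n β),
      (∀ f : FokkerPlanck.WL2 n β, FokkerPlanck.IsConvolution θ f (Θ f)) ∧
      FokkerPlanck.HasFourier ψ
        (fun ξ => FokkerPlanck.psiSymbol c F (FokkerPlanck.toComplex ξ)) ∧
      (∀ f : FokkerPlanck.WL2 n β, FokkerPlanck.IsConvolution ψ f (Ψ f)) ∧
      (∀ k, μ k =ᵐ[volume] FokkerPlanck.mu c k) ∧
      -- `Ψ` is a similarity between `𝓛` and `𝓛 + Θ`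
      (∀ f g, (f, g) ∈ (FokkerPlanck.fpOp c β).graph ↔
        (Ψ f, Ψ g) ∈ (FokkerPlanck.perturbedOp c β Θ).graph) ∧
      -- the spectrum
      FokkerPlanck.spectrum (FokkerPlanck.perturbedOp c β Θ) =
        FokkerPlanck.spectrum (FokkerPlanck.fpOp c β) ∧
      FokkerPlanck.spectrum (FokkerPlanck.fpOp c β) =
        Set.range (FokkerPlanck.eigval c) ∧
      -- the eigenfunctions and eigenspaces
      (∀ k, Ψ (μ k) ≠ 0 ∧ Ψ (μ k) ∈ FokkerPlanck.eigenspace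
        (FokkerPlanck.perturbedOp c β Θ) (FokkerPlanck.eigval c k)) ∧
      (∀ z ∈ FokkerPlanck.spectrum (FokkerPlanck.perturbedOp c β Θ),
        FokkerPlanck.eigenspace (FokkerPlanck.perturbedOp c β Θ) z =
          Submodule.span ℂ ((fun k => Ψ (μ k)) '' {k | FokkerPlanck.eigval c k = z})) ∧
      -- the semigroup on `L²(ω)` and on the subspaces `𝓗_k`
      ∃ T : ℝ≥0 → FokkerPlanck.WL2 n β →L[ℂ] FokkerPlanck.WL2 n β,
        FokkerPlanck.IsC0Semigroup T ∧
        FokkerPlanck.IsGenerator (FokkerPlanck.perturbedOp c β Θ) T ∧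
        ∀ k : ℕ,
          IsClosed (FokkerPlanck.momentSpace n β k : Set (FokkerPlanck.WL2 n β)) ∧
          FokkerPlanck.MapsInto (FokkerPlanck.perturbedOp c β Θ)
            (FokkerPlanck.momentSpace n β k) ∧
          ∃ S : ℝ≥0 → FokkerPlanck.momentSpace n β k →L[ℂ] FokkerPlanck.momentSpace n β k,
            (∀ t f, (S t f : FokkerPlanck.WL2 n β) = T t f) ∧
            FokkerPlanck.IsC0Semigroup S ∧
            FokkerPlanck.IsGenerator (FokkerPlanck.part (FokkerPlanck.perturbedOp c β Θ)
              (FokkerPlanck.momentSpace n β k)) S ∧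
            ∃ C : ℝ, 0 < C ∧ ∀ t : ℝ≥0, ‖S t‖ ≤ C * Real.exp (-(t * k * c 0)) := by
  open FokkerPlanck in
    obtain ⟨M, hM⟩ := hθ.bounded
    obtain ⟨M', hM'⟩ := hθ.log_re_bounded
    obtain ⟨Θ, hΘ⟩ := exists_multiplier hβ hθ.analytic hM
    obtain ⟨Ψ, hΨ, hΨ'⟩ := exists_equiv_of_exp hβ hθ.log_analytic hM'
    have hnorm : ∀ ξ : E n, ‖psiSymbol c F (toComplex ξ)‖ ≤ Real.exp M' := fun ξ => by
      rw [psiSymbol, Complex.norm_exp]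
      exact Real.exp_le_exp.2 (abs_le.1 (hM' _ (toComplex_mem_tube hβ ξ))).2
    have hcont : Continuous fun ξ : E n => psiSymbol c F (toComplex ξ) :=
      Complex.continuous_exp.comp (hθ.log_analytic.continuousOn.comp_continuous
        (by unfold toComplex; fun_prop) (toComplex_mem_tube hβ))
    obtain ⟨ψ, hψ⟩ := exists_hasFourier hcont.aestronglyMeasurable hnorm
    have hsim := mem_graph_perturbedOp_iff_of_multiplier hc hβ
      (hasDerivAt_logSymbol hc hβ hθ.analytic hM hθ.massless) hΨ hΨ' hΘ
    have hspec := spectrum_eq_of_similar Ψ hsim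
    have hT := isRealSemigroup_ou (β := β) hc hβ
    have hsim' : ∀ x y, (x, y) ∈ genGraph (ou hc hβ) ↔
        (Ψ x, Ψ y) ∈ (perturbedOp c β Θ).graph := fun x y => by
      rw [← hsim, graph_fpOp hc hβ]
    have hgen := isGenerator_conj hT hsim'
    have h0 := zero_mem_tube (n := n) hβ
    have hΨmem : ∀ k, ∀ f ∈ momentSpace n β k, Ψ f ∈ momentSpace n β k := fun k f hf =>
      mem_momentSpace_of_multiplier hβ (m := fun z => Complex.exp (logSymbol c F z))
        (hθ.log_analytic.cexp 0 h0).continuousAt (hΨ f) hf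
    have hΨmem' : ∀ k, ∀ f ∈ momentSpace n β k, Ψ.symm f ∈ momentSpace n β k := fun k f hf =>
      mem_momentSpace_of_multiplier hβ (m := fun z => Complex.exp (-logSymbol c F z))
        (hθ.log_analytic.neg.cexp 0 h0).continuousAt (hΨ' f) hf
    -- All three factors of Ψ T(t) Ψ⁻¹ preserve 𝓗_k: the outer ones have symbols continuous at 0,
    -- and the middle one rescales rays.
    have hinv : ∀ k (t : ℝ≥0), ∀ f ∈ momentSpace n β k,
        conjSemigroup Ψ (ou hc hβ) t f ∈ momentSpace n β k := fun k t f hf =>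
      hΨmem k _ (ou_mem_momentSpace hc hβ t.2 (hΨmem' k f hf))
    refine ⟨?_, Θ, ψ, Ψ, muL hc hβ.le, fun f => isConvolution_of_FL_eq hβ hθ.fourier (hΘ f), hψ,
      fun f => isConvolution_of_FL_eq hβ hψ (hΨ f), coeFn_muL hc hβ.le, hsim, hspec,
      spectrum_fpOp hc hβ, fun k => ⟨?_, ?_⟩, fun z _ => ?_, conjSemigroup Ψ (ou hc hβ),
      hT.isC0Semigroup_conj Ψ, hgen, fun k => ⟨isClosed_momentSpace hβ k, ?_,
      restrictSemigroup _ (hinv k), fun _ _ => rfl, (hT.isC0Semigroup_conj Ψ).restrict (hinv k),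
      hgen.part (hinv k), ?_⟩⟩
    · rw [graph_fpOp hc hβ, topologicalClosure_testGraph hc hβ]
    · exact (map_ne_zero_iff Ψ Ψ.injective).2 (muL_ne_zero hc hβ k)
    · rw [mem_eigenspace_iff, ← map_smul, ← hsim']
      exact muL_mem_genGraph hc hβ k
    · rw [eigenspace_eq_map_of_similar Ψ hsim, eigenspace_fpOp hc hβ, Submodule.map_span,
        ← Set.image_comp]
      rfl
    · exact mapsInto_perturbedOp hc hβ fun f hf =>
        mem_momentSpace_of_multiplier hβ (hθ.analytic 0 h0).continuousAt (hΘ f) hf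
    · obtain ⟨C, hC, hb⟩ := exists_norm_ou_le_of_mem hc hβ (hc 0)
        (fun i => hmono (Fin.zero_le i)) k
      -- The condition number of Ψ times the unperturbed constant; adding 1 to each norm makes
      -- positivity immediate.
      refine ⟨(‖(Ψ : WL2 n β →L[ℂ] WL2 n β)‖ + 1) * C *
        (‖(Ψ.symm : WL2 n β →L[ℂ] WL2 n β)‖ + 1), by positivity, fun t => ?_⟩
      refine ContinuousLinearMap.opNorm_le_bound _ (by positivity) fun f => ?_
      rw [Submodule.coe_norm, coe_restrictSemigroup, conjSemigroup_apply]
      calc ‖Ψ (ou hc hβ t (Ψ.symm f))‖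
          ≤ ‖(Ψ : WL2 n β →L[ℂ] WL2 n β)‖ * ‖ou hc hβ t (Ψ.symm f)‖ :=
            (Ψ : WL2 n β →L[ℂ] WL2 n β).le_opNorm _
        _ ≤ (‖(Ψ : WL2 n β →L[ℂ] WL2 n β)‖ + 1) * (C * Real.exp (-(t * k * c 0)) *
            ((‖(Ψ.symm : WL2 n β →L[ℂ] WL2 n β)‖ + 1) * ‖(f : WL2 n β)‖)) := by
            refine mul_le_mul (by linarith) ((hb t t.2 _ (hΨmem' k f f.2)).trans ?_)
              (norm_nonneg _) (by positivity)
            refine mul_le_mul_of_nonneg_left ?_ (by positivity)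
            refine ((Ψ.symm : WL2 n β →L[ℂ] WL2 n β).le_opNorm _).trans ?_
            exact mul_le_mul_of_nonneg_right (by linarith) (norm_nonneg _)
        _ = _ := by
            rw [Submodule.coe_norm]
            ring
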